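/- **Setting.** Let $(V,E)$ be a simple graph with $n\ge 1$ nodes and let $P\in\mathbb R^{n\times n}$ be a doubly stochastic normal matrix ($PP^\top=P^\top P$; e.g. $P$ symmetric) supported on the graph: for $v\neq w$, $P_{vw}\ne 0$ only if $\{v,w\}\in E$. Let $\sigma_2=\sigma_2(P)$ be the second largest modulus of an eigenvalue of $P$ (with multiplicity; $\sigma_2=0$ if $n=1$), and assume $\sigma_2<1$. Let $Z_{v,i}$, $v\in V$, $1\le i\le m$ (with $m\geq 1$), be i.i.d. observations in a measurable space $\mathcal Z$ and let $Z$ be a further observation with the same law. Let $\ell:\mathbb R^d\times\mathcal Z\to\mathbb R$ be such that every $\ell(\cdot,z)$ is convex and $L$-Lipschitz, $\ell(0,z)\le B$ and $\ell(x,z)\ge C$ for all $x,z$, and for all $z_1,\dots,z_{nm}\in\mathcal Z$ and all bounded $\widetilde{\mathcal X}\subseteq\mathbb R^d$, $$\mathbf E\sup_{x\in\widetilde{\mathcal X}}\frac1{nm}\sum_{i=1}^{nm}\varepsilon_i\,\ell(x,z_i)\le D\,\frac{\sup_{x\in\widetilde{\mathcal X}}\|x\|}{\sqrt{nm}}$$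 with independent uniform signs $\varepsilon_i$. Here $L,G>0$, $D\ge0$, $C\le B$. Put $r(x)=\mathbf E\,\ell(x,Z)$ and $R(x)=\frac1{nm}\sum_{v,i}\ell(x,Z_{v,i})$; assume that $r$ has a minimiser $x^\star$ and that almost surely $R$ has a minimiser $X^\star$ with $\|X^\star\|\le G$. Distributed SGD with step size $\eta$ is $X^1_v=0$ and, for $s\ge1$, $$X^{s+1}_v=\sum_{w\in V}P_{vw}\big(X^s_w-\eta\,\partial\ell(X^s_w,Z_{w,K^{s+1}_w})\big),$$ where $\partial\ell(x,z)$ is a (measurable) choice of a subgradient of $\ell(\cdot,z)$ at $x$, each $K^s_v$ is uniform on $\{1,\dots,m\}$, and the vectors $(K^s_v)_{v\in V}$, $s\ge2$, are independent of each other and jointly independent of the data. The test error of node $v$ at time $t$ is $\mathrm{Err}_v(\eta,t)=\mathbf E\,r\big(\frac1t\sum_{s=1}^tX^s_v\big)-r(x^\star)$. **Step sizes.** $$\eta^\star=\frac{G}{L\sqrt{19t}},\qquad \eta^\star_{\mathrm{Opt}}=\frac{G}{L\sqrt{19t}}\sqrt{\frac{1-\sigma_2}{\log(t\sqrt n)}},\qquad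 \eta^\star_{\mathrm{Test}}=\frac{G}{L\sqrt t}\Big(\frac{19}{2}\frac{\log(t\sqrt n)}{1-\sigma_2}+\frac{t}{(nm)^{2/3}}\Big)^{-1/2}.$$ Let $\Lambda=1+\log(nmt)$, and let $N=nm$. **Claim.** There is a constant $K>0$ that depends only on $L,B,C,D,G$ (not on $n,m,t,d,P$, the graph, the loss, or the data distribution) such that the following holds. 1. *(Step sizes.)* For all $t\ge1$ with $tn\ge2$ and all $\sigma_2\in[0,1)$: up to a factor $K$, $\eta^\star$ equals $1/\sqrt t$; up to a factor $K\Lambda$, $\eta^\star_{\mathrm{Opt}}$ equals $\sqrt{(1-\sigma_2)/t}$ and $\eta^\star_{\mathrm{Test}}$ equals $\frac1{\sqrt t}\big(\frac9{1-\sigma_2}+\frac{t}{N^{2/3}}\big)^{-1/2}$ (each in both directions). The step size $\eta^\star_{\mathrm{Opt}}$ minimises over $\eta>0$ the optimisation error bound $b(\eta)=\frac{19}2\frac{\eta L^2\log(t\sqrt n)}{1-\sigma_2}+\frac{G^2}{2\eta t}$. If $D>0$, $C<B$, $t\ge2$, then $\eta^\star_{\mathrm{Test}}$ minimises, up to a factor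 $K$, the test error bound $2D\sqrt{(t-1)(\eta^2L^2+2\eta(B-C))/N}+b(\eta)$ over $\eta>0$. 2. *(Test error at time $t$.)* In every such setting, for all $v\in V$, $t\ge1$ (and $tn\ge2$ for $\eta^\star_{\mathrm{Opt}}$), $$\mathrm{Err}_v(\eta^\star,t)\le K\Lambda\Big(\frac1{(1-\sigma_2)\sqrt t}+\sqrt{\frac{\sqrt t}{N}}\Big),\qquad \mathrm{Err}_v(\eta^\star_{\mathrm{Opt}},t)\le K\Lambda\Big(\frac1{\sqrt{t(1-\sigma_2)}}+\sqrt{\frac{\sqrt{t(1-\sigma_2)}}{N}}\Big),$$ $$\mathrm{Err}_v(\eta^\star_{\mathrm{Test}},t)\le K\Lambda\Big(\frac1{\sqrt{t(1-\sigma_2)}}+\frac1{N^{1/3}}\Big).$$ 3. *(Test error at the early stopping time.)* Put $T^\star=N^{2/3}/(1-\sigma_2)^{4/3}$ and $T=N^{2/3}/(1-\sigma_2)$. For all $a>0$ and $q\in\{0,1,2,\dots\}$ there is a constant $K'$ depending only on $a,q,L,B,C,D,G$ such that in every such setting, for all $v$ and all $t\ge1$: - if $t\le a\Lambda^qT^\star$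 and $T^\star\le a\Lambda^qt$, then $\mathrm{Err}_v(\eta^\star,t)\le K'\Lambda^{q+1}\,(N(1-\sigma_2))^{-1/3}$; - if $tn\ge2$, $t\le a\Lambda^qT$ and $T\le a\Lambda^qt$, then $\mathrm{Err}_v(\eta^\star_{\mathrm{Opt}},t)\le K'\Lambda^{q+1}N^{-1/3}$; - if $T\le a\Lambda^qt$, then $\mathrm{Err}_v(\eta^\star_{\mathrm{Test}},t)\le K'\Lambda^{q+1}N^{-1/3}$. 4. *(These are the stopping times and rates that the bounds in 2 prescribe.)* For all $n,m,t\ge1$ and $\sigma_2\in[0,1)$, the three expressions in parentheses in 2 are at least $(N(1-\sigma_2))^{-1/3}$, $N^{-1/3}$ and $N^{-1/3}$ respectively. If for some $\kappa$ such an expression is at most $\kappa$ times this lower bound, then, respectively, $\kappa^{-2}T^\star\le t\le\kappa^4T^\star$; $\kappa^{-2}T\le t\le\kappa^4T$; $\kappa^{-2}T\le t$. -/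

import Mathlib

open MeasureTheory ProbabilityTheory

set_option linter.checkUnivs false

universe u v

/-- The second largest absolute value of an eigenvalue of a real square matrix: the complex
eigenvalues are listed with multiplicity by decreasing modulus, and the second entry is taken
(it is `0` for a matrix of size at most one). -/
noncomputable def secondEigenvalue {n : ℕ} (P : Matrix (Fin n) (Fin n) ℝ) : ℝ :=
  (((P.map (algebraMap ℝ ℂ)).charpoly.roots.map (fun z => ‖z‖)).sort (· ≥ ·)).getD 1 0

/-- The empirical Rademacher complexity
`𝐄 sup_{x ∈ X} (1/N) ∑ i, ε i * ℓ(x, z i)` of the sample `z`, where `N` is the number of sample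
points and `ε` is a vector of independent uniform signs
(so that the mean is the average over the `2 ^ N` sign vectors). -/
noncomputable def rademacherComplexity {ι : Type*} [Fintype ι] [DecidableEq ι]
    {E : Type*} {𝒵 : Type*} (ℓ : E → 𝒵 → ℝ) (X : Set E) (z : ι → 𝒵) : ℝ :=
  (∑ ε : ι → Bool,
      sSup ((fun x => (∑ i, (if ε i then (1 : ℝ) else -1) * ℓ x (z i)) / Fintype.card ι) '' X))
    / 2 ^ Fintype.card ι

/-- A decentralised learning problem with `n` nodes, `m` data points per node, and convex
`L`-Lipschitz losses, together with the randomness of distributed stochastic subgradient descent.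
The losses are bounded above by `B` at the origin and bounded below by `C`, the Rademacher
complexity is controlled by `D`, and the empirical risk has a minimiser of norm at most `G`. -/
structure DistributedProblem (n m : ℕ) (L B C D G : ℝ) where
  /-- The dimension of the parameter space. -/
  d : ℕ
  /-- The communication graph on the nodes. -/
  graph : SimpleGraph (Fin n)
  /-- The communication matrix. -/
  P : Matrix (Fin n) (Fin n) ℝ
  doubly_stochastic : P ∈ doublyStochastic ℝ (Fin n)
  supported : ∀ v w, v ≠ w → P v w ≠ 0 → graph.Adj v w
  normal : P * P.transpose = P.transpose * P
  spectral_gap : secondEigenvalue P < 1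
  /-- The space of observations, with the distribution `μ` of an observation. -/
  𝒵 : Type u
  [measurableSpace_obs : MeasurableSpace 𝒵]
  μ : Measure 𝒵
  [isProb_obs : IsProbabilityMeasure μ]
  /-- The loss function `ℓ(x, z)`. -/
  loss : EuclideanSpace ℝ (Fin d) → 𝒵 → ℝ
  loss_measurable : ∀ x, Measurable (loss x)
  loss_convex : ∀ z, ConvexOn ℝ Set.univ (fun x => loss x z)
  loss_lipschitz : ∀ z x y, |loss x z - loss y z| ≤ L * ‖x - y‖
  loss_zero_le : ∀ z, loss 0 z ≤ B
  le_loss : ∀ x z, C ≤ loss x z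
  rademacher_le : ∀ (z : Fin n × Fin m → 𝒵) (X : Set (EuclideanSpace ℝ (Fin d))),
    Bornology.IsBounded X →
      rademacherComplexity loss X z ≤ D * sSup ((fun x => ‖x‖) '' X) / √((n : ℝ) * m)
  /-- The subgradient oracle: an element of the subdifferential of `ℓ(·, z)` at `x`. -/
  subgrad : EuclideanSpace ℝ (Fin d) → 𝒵 → EuclideanSpace ℝ (Fin d)
  subgrad_measurable : Measurable (Function.uncurry subgrad)
  subgrad_spec : ∀ z x y, loss x z + inner ℝ (subgrad x z) (y - x) ≤ loss y z
  /-- The underlying probability space. -/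
  Ω : Type v
  [measurableSpace_prob : MeasurableSpace Ω]
  Pr : Measure Ω
  [isProb_prob : IsProbabilityMeasure Pr]
  /-- `Z v i` is the `i`-th data point of node `v`; the data points are i.i.d. with law `μ`. -/
  Z : Fin n → Fin m → Ω → 𝒵
  Z_measurable : ∀ v i, Measurable (Z v i)
  Z_law : ∀ v i, Pr.map (Z v i) = μ
  Z_indep : iIndepFun (fun (p : Fin n × Fin m) => Z p.1 p.2) Pr
  /-- `K s v` is the index of the data point that node `v` draws in the `s`-th update,
  `s = 0, 1, 2, …`. -/
  K : ℕ → Fin n → Ω → Fin m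
  K_measurable : ∀ s v, Measurable (K s v)
  K_uniform : ∀ s v k, Pr (K s v ⁻¹' {k}) = (m : ENNReal)⁻¹
  K_indep : iIndepFun (fun (s : ℕ) (ω : Ω) (v : Fin n) => K s v ω) Pr
  Z_K_indep : IndepFun (fun (ω : Ω) (p : Fin n × Fin m) => Z p.1 p.2 ω)
    (fun (ω : Ω) (q : ℕ × Fin n) => K q.1 q.2 ω) Pr
  /-- A minimiser of the test risk. -/
  xStar : EuclideanSpace ℝ (Fin d)
  xStar_spec : IsMinOn (fun x => ∫ z, loss x z ∂μ) Set.univ xStar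
  /-- A minimiser of the global empirical risk. -/
  XStar : Ω → EuclideanSpace ℝ (Fin d)
  XStar_spec : ∀ᵐ ω ∂Pr,
    IsMinOn (fun x => (∑ v, ∑ i, loss x (Z v i ω)) / ((n : ℝ) * m)) Set.univ (XStar ω)
  XStar_norm_le : ∀ᵐ ω ∂Pr, ‖XStar ω‖ ≤ G

namespace DistributedProblem

attribute [instance] measurableSpace_obs isProb_obs measurableSpace_prob isProb_prob

variable {n m : ℕ} {L B C D G : ℝ}

/-- The quantity `σ₂(P)` of the communication matrix. -/
noncomputable def σ₂ (S : DistributedProblem.{u, v} n m L B C D G) : ℝ := secondEigenvalue S.P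

/-- The test risk `r(x) = 𝐄 ℓ(x, Z)`. -/
noncomputable def risk (S : DistributedProblem.{u, v} n m L B C D G)
    (x : EuclideanSpace ℝ (Fin S.d)) : ℝ := ∫ z, S.loss x z ∂S.μ

/-- Distributed stochastic subgradient descent with step size `η`, started at `0` in every node.
`S.iterate η ω s v` is the model of node `v` after `s` updates: `X^{s+1}_v` when the initial
models are called `X^1_v`. -/
noncomputable def iterate (S : DistributedProblem.{u, v} n m L B C D G) (η : ℝ) (ω : S.Ω) :
    ℕ → Fin n → EuclideanSpace ℝ (Fin S.d)
  | 0, _ => 0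
  | s + 1, v => ∑ w, S.P v w •
      (S.iterate η ω s w - η • S.subgrad (S.iterate η ω s w) (S.Z w (S.K s w ω) ω))

/-- The ergodic average `(1/t) ∑_{s=1}^t X^s_v`. -/
noncomputable def average (S : DistributedProblem.{u, v} n m L B C D G) (η : ℝ) (t : ℕ)
    (v : Fin n) (ω : S.Ω) : EuclideanSpace ℝ (Fin S.d) :=
  (t : ℝ)⁻¹ • ∑ s ∈ Finset.range t, S.iterate η ω s v

/-- The test error `𝐄 r((1/t) ∑_{s=1}^t X^s_v) - r(x⋆)`. -/
noncomputable def testError (S : DistributedProblem.{u, v} n m L B C D G) (η : ℝ) (t : ℕ)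
    (v : Fin n) : ℝ :=
  (∫ ω, S.risk (S.average η t v ω) ∂S.Pr) - S.risk S.xStar

end DistributedProblem

/-- The optimisation error bound as a function of the step size `η`. -/
noncomputable def optBound (L G : ℝ) (n t : ℕ) (σ η : ℝ) : ℝ :=
  19 / 2 * (η * L ^ 2 * Real.log (t * √n) / (1 - σ)) + G ^ 2 / (2 * η * t)

/-- The test error bound as a function of the step size `η`: generalisation error bound plus
optimisation error bound. -/
noncomputable def testBound (L B C D G : ℝ) (n m t : ℕ) (σ η : ℝ) : ℝ :=
  2 * D * √(((t : ℝ) - 1) * (η ^ 2 * L ^ 2 + 2 * η * (B - C)) / ((n : ℝ) * m))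
    + optBound L G n t σ η

/-- The step size `η⋆` of centralised stochastic gradient descent. -/
noncomputable def etaStar (L G : ℝ) (t : ℕ) : ℝ := G / (L * √(19 * t))

/-- The step size `η⋆_Opt`. -/
noncomputable def etaOpt (L G : ℝ) (n t : ℕ) (σ : ℝ) : ℝ :=
  G / (L * √(19 * t)) * √((1 - σ) / Real.log (t * √n))

/-- The step size `η⋆_Test`. -/
noncomputable def etaTest (L G : ℝ) (n m t : ℕ) (σ : ℝ) : ℝ :=
  G / (L * √t) *
    (1 / √(19 / 2 * (Real.log (t * √n) / (1 - σ)) + t / ((n : ℝ) * m) ^ ((2 : ℝ) / 3)))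

/-- The order of the test error bound for `η⋆` at time `t`. -/
noncomputable def rateStar (n m t : ℕ) (σ : ℝ) : ℝ :=
  1 / ((1 - σ) * √t) + √(√t / ((n : ℝ) * m))

/-- The order of the test error bound for `η⋆_Opt` at time `t`. -/
noncomputable def rateOpt (n m t : ℕ) (σ : ℝ) : ℝ :=
  1 / √(t * (1 - σ)) + √(√(t * (1 - σ)) / ((n : ℝ) * m))

/-- The order of the test error bound for `η⋆_Test` at time `t`. -/
noncomputable def rateTest (n m t : ℕ) (σ : ℝ) : ℝ :=
  1 / √(t * (1 - σ)) + 1 / ((n : ℝ) * m) ^ ((1 : ℝ) / 3)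

/-- The early stopping time for `η⋆`, up to constants and logarithms. -/
noncomputable def stopStar (n m : ℕ) (σ : ℝ) : ℝ :=
  ((n : ℝ) * m) ^ ((2 : ℝ) / 3) / (1 - σ) ^ ((4 : ℝ) / 3)

/-- The early stopping time for `η⋆_Opt` and `η⋆_Test`, up to constants and logarithms. -/
noncomputable def stopGraph (n m : ℕ) (σ : ℝ) : ℝ :=
  ((n : ℝ) * m) ^ ((2 : ℝ) / 3) / (1 - σ)

/-- The logarithmic factor. -/
noncomputable def logFactor (n m t : ℕ) : ℝ := 1 + Real.log ((n : ℝ) * m * t)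

/-- `x` and `y` agree up to the factor `c * Λ ^ q`. -/
def AgreeUpTo (c : ℝ) (q : ℕ) (Λ x y : ℝ) : Prop :=
  x ≤ c * Λ ^ q * y ∧ y ≤ c * Λ ^ q * x

/-!
Fix a step size `η` and write `σ = σ₂(P)`, `N = n * m`. The test error of the ergodic average `X` of
a node splits as `𝐄 (r(X) - R(X)) + 𝐄 (R(X) - R(x⋆)) + (𝐄 R(x⋆) - r(x⋆))`, where the last term
vanishes.

*Generalisation.* Since `⟪∂ℓ(x, z), x⟫ ≥ C - B`, the squared norm of a model grows by at most
`η² L² + 2 η (B - C)` per update (`norm_gossipDescent_le`), so `X` stays in a deterministic ball.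
By symmetrisation (`integral_sup_mean_sub_le`) the first term is at most twice the Rademacher
complexity of that ball.

*Optimisation.* Condition on the data. The mean of the models over the nodes performs subgradient
descent with subgradients taken at the models of the nodes, so the usual regret bound
`G² / (2 η t) + η L² / 2` holds up to a multiple of `L` times the distance of the models to their
mean (`sum_inner_gossipDescent_le`, `integral_gossipDescent_average_sub_le`). Unrolling the
recursion, this distance is at most `η L ∑_j ∑_w |(P^j)_{vw} - 1/n|`. For a normal matrix the
operator norm is the spectral radius, hence `P - 𝟙𝟙ᵀ/n` has norm at most `σ`
(`l2_opNorm_sub_average_le`) and the inner sum is at most `min 2 (√n σ^j)`, which sums up to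
`(3 + log n) / (1 - σ)`. For almost all data the empirical minimiser lies in the ball of radius `G`
and is at least as good as `x⋆` on the data, which turns this into a bound on `R(X) - R(x⋆)`;
no measurable choice of the minimiser is needed.

Both bounds together give `DistributedProblem.testError_le`. With `η = (G / L) * (y / t)` it becomes
a bound in terms of `y` alone, of order `1 / y + y / (t (1 - σ))` plus the generalisation term, and
the three step sizes correspond to three choices of `y`. In suitable variables each of the rates
is `1 / u + √(u / p ^ 3)`, or `1 / u + 1 / p` for `etaTest`. The former is smallest, up to
constants, at `u = p`, the latter for all `u` from `p` on, which explains the early stopping times.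
-/

/-! ### Communication matrices and their second eigenvalue -/

/-- Two entries that are at least `c` force the second entry of the decreasing list to be so. -/
theorem le_getD_one_sort_of_pair_le {s : Multiset ℝ} {a b c : ℝ} (h : {a, b} ≤ s) (ha : c ≤ a)
    (hb : c ≤ b) : c ≤ (s.sort (· ≥ ·)).getD 1 0 := by
  have hsorted := Multiset.pairwise_sort s (· ≥ ·)
  have hcount : 2 ≤ (s.sort (· ≥ ·)).countP (fun x => c ≤ x) := by
    have h1 : Multiset.countP (fun x => c ≤ x) ({a, b} : Multiset ℝ) = 2 := by
      have : ({a, b} : Multiset ℝ) = a ::ₘ b ::ₘ 0 := rfl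
      rw [this, Multiset.countP_cons_of_pos _ ha, Multiset.countP_cons_of_pos _ hb,
        Multiset.countP_zero]
    have h2 := Multiset.countP_le_of_le (fun x => c ≤ x) h
    rw [h1, ← Multiset.sort_eq s (· ≥ ·), Multiset.coe_countP] at h2
    exact h2
  match hl : s.sort (· ≥ ·), hsorted, hcount with
  | [], _, hc => simp at hc
  | [x], _, hc => 
    have := List.countP_le_length (p := fun y => decide (c ≤ y)) (l := [x])
    simp at this hc; omega
  | x :: y :: l, hs, hc =>
    by_contra hcon
    simp only [List.getD_cons_succ, List.getD_cons_zero, not_le] at hcon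
    have hz : (y :: l).countP (fun z => decide (c ≤ z)) = 0 := by
      rw [List.countP_eq_zero]
      intro z hz
      have : z ≤ y := by
        rcases List.mem_cons.1 hz with rfl | hz
        · exact le_rfl
        · exact (List.pairwise_cons.1 (List.pairwise_cons.1 hs).2).1 z hz
      simpa using lt_of_le_of_lt this hcon
    rw [List.countP_cons, hz] at hc
    split_ifs at hc <;> omega

theorem secondEigenvalue_nonneg {n : ℕ} (P : Matrix (Fin n) (Fin n) ℝ) :
    0 ≤ secondEigenvalue P := by
  unfold secondEigenvalue
  rw [List.getD_eq_getElem?_getD]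
  rcases h : (((P.map (algebraMap ℝ ℂ)).charpoly.roots.map (fun z => ‖z‖)).sort (· ≥ ·))[1]?
    with _ | x
  · simp
  · have := List.mem_of_getElem? h
    rw [Multiset.mem_sort, Multiset.mem_map] at this
    obtain ⟨z, _, rfl⟩ := this
    simp

open Matrix in
/-- Two independent eigenvectors give two entries of the list of eigenvalues.
The case `z = 1` needs the multiplicity of the eigenvalue, hence the generalised eigenspace. -/
theorem pair_le_charpoly_roots {n : ℕ} (M : Matrix (Fin n) (Fin n) ℂ) {u x : Fin n → ℂ} {z : ℂ}
    (hu : M *ᵥ u = u) (hu0 : u ≠ 0) (hx : M *ᵥ x = z • x) (hx0 : x ≠ 0)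
    (hux : ∀ c : ℂ, x ≠ c • u) : ({1, z} : Multiset ℂ) ≤ M.charpoly.roots := by
  have hroot : ∀ (w : ℂ) (y : Fin n → ℂ), y ≠ 0 → M *ᵥ y = w • y → w ∈ M.charpoly.roots := by
    intro w y hy hMy
    rw [Polynomial.mem_roots (charpoly_monic M).ne_zero, ← Matrix.mem_spectrum_iff_isRoot_charpoly,
      ← Matrix.spectrum_toLin']
    refine Module.End.HasEigenvalue.mem_spectrum ?_
    exact Module.End.hasEigenvalue_of_hasEigenvector (x := y)
      ⟨by rw [Module.End.mem_eigenspace_iff]; simpa using hMy, hy⟩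
  by_cases hz : z = 1
  · subst hz
    have h2 : 2 ≤ M.charpoly.rootMultiplicity 1 := by
      have hf := LinearMap.finrank_maxGenEigenspace_eq (Matrix.toLin' M) 1
      rw [Matrix.charpoly_toLin'] at hf
      rw [← hf]
      have hmem : ∀ y : Fin n → ℂ, M *ᵥ y = y →
          y ∈ Module.End.maxGenEigenspace (Matrix.toLin' M) 1 := by
        intro y hy
        rw [Module.End.mem_maxGenEigenspace]
        exact ⟨1, by simp [hy]⟩
      have hli : LinearIndependent ℂ ![(⟨u, hmem u hu⟩ : Module.End.maxGenEigenspace (Matrix.toLin' M) 1),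
          ⟨x, hmem x (by simpa using hx)⟩] := by
        rw [LinearIndependent.pair_iff' (by simpa [Subtype.ext_iff] using hu0)]
        intro a ha
        exact hux a (by simpa [Subtype.ext_iff] using ha.symm)
      simpa using hli.fintype_card_le_finrank
    have : ({1, 1} : Multiset ℂ) = Multiset.replicate 2 1 := rfl
    rw [this, ← Multiset.le_count_iff_replicate_le, Polynomial.count_roots]
    exact h2
  · rw [Multiset.le_iff_subset (by simp [Ne.symm hz])]
    intro w hw
    simp only [Multiset.insert_eq_cons, Multiset.mem_cons, Multiset.mem_singleton] at hw
    rcases hw with rfl | rfl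
    · exact hroot 1 u hu0 (by simpa using hu)
    · exact hroot w x hx0 hx

open Matrix in
/-- An eigenvector orthogonal to the constants yields an eigenvalue besides the eigenvalue `1` of the
constant vector. Without the spectral gap only `min 1 ‖z‖ ≤ secondEigenvalue P` would follow. -/
theorem norm_le_secondEigenvalue {n : ℕ} {P : Matrix (Fin n) (Fin n) ℝ}
    (hP : P ∈ doublyStochastic ℝ (Fin n)) (hgap : secondEigenvalue P < 1)
    {x : Fin n → ℂ} {z : ℂ} (hx : P.map (algebraMap ℝ ℂ) *ᵥ x = z • x) (hx0 : x ≠ 0)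
    (hsum : ∑ i, x i = 0) : ‖z‖ ≤ secondEigenvalue P := by
  have hn : n ≠ 0 := by
    rintro rfl; exact hx0 (Subsingleton.elim _ _)
  have h1 : P.map (algebraMap ℝ ℂ) *ᵥ 1 = 1 := by
    ext i
    have := sum_row_of_mem_doublyStochastic hP i
    simp only [mulVec, dotProduct, map_apply, Pi.one_apply, mul_one]
    rw [← map_sum, this, map_one]
  have hpair := pair_le_charpoly_roots (P.map (algebraMap ℝ ℂ)) h1
    (by have : NeZero n := ⟨hn⟩
        intro h; simpa using congrFun h 0) hx hx0 (by
      rintro c rfl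
      have : (n : ℂ) * c = 0 := by simpa using hsum
      rcases mul_eq_zero.1 this with h | h
      · exact hn (by exact_mod_cast h)
      · simp [h] at hx0)
  have hpair' := Multiset.map_le_map (f := fun w : ℂ => ‖w‖) hpair
  have key := le_getD_one_sort_of_pair_le (c := min 1 ‖z‖) (a := 1) (b := ‖z‖)
    (by simpa using hpair') (min_le_left _ _) (min_le_right _ _)
  change min 1 ‖z‖ ≤ secondEigenvalue P at key
  rcases min_le_iff.1 key with h | h
  · linarith
  · exact h

open Matrix in
open scoped Matrix.Norms.L2Operator in
/-- A normal matrix has operator norm equal to its spectral radius; subtracting the projection onto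
the constants removes the eigenvalue `1` of the constant vector, so what is left is at most
`secondEigenvalue P`. -/
theorem l2_opNorm_sub_average_le {n : ℕ} {P : Matrix (Fin n) (Fin n) ℝ}
    (hP : P ∈ doublyStochastic ℝ (Fin n)) (hnormal : P * P.transpose = P.transpose * P)
    (hgap : secondEigenvalue P < 1) :
    ‖(P - of fun _ _ => (n : ℝ)⁻¹).map (algebraMap ℝ ℂ)‖ ≤ secondEigenvalue P := by
  set Q : Matrix (Fin n) (Fin n) ℝ := P - of fun _ _ => (n : ℝ)⁻¹ with hQ
  have hJP : (of fun _ _ => (n : ℝ)⁻¹) * P = (of fun _ _ => (n : ℝ)⁻¹) := by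
    ext i j
    simp [mul_apply, ← Finset.mul_sum, sum_col_of_mem_doublyStochastic hP j]
  have hPJ : P * (of fun _ _ => (n : ℝ)⁻¹) = (of fun _ _ => (n : ℝ)⁻¹) := by
    ext i j
    simp [mul_apply, ← Finset.sum_mul, sum_row_of_mem_doublyStochastic hP i]
  have hJt : (of fun _ _ => (n : ℝ)⁻¹ : Matrix (Fin n) (Fin n) ℝ)ᵀ = of fun _ _ => (n : ℝ)⁻¹ := by
    ext; simp
  have hJPt : (of fun _ _ => (n : ℝ)⁻¹) * Pᵀ = (of fun _ _ => (n : ℝ)⁻¹) := by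
    have := congrArg transpose hPJ
    rwa [transpose_mul, hJt] at this
  have hPtJ : Pᵀ * (of fun _ _ => (n : ℝ)⁻¹) = (of fun _ _ => (n : ℝ)⁻¹) := by
    have := congrArg transpose hJP
    rwa [transpose_mul, hJt] at this
  have hQn : Qᵀ * Q = Q * Qᵀ := by
    rw [hQ, transpose_sub, hJt]
    simp only [sub_mul, mul_sub, hJP, hPJ, hJPt, hPtJ, hnormal]
  have hstar : star (Q.map (algebraMap ℝ ℂ)) = Qᵀ.map (algebraMap ℝ ℂ) := by
    ext i j
    simp [star_apply]
  have : IsStarNormal (Q.map (algebraMap ℝ ℂ)) := by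
    refine ⟨?_⟩
    rw [hstar, Commute, SemiconjBy, ← Matrix.map_mul, ← Matrix.map_mul, hQn]
  have hrad := IsStarNormal.spectralRadius_eq_nnnorm (Q.map (algebraMap ℝ ℂ))
  have hle : spectralRadius ℂ (Q.map (algebraMap ℝ ℂ))
      ≤ ENNReal.ofNNReal (secondEigenvalue P).toNNReal := by
    unfold spectralRadius
    refine iSup₂_le fun z hz => ?_
    rw [ENNReal.coe_le_coe, ← NNReal.coe_le_coe, coe_nnnorm,
      Real.coe_toNNReal _ (secondEigenvalue_nonneg P)]
    rcases eq_or_ne z 0 with rfl | hz0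
    · simpa using secondEigenvalue_nonneg P
    rw [← Matrix.spectrum_toLin', ← Module.End.hasEigenvalue_iff_mem_spectrum] at hz
    obtain ⟨x, hx⟩ := hz.exists_hasEigenvector
    have hx1 : Q.map (algebraMap ℝ ℂ) *ᵥ x = z • x := by
      simpa using hx.apply_eq_smul
    have hcol : ∀ j, ∑ i, Q i j = 0 := by
      intro j
      have hn : (n : ℝ) ≠ 0 := by
        have : 0 < n := j.pos
        positivity
      simp [hQ, Finset.sum_sub_distrib, sum_col_of_mem_doublyStochastic hP j, hn]
    have hsum : ∑ i, x i = 0 := by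
      have h1 : ∑ i, (Q.map (algebraMap ℝ ℂ) *ᵥ x) i = 0 := by
        simp only [mulVec, dotProduct, map_apply]
        rw [Finset.sum_comm]
        refine Finset.sum_eq_zero fun j _ => ?_
        rw [← Finset.sum_mul, ← map_sum, hcol j, map_zero, zero_mul]
      rw [hx1] at h1
      simp only [Pi.smul_apply, smul_eq_mul, ← Finset.mul_sum] at h1
      exact (mul_eq_zero.1 h1).resolve_left hz0
    refine norm_le_secondEigenvalue hP hgap (x := x) ?_ hx.2 hsum
    rw [← hx1]
    ext i
    simp [hQ, mulVec, dotProduct, sub_mul, Finset.sum_sub_distrib, ← Finset.mul_sum, hsum]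
  rw [hrad, ENNReal.coe_le_coe, ← NNReal.coe_le_coe, coe_nnnorm,
    Real.coe_toNNReal _ (secondEigenvalue_nonneg P)] at hle
  exact hle

open Matrix in
open scoped Matrix.Norms.L2Operator in
/-- The deviation from the uniform matrix is a power, `P ^ j - J = (P - J) ^ j` where
`J` has all entries equal to `1 / n`, and the factor `√n`
comes from the Cauchy-Schwarz inequality on a row. -/
theorem sum_abs_pow_sub_le {n : ℕ} {P : Matrix (Fin n) (Fin n) ℝ}
    (hP : P ∈ doublyStochastic ℝ (Fin n)) (hnormal : P * P.transpose = P.transpose * P)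
    (hgap : secondEigenvalue P < 1) {j : ℕ} (hj : 1 ≤ j) (v : Fin n) :
    ∑ w, |(P ^ j) v w - (n : ℝ)⁻¹| ≤ √n * secondEigenvalue P ^ j := by
  set Q : Matrix (Fin n) (Fin n) ℝ := P - of fun _ _ => (n : ℝ)⁻¹ with hQ
  have hn : (n : ℝ) ≠ 0 := by
    have : 0 < n := v.pos
    positivity
  have hJP : (of fun _ _ => (n : ℝ)⁻¹) * P = (of fun _ _ => (n : ℝ)⁻¹) := by
    ext i j
    simp [mul_apply, ← Finset.mul_sum, sum_col_of_mem_doublyStochastic hP j]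
  have hpow : ∀ k : ℕ, Q ^ (k + 1) = P ^ (k + 1) - of fun _ _ => (n : ℝ)⁻¹ := by
    intro k
    induction k with
    | zero => simp [hQ]
    | succ k ih =>
      have hPJ : P ^ (k + 1) * (of fun _ _ => (n : ℝ)⁻¹) = (of fun _ _ => (n : ℝ)⁻¹) := by
        ext a b
        simp [mul_apply, ← Finset.sum_mul,
          sum_row_of_mem_doublyStochastic (pow_mem hP (k + 1)) a]
      have hJJ : (of fun _ _ => (n : ℝ)⁻¹ : Matrix (Fin n) (Fin n) ℝ)
          * (of fun _ _ => (n : ℝ)⁻¹) = (of fun _ _ => (n : ℝ)⁻¹) := by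
        ext a b
        simp [mul_apply, hn]
      rw [pow_succ, ih, hQ, sub_mul, mul_sub, mul_sub, ← pow_succ, hPJ, hJP, hJJ]
      simp
  obtain ⟨k, rfl⟩ : ∃ k, j = k + 1 := ⟨j - 1, by omega⟩
  have hentry : ∀ w, (P ^ (k + 1)) v w - (n : ℝ)⁻¹ = (Q ^ (k + 1)) v w := by
    intro w; rw [hpow]; simp
  simp only [hentry]
  set A := Q.map (algebraMap ℝ ℂ) with hA
  have hAn : ‖A ^ (k + 1)‖ ≤ secondEigenvalue P ^ (k + 1) :=
    (norm_pow_le' _ k.succ_pos).trans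
      (pow_le_pow_left₀ (norm_nonneg _) (l2_opNorm_sub_average_le hP hnormal hgap) _)
  have hAQ : A ^ (k + 1) = (Q ^ (k + 1)).map (algebraMap ℝ ℂ) := by
    simpa [hA, RingHom.mapMatrix_apply] using
      (map_pow ((algebraMap ℝ ℂ).mapMatrix (m := Fin n)) Q (k + 1)).symm
  have hrow : ∑ w, (Q ^ (k + 1)) v w ^ 2 ≤ (secondEigenvalue P ^ (k + 1)) ^ 2 := by
    have h := l2_opNorm_mulVec (A ^ (k + 1))ᴴ (EuclideanSpace.single v 1)
    rw [l2_opNorm_conjTranspose, PiLp.norm_single, norm_one, mul_one] at h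
    have h2 := pow_le_pow_left₀ (norm_nonneg _) (h.trans hAn) 2
    rw [EuclideanSpace.norm_sq_eq] at h2
    refine le_trans (le_of_eq ?_) h2
    refine Finset.sum_congr rfl fun w _ => ?_
    simp [hAQ, conjTranspose_apply]
  have hcs : (∑ w, |(Q ^ (k + 1)) v w|) ^ 2 ≤ n * ∑ w, (Q ^ (k + 1)) v w ^ 2 := by
    have := sq_sum_le_card_mul_sum_sq (s := Finset.univ) (f := fun w => |(Q ^ (k + 1)) v w|)
    simpa using this
  refine abs_le_of_sq_le_sq' ?_ (by have := secondEigenvalue_nonneg P; positivity) |>.2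
  rw [mul_pow, Real.sq_sqrt (by positivity)]
  exact hcs.trans (mul_le_mul_of_nonneg_left hrow (by positivity))

theorem sum_abs_pow_sub_le_two {n : ℕ} {P : Matrix (Fin n) (Fin n) ℝ}
    (hP : P ∈ doublyStochastic ℝ (Fin n)) (j : ℕ) (v : Fin n) :
    ∑ w, |(P ^ j) v w - (n : ℝ)⁻¹| ≤ 2 := by
  have hPj := pow_mem hP j
  have hn : (n : ℝ) ≠ 0 := by
    have : 0 < n := v.pos
    positivity
  calc ∑ w, |(P ^ j) v w - (n : ℝ)⁻¹| ≤ ∑ w, ((P ^ j) v w + (n : ℝ)⁻¹) := by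
        refine Finset.sum_le_sum fun w _ => ?_
        have h1 : 0 ≤ (P ^ j) v w := nonneg_of_mem_doublyStochastic hPj
        have h2 : 0 ≤ (n : ℝ)⁻¹ := by positivity
        rw [abs_le]; constructor <;> linarith
    _ = 2 := by
        rw [Finset.sum_add_distrib, sum_row_of_mem_doublyStochastic hPj v]
        simp [hn]; norm_num

/-- The geometric decay `√n * σ ^ j` takes over after about `log n / (1 - σ)` steps, before which
the bound `2` is used. -/
theorem sum_le_of_le_two_of_geometric {n : ℕ} (hn : 1 ≤ n) {σ : ℝ} (h0 : 0 ≤ σ) (h1 : σ < 1)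
    (f : ℕ → ℝ) (h2 : ∀ j, f j ≤ 2) (hgeo : ∀ j, f j ≤ √n * σ ^ j)
    (s : Finset ℕ) : ∑ j ∈ s, f j ≤ (3 + Real.log n) / (1 - σ) := by
  have hd : 0 < 1 - σ := by linarith
  have hn' : (1 : ℝ) ≤ n := by exact_mod_cast hn
  have hlog : 0 ≤ Real.log n := Real.log_nonneg hn'
  set j₀ := ⌈Real.log n / 2 / (1 - σ)⌉₊ with hj₀
  have hj1 : Real.log n / 2 / (1 - σ) ≤ j₀ := Nat.le_ceil _
  have hj2 : (j₀ : ℝ) < Real.log n / 2 / (1 - σ) + 1 := Nat.ceil_lt_add_one (by positivity)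
  have hsig : √n * σ ^ j₀ ≤ 1 := by
    have hexp : σ ≤ Real.exp (-(1 - σ)) := by
      have := Real.add_one_le_exp (-(1 - σ)); linarith
    have hp : σ ^ j₀ ≤ Real.exp (-(1 - σ)) ^ j₀ := pow_le_pow_left₀ h0 hexp _
    rw [← Real.exp_nat_mul] at hp
    have hsq : √(n : ℝ) = Real.exp (Real.log n / 2) := by
      rw [Real.exp_half, Real.exp_log (by linarith)]
    rw [hsq]
    calc _ ≤ Real.exp (Real.log n / 2) * Real.exp (j₀ * -(1 - σ)) := by gcongr
      _ = Real.exp (Real.log n / 2 - j₀ * (1 - σ)) := by rw [← Real.exp_add]; ring_nf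
      _ ≤ 1 := by
        rw [Real.exp_le_one_iff]
        rw [div_le_iff₀ hd] at hj1
        linarith
  have hA : ∑ j ∈ s with j < j₀, f j ≤ 2 * j₀ := by
    calc _ ≤ ∑ j ∈ s with j < j₀, (2 : ℝ) := Finset.sum_le_sum fun j _ => h2 j
      _ = 2 * ((s.filter (· < j₀)).card : ℝ) := by simp [mul_comm]
      _ ≤ 2 * j₀ := by
        have : (s.filter (· < j₀)).card ≤ j₀ := by
          calc _ ≤ (Finset.range j₀).card := Finset.card_le_card (by
                intro x hx; simp at hx ⊢; exact hx.2)
            _ = j₀ := by simp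
        have : ((s.filter (· < j₀)).card : ℝ) ≤ j₀ := by exact_mod_cast this
        linarith
  have hB : ∑ j ∈ s with ¬ j < j₀, f j ≤ 1 / (1 - σ) := by
    have hsum : Summable fun j : ℕ => σ ^ j := summable_geometric_of_lt_one h0 h1
    calc ∑ j ∈ s with ¬ j < j₀, f j ≤ ∑ j ∈ s with ¬ j < j₀, σ ^ (j - j₀) := by
          refine Finset.sum_le_sum fun j hj => (hgeo j).trans ?_
          have hle : j₀ ≤ j := not_lt.1 (Finset.mem_filter.1 hj).2
          have : σ ^ j = σ ^ j₀ * σ ^ (j - j₀) := by rw [← pow_add]; congr 1; omega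
          rw [this, ← mul_assoc]
          exact mul_le_of_le_one_left (by positivity) hsig
      _ = ∑ i ∈ (s.filter (¬ · < j₀)).image (· - j₀), σ ^ i := by
          rw [Finset.sum_image]
          intro a ha b hb hab
          simp at ha hb hab
          omega
      _ ≤ ∑' i : ℕ, σ ^ i := hsum.sum_le_tsum _ fun i _ => by positivity
      _ = 1 / (1 - σ) := by rw [tsum_geometric_of_lt_one h0 h1, one_div]
  rw [← Finset.sum_filter_add_sum_filter_not s (· < j₀)]
  have h3 : (1 : ℝ) ≤ 1 / (1 - σ) := by rw [le_div_iff₀ hd]; linarith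
  calc _ ≤ 2 * (j₀ : ℝ) + 1 / (1 - σ) := add_le_add hA hB
    _ ≤ 2 * (Real.log n / 2 / (1 - σ) + 1 / (1 - σ)) + 1 / (1 - σ) := by linarith
    _ = (3 + Real.log n) / (1 - σ) := by field_simp; ring

/-! ### Gossip subgradient descent along fixed directions -/

section Gossip

variable {n : ℕ} {E : Type*} [NormedAddCommGroup E] [InnerProductSpace ℝ E]

/-- Subgradient descent with communication matrix `P` and step size `η`, started at `0`, where node
`w` uses the vector field `g s w` in its `s`-th update. -/
noncomputable def gossipDescent (P : Matrix (Fin n) (Fin n) ℝ) (η : ℝ) (g : ℕ → Fin n → E → E) :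
    ℕ → Fin n → E
  | 0, _ => 0
  | s + 1, v => ∑ w, P v w • (gossipDescent P η g s w - η • g s w (gossipDescent P η g s w))

theorem gossipDescent_congr (P : Matrix (Fin n) (Fin n) ℝ) (η : ℝ) {g g' : ℕ → Fin n → E → E}
    {s : ℕ} (h : ∀ r < s, g r = g' r) : gossipDescent P η g s = gossipDescent P η g' s := by
  induction s with
  | zero => rfl
  | succ s ih =>
    ext v
    simp only [gossipDescent, ih fun r hr => h r (hr.trans s.lt_succ_self), h s s.lt_succ_self]

variable {P : Matrix (Fin n) (Fin n) ℝ} {η L : ℝ} {g : ℕ → Fin n → E → E}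

/-- Each direction has been averaged over the network once per update since it was used. -/
theorem gossipDescent_eq_sum (s : ℕ) (v : Fin n) :
    gossipDescent P η g s v = -η • ∑ k ∈ Finset.range s, ∑ w,
      (P ^ (s - k)) v w • g k w (gossipDescent P η g k w) := by
  induction s generalizing v with
  | zero => simp [gossipDescent]
  | succ s ih =>
    set X := gossipDescent P η g with hX
    have hs : ∀ k ∈ Finset.range s, ∑ w, (P ^ (s + 1 - k)) v w • g k w (X k w)
        = ∑ u, P v u • ∑ w, (P ^ (s - k)) u w • g k w (X k w) := by
      intro k hk
      have hk' : k < s := Finset.mem_range.1 hk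
      have : s + 1 - k = (s - k) + 1 := by omega
      rw [this, pow_succ']
      simp only [Matrix.mul_apply, Finset.sum_smul, Finset.smul_sum, smul_smul]
      rw [Finset.sum_comm]
    have h1 : X (s + 1) v = ∑ w, P v w • (X s w - η • g s w (X s w)) := rfl
    rw [h1, Finset.sum_range_succ, Finset.sum_congr rfl hs]
    simp only [smul_sub, Finset.sum_sub_distrib]
    rw [Finset.sum_comm, smul_add]
    simp only [← Finset.smul_sum]
    have h2 : ∑ w, P v w • X s w
        = -η • ∑ u, P v u • ∑ k ∈ Finset.range s, ∑ w, (P ^ (s - k)) u w • g k w (X k w) := by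
      rw [Finset.smul_sum]
      exact Finset.sum_congr rfl fun u _ => by rw [ih u, smul_comm]
    rw [h2, sub_eq_add_neg]
    congr 1
    simp only [add_tsub_cancel_left, pow_one, Finset.smul_sum, ← Finset.sum_neg_distrib]
    exact Finset.sum_congr rfl fun u _ => by rw [smul_comm, neg_smul]

theorem norm_sum_smul_le_of_mem_doublyStochastic (hP : P ∈ doublyStochastic ℝ (Fin n))
    {y : Fin n → E} {c : ℝ} (hy : ∀ w, ‖y w‖ ≤ c) (v : Fin n) : ‖∑ w, P v w • y w‖ ≤ c := by
  have h0 : ∀ w, 0 ≤ P v w := fun w => nonneg_of_mem_doublyStochastic hP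
  calc ‖∑ w, P v w • y w‖ ≤ ∑ w, ‖P v w • y w‖ := norm_sum_le _ _
    _ ≤ ∑ w, P v w * c := Finset.sum_le_sum fun w _ => by
        rw [norm_smul, Real.norm_of_nonneg (h0 w)]
        exact mul_le_mul_of_nonneg_left (hy w) (h0 w)
    _ = c := by rw [← Finset.sum_mul, sum_row_of_mem_doublyStochastic hP v, one_mul]

/-- If the directions never point away from the origin by more than `b`, then the squared distance
to the origin grows at most linearly. -/
theorem norm_gossipDescent_le (hP : P ∈ doublyStochastic ℝ (Fin n)) (hη : 0 ≤ η) {b : ℝ}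
    (hg : ∀ s w x, ‖g s w x‖ ≤ L) (hb : ∀ s w x, -b ≤ inner ℝ (g s w x) x) (s : ℕ) (v : Fin n) :
    ‖gossipDescent P η g s v‖ ≤ √(s * (η ^ 2 * L ^ 2 + 2 * η * b)) := by
  have hL : 0 ≤ L := (norm_nonneg _).trans (hg 0 v 0)
  have hb0 : 0 ≤ b := by simpa using hb 0 v 0
  have hc : 0 ≤ η ^ 2 * L ^ 2 + 2 * η * b := by positivity
  induction s generalizing v with
  | zero => simp [gossipDescent]
  | succ s ih =>
    refine norm_sum_smul_le_of_mem_doublyStochastic hP (fun w => ?_) v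
    refine Real.le_sqrt_of_sq_le ?_
    set x := gossipDescent P η g s w with hx
    have h1 : ‖x‖ ^ 2 ≤ s * (η ^ 2 * L ^ 2 + 2 * η * b) := by
      have := pow_le_pow_left₀ (norm_nonneg _) (ih w) 2
      rwa [Real.sq_sqrt (by positivity)] at this
    have h2 : ‖g s w x‖ ^ 2 ≤ L ^ 2 := pow_le_pow_left₀ (norm_nonneg _) (hg s w x) 2
    have h3 := hb s w x
    rw [norm_sub_sq_real, norm_smul, mul_pow, Real.norm_of_nonneg hη, inner_smul_right,
      real_inner_comm]
    have h4 : η ^ 2 * ‖g s w x‖ ^ 2 ≤ η ^ 2 * L ^ 2 := by gcongr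
    have h5 : η * (-b) ≤ η * inner ℝ (g s w x) x := by gcongr
    push_cast
    linarith

/-- The mean over the nodes of `gossipDescent`. -/
noncomputable def gossipMean (P : Matrix (Fin n) (Fin n) ℝ) (η : ℝ) (g : ℕ → Fin n → E → E)
    (s : ℕ) : E := (n : ℝ)⁻¹ • ∑ v, gossipDescent P η g s v

theorem gossipMean_succ (hP : P ∈ doublyStochastic ℝ (Fin n)) (s : ℕ) :
    gossipMean P η g (s + 1) = gossipMean P η g s
      - η • ((n : ℝ)⁻¹ • ∑ w, g s w (gossipDescent P η g s w)) := by
  have h : ∑ v, gossipDescent P η g (s + 1) v = ∑ w, (gossipDescent P η g s w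
      - η • g s w (gossipDescent P η g s w)) := by
    simp only [gossipDescent]
    rw [Finset.sum_comm]
    refine Finset.sum_congr rfl fun w _ => ?_
    rw [← Finset.sum_smul, sum_col_of_mem_doublyStochastic hP w, one_smul]
  rw [gossipMean, h, Finset.sum_sub_distrib, smul_sub, ← Finset.smul_sum, smul_comm]
  rfl

theorem gossipMean_eq_sum (hP : P ∈ doublyStochastic ℝ (Fin n)) (s : ℕ) :
    gossipMean P η g s = -η • ∑ k ∈ Finset.range s, ∑ w,
      (n : ℝ)⁻¹ • g k w (gossipDescent P η g k w) := by
  induction s with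
  | zero => simp [gossipMean, gossipDescent]
  | succ s ih =>
    rw [gossipMean_succ hP, ih, Finset.sum_range_succ, smul_add,
      ← Finset.smul_sum (s := Finset.univ), neg_smul, neg_smul, sub_eq_add_neg]

/-- The dispersion of the models around their mean is bounded uniformly in time, by the mixing of the
communication matrix. -/
theorem norm_gossipDescent_sub_mean_le (hP : P ∈ doublyStochastic ℝ (Fin n))
    (hnormal : P * P.transpose = P.transpose * P) (hgap : secondEigenvalue P < 1) (hη : 0 ≤ η)
    (hg : ∀ s w x, ‖g s w x‖ ≤ L) (s : ℕ) (v : Fin n) :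
    ‖gossipDescent P η g s v - gossipMean P η g s‖
      ≤ η * L * ((3 + Real.log n) / (1 - secondEigenvalue P)) := by
  have hL : 0 ≤ L := (norm_nonneg _).trans (hg 0 v 0)
  rw [gossipDescent_eq_sum, gossipMean_eq_sum hP, ← smul_sub, ← Finset.sum_sub_distrib, norm_smul,
    norm_neg, Real.norm_of_nonneg hη, mul_assoc]
  refine mul_le_mul_of_nonneg_left ?_ hη
  calc _ ≤ ∑ k ∈ Finset.range s, L * ∑ w, |(P ^ (s - k)) v w - (n : ℝ)⁻¹| := by
        refine norm_sum_le_of_le _ fun k _ => ?_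
        rw [← Finset.sum_sub_distrib, Finset.mul_sum]
        refine norm_sum_le_of_le _ fun w _ => ?_
        rw [← sub_smul, norm_smul, mul_comm, Real.norm_eq_abs]
        exact mul_le_mul_of_nonneg_right (hg _ _ _) (abs_nonneg _)
    _ = L * ∑ k ∈ Finset.range s, ∑ w, |(P ^ (s - 1 - k + 1)) v w - (n : ℝ)⁻¹| := by
        rw [Finset.mul_sum]
        refine Finset.sum_congr rfl fun k hk => ?_
        have : s - 1 - k + 1 = s - k := by have := Finset.mem_range.1 hk; omega
        rw [this]
    _ = L * ∑ j ∈ Finset.range s, ∑ w, |(P ^ (j + 1)) v w - (n : ℝ)⁻¹| := by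
        rw [Finset.sum_range_reflect fun j => ∑ w, |(P ^ (j + 1)) v w - (n : ℝ)⁻¹|]
    _ ≤ _ := by
        refine mul_le_mul_of_nonneg_left ?_ hL
        have h0 := secondEigenvalue_nonneg P
        refine sum_le_of_le_two_of_geometric v.pos h0 hgap _
          (fun j => sum_abs_pow_sub_le_two hP _ v) (fun j => ?_) _
        refine (sum_abs_pow_sub_le hP hnormal hgap (Nat.le_add_left 1 j) v).trans ?_
        exact mul_le_mul_of_nonneg_left
          (pow_le_pow_of_le_one h0 hgap.le (Nat.le_succ j)) (Real.sqrt_nonneg _)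

/-- The regret inequality of subgradient descent for the mean over the nodes: the subgradients are
taken at the models of the nodes instead of at their mean, which costs the dispersion `Δ`. -/
theorem sum_inner_gossipDescent_le (hn : 0 < n) (hP : P ∈ doublyStochastic ℝ (Fin n)) (hη : 0 ≤ η)
    (hg : ∀ s w x, ‖g s w x‖ ≤ L) {Δ : ℝ}
    (hΔ : ∀ s v, ‖gossipDescent P η g s v - gossipMean P η g s‖ ≤ Δ) (x : E) (t : ℕ) :
    2 * η * ∑ s ∈ Finset.range t, (n : ℝ)⁻¹ * ∑ w,
        inner ℝ (g s w (gossipDescent P η g s w)) (gossipDescent P η g s w - x)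
      ≤ ‖x‖ ^ 2 + t * (η ^ 2 * L ^ 2 + 2 * η * (L * Δ)) := by
  have hn0 : (n : ℝ) ≠ 0 := by positivity
  have hL : 0 ≤ L := (norm_nonneg _).trans (hg 0 ⟨0, hn⟩ 0)
  suffices h : 2 * η * ∑ s ∈ Finset.range t, (n : ℝ)⁻¹ * ∑ w,
        inner ℝ (g s w (gossipDescent P η g s w)) (gossipDescent P η g s w - x)
      ≤ ‖x‖ ^ 2 - ‖gossipMean P η g t - x‖ ^ 2 + t * (η ^ 2 * L ^ 2 + 2 * η * (L * Δ)) by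
    have := sq_nonneg ‖gossipMean P η g t - x‖
    linarith
  induction t with
  | zero => simp [gossipMean, gossipDescent]
  | succ t ih =>
    rw [Finset.sum_range_succ, mul_add]
    set X := gossipDescent P η g t with hX
    set M := gossipMean P η g t with hM
    set γ : E := (n : ℝ)⁻¹ • ∑ w, g t w (X w) with hγ
    have hstep : ‖gossipMean P η g (t + 1) - x‖ ^ 2
        = ‖M - x‖ ^ 2 - 2 * η * inner ℝ γ (M - x) + η ^ 2 * ‖γ‖ ^ 2 := by
      rw [gossipMean_succ hP, sub_right_comm, norm_sub_sq_real, inner_smul_right, real_inner_comm,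
        norm_smul, mul_pow, Real.norm_of_nonneg hη]
      ring
    have hγL : ‖γ‖ ≤ L := by
      rw [hγ, norm_smul, Real.norm_of_nonneg (by positivity), inv_mul_le_iff₀ (by positivity)]
      refine (norm_sum_le_of_le _ fun w _ => hg t w (X w)).trans ?_
      simp
    have hγ2 : ‖γ‖ ^ 2 ≤ L ^ 2 := pow_le_pow_left₀ (norm_nonneg _) hγL 2
    have hinner : (n : ℝ)⁻¹ * ∑ w, inner ℝ (g t w (X w)) (X w - x)
        ≤ inner ℝ γ (M - x) + L * Δ := by
      have hterm : ∀ w, inner ℝ (g t w (X w)) (X w - x)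
          ≤ inner ℝ (g t w (X w)) (M - x) + L * Δ := by
        intro w
        have h1 : X w - x = (M - x) + (X w - M) := by abel
        rw [h1, inner_add_right]
        have h2 := real_inner_le_norm (g t w (X w)) (X w - M)
        have h3 : ‖g t w (X w)‖ * ‖X w - M‖ ≤ L * Δ :=
          mul_le_mul (hg _ _ _) (hΔ t w) (norm_nonneg _) hL
        linarith
      calc _ ≤ (n : ℝ)⁻¹ * ∑ w, (inner ℝ (g t w (X w)) (M - x) + L * Δ) := by
            gcongr with w _
            exact hterm w
        _ = _ := by
            rw [hγ, real_inner_smul_left, sum_inner, Finset.sum_add_distrib, mul_add]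
            simp [hn0]
    have h1 : 2 * η * ((n : ℝ)⁻¹ * ∑ w, inner ℝ (g t w (X w)) (X w - x))
        ≤ 2 * η * (inner ℝ γ (M - x) + L * Δ) := by gcongr
    have h2 : η ^ 2 * ‖γ‖ ^ 2 ≤ η ^ 2 * L ^ 2 := by gcongr
    push_cast
    rw [hstep]
    linarith

end Gossip

/-! ### Sampling the subgradients from fixed data -/

theorem integral_comp_uniform_of_indepFun {Ω β : Type*} [MeasurableSpace Ω] [MeasurableSpace β]
    {μ : Measure Ω} [IsProbabilityMeasure μ] {m : ℕ} {Y : Ω → β} {κ : Ω → Fin m}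
    (hκ : Measurable κ) (hind : IndepFun Y κ μ)
    (hunif : ∀ i, μ (κ ⁻¹' {i}) = (m : ENNReal)⁻¹) {F : Fin m → β → ℝ}
    (hF : ∀ i, Measurable (F i)) (hint : ∀ i, Integrable (fun ω => F i (Y ω)) μ) :
    ∫ ω, F (κ ω) (Y ω) ∂μ = (m : ℝ)⁻¹ * ∑ i, ∫ ω, F i (Y ω) ∂μ := by
  have hdec : ∀ ω, F (κ ω) (Y ω) = ∑ i, F i (Y ω) * if κ ω = i then 1 else 0 := by
    intro ω
    simp
  have hite : ∀ i, (fun ω => if κ ω = i then (1 : ℝ) else 0)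
      = (κ ⁻¹' {i}).indicator fun _ => 1 := by
    intro i
    ext ω
    by_cases h : κ ω = i <;> simp [h]
  have hmeas : ∀ i, MeasurableSet (κ ⁻¹' {i}) := fun i => hκ (measurableSet_singleton i)
  have hind' : ∀ i, ∫ ω, F i (Y ω) * (if κ ω = i then (1 : ℝ) else 0) ∂μ
      = (∫ ω, F i (Y ω) ∂μ) * (m : ℝ)⁻¹ := by
    intro i
    have h1 : IndepFun (fun ω => F i (Y ω)) (fun ω => if κ ω = i then (1 : ℝ) else 0) μ :=
      hind.comp (hF i) (Measurable.of_discrete (f := fun k : Fin m => if k = i then (1 : ℝ) else 0))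
    have h2 : AEStronglyMeasurable (fun ω => if κ ω = i then (1 : ℝ) else 0) μ := by
      rw [hite]
      exact (measurable_const.indicator (hmeas i)).aestronglyMeasurable
    rw [h1.integral_fun_mul_eq_mul_integral (hint i).aestronglyMeasurable h2, hite,
      integral_indicator_const _ (hmeas i)]
    simp [Measure.real, hunif]
  simp_rw [hdec]
  rw [integral_finsetSum]
  · simp_rw [hind', ← Finset.sum_mul, mul_comm]
  · intro i _
    have : (fun ω => F i (Y ω) * if κ ω = i then (1 : ℝ) else 0)
        = (κ ⁻¹' {i}).indicator fun ω => F i (Y ω) := by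
      ext ω
      by_cases h : κ ω = i <;> simp [h]
    rw [this]
    exact (hint i).indicator (hmeas i)

/-- An element of the subdifferential of an `L`-Lipschitz function has norm at most `L`. -/
theorem norm_subgradient_le {E : Type*} [NormedAddCommGroup E] [InnerProductSpace ℝ E] {f : E → ℝ}
    {L : ℝ} (hL : 0 ≤ L) (hf : ∀ x y, |f x - f y| ≤ L * ‖x - y‖) {x g : E}
    (hg : ∀ y, f x + inner ℝ g (y - x) ≤ f y) : ‖g‖ ≤ L := by
  have h1 := hg (x + g)
  have h2 := (abs_le.1 (hf (x + g) x)).2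
  rw [add_sub_cancel_left, real_inner_self_eq_norm_sq] at h1
  rw [add_sub_cancel_left] at h2
  by_contra hlt
  push Not at hlt
  have h0 : 0 ≤ ‖g‖ := norm_nonneg g
  nlinarith

theorem norm_average_le {E : Type*} [NormedAddCommGroup E] [NormedSpace ℝ E] {t : ℕ} (ht : 1 ≤ t)
    {x : ℕ → E} {c : ℝ} (hx : ∀ s ∈ Finset.range t, ‖x s‖ ≤ c) :
    ‖(t : ℝ)⁻¹ • ∑ s ∈ Finset.range t, x s‖ ≤ c := by
  have ht0 : (0 : ℝ) < t := by exact_mod_cast ht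
  rw [norm_smul, Real.norm_of_nonneg (by positivity), inv_mul_le_iff₀ ht0]
  simpa using norm_sum_le_of_le _ hx

/-- A crude bound without any condition on the directions besides their size, which serves for
integrability. -/
theorem norm_gossipDescent_le_mul {n : ℕ} {E : Type*} [NormedAddCommGroup E]
    [InnerProductSpace ℝ E] {P : Matrix (Fin n) (Fin n) ℝ} {η L : ℝ} {g : ℕ → Fin n → E → E}
    (hP : P ∈ doublyStochastic ℝ (Fin n)) (hη : 0 ≤ η) (hg : ∀ s w x, ‖g s w x‖ ≤ L) (s : ℕ)
    (v : Fin n) : ‖gossipDescent P η g s v‖ ≤ s * (η * L) := by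
  induction s generalizing v with
  | zero => simp [gossipDescent]
  | succ s ih =>
    refine norm_sum_smul_le_of_mem_doublyStochastic hP (fun w => (norm_sub_le _ _).trans ?_) v
    rw [norm_smul, Real.norm_of_nonneg hη]
    have h1 := ih w
    have h2 := mul_le_mul_of_nonneg_left (hg s w (gossipDescent P η g s w)) hη
    push_cast
    linarith

theorem measurable_gossipDescent {n : ℕ} {Ω E : Type*} [MeasurableSpace Ω]
    [NormedAddCommGroup E] [InnerProductSpace ℝ E] [MeasurableSpace E] [BorelSpace E]
    [SecondCountableTopology E] {P : Matrix (Fin n) (Fin n) ℝ} {η : ℝ}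
    {φ : ℕ → Fin n → Ω → E → E} (hφ : ∀ s w, Measurable (Function.uncurry (φ s w)))
    (s : ℕ) (v : Fin n) :
    Measurable fun ω => gossipDescent P η (fun s w x => φ s w ω x) s v := by
  induction s generalizing v with
  | zero => exact measurable_const
  | succ s ih =>
    refine Finset.measurable_fun_sum _ fun w _ => (Measurable.sub (ih w) ?_).fun_const_smul (P v w)
    exact ((hφ s w).comp (measurable_id.prodMk (ih w))).fun_const_smul η

section FixedData

variable {n m d : ℕ} {Ω : Type*} [MeasurableSpace Ω] {μ : Measure Ω} [IsProbabilityMeasure μ]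
  {P : Matrix (Fin n) (Fin n) ℝ} {η L : ℝ}
  {h : Fin n → Fin m → EuclideanSpace ℝ (Fin d) → ℝ}
  {g : Fin n → Fin m → EuclideanSpace ℝ (Fin d) → EuclideanSpace ℝ (Fin d)}
  {K : ℕ → Fin n → Ω → Fin m}

/-- The vector fields of stochastic subgradient descent when node `w` draws the index `k s w` in its
`s`-th update. -/
def sampledField {ι κ E : Type*} (g : ι → κ → E → E) (k : ℕ → ι → κ) : ℕ → ι → E → E :=
  fun s w x => g w (k s w) x

omit [IsProbabilityMeasure μ] in
/-- The models after `s` updates depend on the first `s` draws only. -/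
theorem indepFun_gossipDescent_sampledField
    (hK : ∀ s v, Measurable (K s v)) (hind : iIndepFun (fun s ω v => K s v ω) μ)
    (s : ℕ) (v w : Fin n) :
    IndepFun (fun ω => gossipDescent P η (sampledField g fun s w => K s w ω) s v) (K s w) μ := by
  have h1 := hind.indepFun_finset (Finset.range s) {s} (by simp)
    (fun s => measurable_pi_lambda _ fun v => hK s v)
  have h2 := h1.comp (φ := fun c : (Finset.range s → Fin n → Fin m) =>
      gossipDescent P η (fun r w x => if hr : r ∈ Finset.range s then g w (c ⟨r, hr⟩ w) x else 0) s v)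
    (ψ := fun c : (({s} : Finset ℕ) → Fin n → Fin m) => c ⟨s, by simp⟩ w)
    Measurable.of_discrete Measurable.of_discrete
  refine h2.congr (Filter.Eventually.of_forall fun ω => ?_) Filter.EventuallyEq.rfl
  refine congrFun (gossipDescent_congr P η fun r hr => ?_) v
  ext1 w
  ext1 x
  rw [dif_pos (Finset.mem_range.2 hr)]
  rfl

/-- Conditionally on the data, the optimisation error of the ergodic average at every node is
the regret `‖x‖² / (2ηt) + ηL² / 2` of the mean over the nodes, plus the cost of the dispersion. -/
theorem integral_gossipDescent_average_sub_le (hm : 0 < m) (hP : P ∈ doublyStochastic ℝ (Fin n))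
    (hnormal : P * P.transpose = P.transpose * P) (hgap : secondEigenvalue P < 1) (hη : 0 < η)
    (hconv : ∀ w i, ConvexOn ℝ Set.univ (h w i))
    (hlip : ∀ w i x y, |h w i x - h w i y| ≤ L * ‖x - y‖)
    (hg : ∀ w i, Measurable (g w i)) (hgL : ∀ w i x, ‖g w i x‖ ≤ L)
    (hsub : ∀ w i x y, h w i x + inner ℝ (g w i x) (y - x) ≤ h w i y)
    (hK : ∀ s v, Measurable (K s v)) (hind : iIndepFun (fun s ω v => K s v ω) μ)
    (hunif : ∀ s v k, μ (K s v ⁻¹' {k}) = (m : ENNReal)⁻¹)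
    {t : ℕ} (ht : 1 ≤ t) (v : Fin n) (x : EuclideanSpace ℝ (Fin d)) :
    ∫ ω, (∑ w, ∑ i, h w i ((t : ℝ)⁻¹ • ∑ s ∈ Finset.range t,
        gossipDescent P η (sampledField g fun s w => K s w ω) s v)) / ((n : ℝ) * m) ∂μ
      ≤ (∑ w, ∑ i, h w i x) / ((n : ℝ) * m)
        + (‖x‖ ^ 2 / (2 * η * t)
          + 10 * (η * L ^ 2 * (1 + Real.log n) / (1 - secondEigenvalue P))) := by
  have hn : 0 < n := v.pos
  have hn0 : (0 : ℝ) < n := by exact_mod_cast hn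
  have hm0 : (0 : ℝ) < m := by exact_mod_cast hm
  have ht0 : (0 : ℝ) < t := by exact_mod_cast ht
  have hL : 0 ≤ L := (norm_nonneg _).trans (hgL v ⟨0, hm⟩ 0)
  set σ := secondEigenvalue P with hσ
  set Y : ℕ → Fin n → Ω → EuclideanSpace ℝ (Fin d) := fun s w ω =>
    gossipDescent P η (sampledField g fun s w => K s w ω) s w with hY
  set Δ : ℝ := η * L * ((3 + Real.log n) / (1 - σ)) with hΔdef
  have hfield : ∀ ω s w x, ‖sampledField g (fun s w => K s w ω) s w x‖ ≤ L :=
    fun ω s w x => hgL _ _ _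
  have hΔ : ∀ ω s w, ‖Y s w ω - gossipMean P η (sampledField g fun s w => K s w ω) s‖ ≤ Δ :=
    fun ω s w => norm_gossipDescent_sub_mean_le hP hnormal hgap hη.le (hfield ω) s w
  have hYY : ∀ ω s w, ‖Y s v ω - Y s w ω‖ ≤ 2 * Δ := by
    intro ω s w
    have h1 := hΔ ω s v
    have h2 := hΔ ω s w
    rw [norm_sub_rev] at h2
    have h3 := norm_sub_le_norm_sub_add_norm_sub (Y s v ω)
      (gossipMean P η (sampledField g fun s w => K s w ω) s) (Y s w ω)
    linarith
  have hYm : ∀ s w, Measurable (Y s w) := fun s w =>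
    measurable_gossipDescent (φ := fun s w ω x => g w (K s w ω) x) (fun s w =>
      (measurable_from_prod_countable_left (f := fun q : EuclideanSpace ℝ (Fin d) × Fin m =>
        g w q.2 q.1) fun i => hg w i).comp (measurable_snd.prodMk ((hK s w).comp measurable_fst))) s w
  have hYb : ∀ s w ω, ‖Y s w ω‖ ≤ s * (η * L) := fun s w ω =>
    norm_gossipDescent_le_mul hP hη.le (hfield ω) s w
  have hcont : ∀ w i, Continuous (h w i) := fun w i =>
    (LipschitzWith.of_dist_le_mul (K := L.toNNReal) fun x y => by
      rw [Real.dist_eq, dist_eq_norm, Real.coe_toNNReal _ hL]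
      exact hlip w i x y).continuous
  have hint_h : ∀ w i (X : Ω → EuclideanSpace ℝ (Fin d)) (c : ℝ), Measurable X →
      (∀ ω, ‖X ω‖ ≤ c) → Integrable (fun ω => h w i (X ω)) μ := by
    intro w i X c hX hc
    refine Integrable.of_bound ((hcont w i).measurable.comp hX).aestronglyMeasurable
      (|h w i 0| + L * c) (Filter.Eventually.of_forall fun ω => ?_)
    have h1 := hlip w i (X ω) 0
    rw [sub_zero] at h1
    have h2 := abs_sub_abs_le_abs_sub (h w i (X ω)) (h w i 0)
    have h3 := mul_le_mul_of_nonneg_left (hc ω) hL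
    rw [Real.norm_eq_abs]
    linarith
  have hFm : ∀ w i, Measurable fun y => inner ℝ (g w i y) (y - x) := fun w i =>
    (hg w i).inner (measurable_id.sub_const x)
  have hint_F : ∀ s w i, Integrable (fun ω => inner ℝ (g w i (Y s w ω)) (Y s w ω - x)) μ := by
    intro s w i
    refine Integrable.of_bound ((hFm w i).comp (hYm s w)).aestronglyMeasurable
      (L * (s * (η * L) + ‖x‖)) (Filter.Eventually.of_forall fun ω => ?_)
    refine (norm_inner_le_norm _ _).trans (mul_le_mul (hgL _ _ _) ?_ (norm_nonneg _) hL)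
    exact (norm_sub_le _ _).trans (by have := hYb s w ω; linarith)
  set I : ℕ → Fin n → Ω → ℝ := fun s w ω =>
    inner ℝ (g w (K s w ω) (Y s w ω)) (Y s w ω - x) with hI
  have hint_I : ∀ s w, Integrable (I s w) μ := by
    intro s w
    have hu : Measurable (Function.uncurry fun (y : EuclideanSpace ℝ (Fin d)) (i : Fin m) =>
        (inner ℝ (g w i y) (y - x) : ℝ)) := measurable_from_prod_countable_left fun i => hFm w i
    refine Integrable.of_bound (hu.comp ((hYm s w).prodMk (hK s w))).aestronglyMeasurable
      (L * (s * (η * L) + ‖x‖)) (Filter.Eventually.of_forall fun ω => ?_)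
    refine (norm_inner_le_norm _ _).trans (mul_le_mul (hgL _ _ _) ?_ (norm_nonneg _) hL)
    exact (norm_sub_le _ _).trans (by have := hYb s w ω; linarith)
  -- the sampled index is uniform and independent of the current model
  have hI_lower : ∀ s w, (m : ℝ)⁻¹ * ∑ i, (∫ ω, h w i (Y s v ω) ∂μ - h w i x) - 2 * (L * Δ)
      ≤ ∫ ω, I s w ω ∂μ := by
    intro s w
    have h1 := integral_comp_uniform_of_indepFun (μ := μ) (hK s w)
      (indepFun_gossipDescent_sampledField hK hind s w w) (hunif s w)
      (F := fun i y => inner ℝ (g w i y) (y - x)) (hFm w) (hint_F s w)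
    have h2 : ∫ ω, I s w ω ∂μ
        = (m : ℝ)⁻¹ * ∑ i, ∫ ω, inner ℝ (g w i (Y s w ω)) (Y s w ω - x) ∂μ := h1
    rw [h2]
    have h3 : ∀ i, ∫ ω, h w i (Y s v ω) ∂μ - h w i x - 2 * (L * Δ)
        ≤ ∫ ω, inner ℝ (g w i (Y s w ω)) (Y s w ω - x) ∂μ := by
      intro i
      have h4 : ∫ ω, (h w i (Y s v ω) - (h w i x + 2 * (L * Δ))) ∂μ
          ≤ ∫ ω, inner ℝ (g w i (Y s w ω)) (Y s w ω - x) ∂μ := by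
        refine integral_mono ((hint_h w i _ _ (hYm s v) (hYb s v)).sub (integrable_const _))
          (hint_F s w i) fun ω => ?_
        have h5 := hsub w i (Y s w ω) x
        have h6 := (abs_le.1 (hlip w i (Y s v ω) (Y s w ω))).2
        have h7 := mul_le_mul_of_nonneg_left (hYY ω s w) hL
        have h8 : inner ℝ (g w i (Y s w ω)) (x - Y s w ω)
            = -inner ℝ (g w i (Y s w ω)) (Y s w ω - x) := by
          rw [← inner_neg_right, neg_sub]
        simp only
        linarith
      rw [integral_sub (hint_h w i _ _ (hYm s v) (hYb s v)) (integrable_const _),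
        integral_const] at h4
      simp only [probReal_univ, one_smul] at h4
      linarith
    calc _ = (m : ℝ)⁻¹ * ∑ i, (∫ ω, h w i (Y s v ω) ∂μ - h w i x - 2 * (L * Δ)) := by
          rw [Finset.sum_sub_distrib _ (fun _ : Fin m => 2 * (L * Δ))]
          simp only [Finset.sum_const, Finset.card_univ, Fintype.card_fin, nsmul_eq_mul]
          field_simp
      _ ≤ _ := by
          gcongr with i _
          exact h3 i
  set R : EuclideanSpace ℝ (Fin d) → ℝ := fun y => (∑ w, ∑ i, h w i y) / ((n : ℝ) * m) with hR
  have hint_R : ∀ s, Integrable (fun ω => R (Y s v ω)) μ := fun s =>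
    (integrable_finsetSum _ fun w _ => integrable_finsetSum _ fun i _ =>
      hint_h w i _ _ (hYm s v) (hYb s v)).div_const _
  have hR_le : ∀ s, ∫ ω, R (Y s v ω) ∂μ - R x
      ≤ ∫ ω, (n : ℝ)⁻¹ * ∑ w, I s w ω ∂μ + 2 * (L * Δ) := by
    intro s
    have h1 : ∫ ω, R (Y s v ω) ∂μ = (∑ w, ∑ i, ∫ ω, h w i (Y s v ω) ∂μ) / ((n : ℝ) * m) := by
      simp only [hR]
      rw [integral_div, integral_finsetSum _ fun w _ => integrable_finsetSum _ fun i _ =>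
        hint_h w i _ _ (hYm s v) (hYb s v)]
      congr 1
      exact Finset.sum_congr rfl fun w _ => integral_finsetSum _ fun i _ =>
        hint_h w i _ _ (hYm s v) (hYb s v)
    rw [integral_const_mul, integral_finsetSum _ fun w _ => hint_I s w, h1]
    calc _ = (n : ℝ)⁻¹ * ∑ w, ((m : ℝ)⁻¹ * ∑ i, (∫ ω, h w i (Y s v ω) ∂μ - h w i x)
            - 2 * (L * Δ)) + 2 * (L * Δ) := by
          rw [Finset.sum_sub_distrib]
          simp only [hR, Finset.sum_const, Finset.card_univ, Fintype.card_fin, nsmul_eq_mul,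
            Finset.sum_sub_distrib, ← Finset.mul_sum]
          field_simp
          ring
      _ ≤ _ := by
          gcongr with w _
          exact hI_lower s w
  have hregret : ∑ s ∈ Finset.range t, ∫ ω, (n : ℝ)⁻¹ * ∑ w, I s w ω ∂μ
      ≤ (‖x‖ ^ 2 + t * (η ^ 2 * L ^ 2 + 2 * η * (L * Δ))) / (2 * η) := by
    rw [← integral_finsetSum _ fun s _ =>
      (integrable_finsetSum _ fun w _ => hint_I s w).const_mul _]
    have hbound : ∀ ω, ∑ s ∈ Finset.range t, (n : ℝ)⁻¹ * ∑ w, I s w ω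
        ≤ (‖x‖ ^ 2 + t * (η ^ 2 * L ^ 2 + 2 * η * (L * Δ))) / (2 * η) := by
      intro ω
      rw [le_div_iff₀' (by positivity)]
      exact sum_inner_gossipDescent_le hn hP hη.le (hfield ω) (hΔ ω) x t
    calc _ ≤ ∫ _, (‖x‖ ^ 2 + t * (η ^ 2 * L ^ 2 + 2 * η * (L * Δ))) / (2 * η) ∂μ :=
          integral_mono (integrable_finsetSum _ fun s _ =>
            (integrable_finsetSum _ fun w _ => hint_I s w).const_mul _)
            (integrable_const _) hbound
      _ = _ := by simp
  have hjensen : ∀ ω, R ((t : ℝ)⁻¹ • ∑ s ∈ Finset.range t, Y s v ω)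
      ≤ (t : ℝ)⁻¹ * ∑ s ∈ Finset.range t, R (Y s v ω) := by
    intro ω
    have h1 : ∀ w i, h w i ((t : ℝ)⁻¹ • ∑ s ∈ Finset.range t, Y s v ω)
        ≤ (t : ℝ)⁻¹ * ∑ s ∈ Finset.range t, h w i (Y s v ω) := by
      intro w i
      rw [Finset.smul_sum, Finset.mul_sum]
      exact (hconv w i).map_sum_le (fun _ _ => by positivity) (by simp [ht0.ne'])
        fun _ _ => Set.mem_univ _
    calc _ ≤ (∑ w, ∑ i, (t : ℝ)⁻¹ * ∑ s ∈ Finset.range t, h w i (Y s v ω)) / ((n : ℝ) * m) := by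
          simp only [hR]
          gcongr with w _ i _
          exact h1 w i
      _ = _ := by
          simp only [hR, ← Finset.mul_sum, ← Finset.sum_div]
          rw [mul_div_assoc]
          congr 2
          symm
          rw [Finset.sum_comm]
          exact Finset.sum_congr rfl fun w _ => Finset.sum_comm
  have havg_m : Measurable fun ω => (t : ℝ)⁻¹ • ∑ s ∈ Finset.range t, Y s v ω :=
    (Finset.measurable_fun_sum _ fun s _ => hYm s v).fun_const_smul _
  have hYt : ∀ s ∈ Finset.range t, ∀ ω, ‖Y s v ω‖ ≤ t * (η * L) := fun s hs ω =>
    (hYb s v ω).trans (by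
      have : (s : ℝ) ≤ t := by exact_mod_cast (Finset.mem_range.1 hs).le
      gcongr)
  have havg_b : ∀ ω, ‖(t : ℝ)⁻¹ • ∑ s ∈ Finset.range t, Y s v ω‖ ≤ t * (η * L) := fun ω =>
    norm_average_le ht fun s hs => hYt s hs ω
  have hint_avg : Integrable (fun ω => R ((t : ℝ)⁻¹ • ∑ s ∈ Finset.range t, Y s v ω)) μ :=
    (integrable_finsetSum _ fun w _ => integrable_finsetSum _ fun i _ =>
      hint_h w i _ _ havg_m havg_b).div_const _
  have hfin : ∫ ω, R ((t : ℝ)⁻¹ • ∑ s ∈ Finset.range t, Y s v ω) ∂μ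
      ≤ (t : ℝ)⁻¹ * ∑ s ∈ Finset.range t, ∫ ω, R (Y s v ω) ∂μ := by
    rw [← integral_finsetSum _ fun s _ => hint_R s, ← integral_const_mul]
    exact integral_mono hint_avg ((integrable_finsetSum _ fun s _ => hint_R s).const_mul _) hjensen
  have hsum : ∑ s ∈ Finset.range t, ∫ ω, R (Y s v ω) ∂μ
      ≤ (‖x‖ ^ 2 + t * (η ^ 2 * L ^ 2 + 2 * η * (L * Δ))) / (2 * η)
        + t * (2 * (L * Δ) + R x) := by
    calc _ ≤ ∑ s ∈ Finset.range t,
          (∫ ω, (n : ℝ)⁻¹ * ∑ w, I s w ω ∂μ + (2 * (L * Δ) + R x)) :=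
          Finset.sum_le_sum fun s _ => by have := hR_le s; linarith
      _ ≤ _ := by
          rw [Finset.sum_add_distrib]
          simp only [Finset.sum_const, Finset.card_range, nsmul_eq_mul]
          linarith
  have hfin2 := hfin.trans (mul_le_mul_of_nonneg_left hsum (inv_nonneg.2 ht0.le))
  refine hfin2.trans ?_
  have hd : 0 < 1 - σ := by linarith
  have hd1 : 1 - σ ≤ 1 := by have := secondEigenvalue_nonneg P; linarith
  have hlog : 0 ≤ Real.log n := Real.log_nonneg (by exact_mod_cast hn)
  have hexp : (t : ℝ)⁻¹ * ((‖x‖ ^ 2 + t * (η ^ 2 * L ^ 2 + 2 * η * (L * Δ))) / (2 * η)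
        + t * (2 * (L * Δ) + R x))
      = R x + ‖x‖ ^ 2 / (2 * η * t) + (η * L ^ 2 / 2 + 3 * (L * Δ)) := by
    field_simp
    ring
  rw [hexp, ← add_assoc]
  have hone : η * L ^ 2 / 2 ≤ η * L ^ 2 / 2 / (1 - σ) := le_div_self (by positivity) hd hd1
  have : η * L ^ 2 / 2 / (1 - σ) + 3 * (L * Δ)
      ≤ 10 * (η * L ^ 2 * (1 + Real.log n) / (1 - σ)) := by
    have e1 : η * L ^ 2 / 2 / (1 - σ) + 3 * (L * Δ)
        = η * L ^ 2 / (1 - σ) * (19 / 2 + 3 * Real.log n) := by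
      rw [hΔdef]; field_simp; ring
    have e2 : 10 * (η * L ^ 2 * (1 + Real.log n) / (1 - σ))
        = η * L ^ 2 / (1 - σ) * (10 + 10 * Real.log n) := by
      field_simp
    rw [e1, e2]
    gcongr ?_ * ?_
    linarith
  linarith

end FixedData

/-! ### Symmetrisation -/

section Symmetrisation

theorem abs_ciSup_le {κ : Type*} [Nonempty κ] {u : κ → ℝ} {c : ℝ} (h : ∀ k, |u k| ≤ c) :
    |⨆ k, u k| ≤ c := by
  have hbdd : BddAbove (Set.range u) := ⟨c, by rintro _ ⟨k, rfl⟩; exact (abs_le.1 (h k)).2⟩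
  obtain ⟨k⟩ := ‹Nonempty κ›
  exact abs_le.2 ⟨(abs_le.1 (h k)).1.trans (le_ciSup hbdd k),
    have : Nonempty κ := ⟨k⟩; ciSup_le fun k => (abs_le.1 (h k)).2⟩

theorem integrable_ciSup {κ β : Type*} [Countable κ] [Nonempty κ] [MeasurableSpace β]
    {ν : Measure β} [IsFiniteMeasure ν] {u : κ → β → ℝ} {c : ℝ} (hu : ∀ k, Measurable (u k))
    (h : ∀ k b, |u k b| ≤ c) : Integrable (fun b => ⨆ k, u k b) ν :=
  Integrable.of_bound (Measurable.iSup hu).aestronglyMeasurable c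
    (Filter.Eventually.of_forall fun b => abs_ciSup_le fun k => h k b)

variable {ι 𝒵 : Type*} [Fintype ι] [MeasurableSpace 𝒵]

/-- The sign attached to a Boolean. -/
def boolSign (b : Bool) : ℝ := if b then 1 else -1

theorem boolSign_not (b : Bool) : boolSign (!b) = -boolSign b := by
  cases b <;> simp [boolSign]

theorem abs_boolSign (b : Bool) : |boolSign b| = 1 := by
  cases b <;> simp [boolSign]

/-- The supremum over `k` of the signed empirical mean of `f k`. The class of functions is indexed by
`ℕ`, so that the supremum is measurable. -/
noncomputable def signedSup (f : ℕ → 𝒵 → ℝ) (ε : ι → Bool) (z : ι → 𝒵) : ℝ :=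
  ⨆ k, (∑ i, boolSign (ε i) * f k (z i)) / Fintype.card ι

theorem abs_sum_div_card_le [Nonempty ι] {a : ι → ℝ} {c : ℝ} (h : ∀ i, |a i| ≤ c) :
    |(∑ i, a i) / Fintype.card ι| ≤ c := by
  have hN : (0 : ℝ) < Fintype.card ι := by exact_mod_cast Fintype.card_pos
  rw [abs_div, abs_of_pos hN, div_le_iff₀ hN]
  calc _ ≤ ∑ i, |a i| := Finset.abs_sum_le_sum_abs _ _
    _ ≤ ∑ _i : ι, c := Finset.sum_le_sum fun i _ => h i
    _ = _ := by simp [mul_comm]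

variable [Nonempty ι] {μ : Measure 𝒵} [IsProbabilityMeasure μ]
  {f : ℕ → 𝒵 → ℝ} {b c : ℝ}

/-- Exchanging the two independent copies in the coordinates selected by `ε` does not change the
law of the pair of samples, so that signs may be inserted. -/
theorem integral_ghost_sup_le (hf : ∀ k, Measurable (f k)) (hc : ∀ k z, |f k z| ≤ c)
    (ε : ι → Bool) :
    ∫ p : ι → 𝒵 × 𝒵, ⨆ k, (∑ i, (f k (p i).2 - f k (p i).1)) / Fintype.card ι
        ∂Measure.pi (fun _ => μ.prod μ)
      ≤ ∫ z, signedSup f ε z ∂Measure.pi (fun _ : ι => μ)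
        + ∫ z, signedSup f (fun i => !ε i) z ∂Measure.pi (fun _ : ι => μ) := by
  have hsw : MeasurePreserving (fun (p : ι → 𝒵 × 𝒵) i => if ε i then p i else (p i).swap)
      (Measure.pi fun _ => μ.prod μ) (Measure.pi fun _ => μ.prod μ) := by
    refine measurePreserving_pi (fun _ => μ.prod μ) (fun _ => μ.prod μ)
      (f := fun i (q : 𝒵 × 𝒵) => if ε i then q else q.swap) fun i => ?_
    cases ε i
    · simpa using Measure.measurePreserving_swap
    · simpa using! MeasurePreserving.id (μ.prod μ)
  have hfst : MeasurePreserving (fun (p : ι → 𝒵 × 𝒵) i => (p i).1)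
      (Measure.pi fun _ => μ.prod μ) (Measure.pi fun _ => μ) :=
    measurePreserving_pi (fun _ => μ.prod μ) (fun _ => μ) (f := fun _ (q : 𝒵 × 𝒵) => q.1) fun i => measurePreserving_fst
  have hsnd : MeasurePreserving (fun (p : ι → 𝒵 × 𝒵) i => (p i).2)
      (Measure.pi fun _ => μ.prod μ) (Measure.pi fun _ => μ) :=
    measurePreserving_pi (fun _ => μ.prod μ) (fun _ => μ) (f := fun _ (q : 𝒵 × 𝒵) => q.2) fun i => measurePreserving_snd
  have hmA : ∀ (ε : ι → Bool) k, Measurable fun z : ι → 𝒵 =>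
      (∑ i, boolSign (ε i) * f k (z i)) / Fintype.card ι := fun ε k =>
    (Finset.measurable_fun_sum _ fun i _ =>
      ((hf k).comp (measurable_pi_apply i)).const_mul _).div_const _
  have hbA : ∀ (ε : ι → Bool) k (z : ι → 𝒵),
      |(∑ i, boolSign (ε i) * f k (z i)) / Fintype.card ι| ≤ c := fun ε k z =>
    abs_sum_div_card_le fun i => by rw [abs_mul, abs_boolSign, one_mul]; exact hc k _
  have hA : ∀ ε : ι → Bool, Integrable (signedSup f ε) (Measure.pi fun _ : ι => μ) :=
    fun ε => integrable_ciSup (hmA ε) (hbA ε)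
  have hmG : ∀ (ε : ι → Bool) k, Measurable fun p : ι → 𝒵 × 𝒵 =>
      (∑ i, boolSign (ε i) * (f k (p i).2 - f k (p i).1)) / Fintype.card ι := fun ε k =>
    (Finset.measurable_fun_sum _ fun i _ =>
      (((hf k).comp (measurable_snd.comp (measurable_pi_apply i))).sub
        ((hf k).comp (measurable_fst.comp (measurable_pi_apply i)))).const_mul _).div_const _
  have hbG : ∀ (ε : ι → Bool) k (p : ι → 𝒵 × 𝒵),
      |(∑ i, boolSign (ε i) * (f k (p i).2 - f k (p i).1)) / Fintype.card ι| ≤ c + c :=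
    fun ε k p => abs_sum_div_card_le fun i => by
      rw [abs_mul, abs_boolSign, one_mul]
      exact (abs_sub _ _).trans (add_le_add (hc k _) (hc k _))
  have hG1 : (fun p : ι → 𝒵 × 𝒵 => ⨆ k, (∑ i, (f k (p i).2 - f k (p i).1)) / Fintype.card ι)
      = fun p => ⨆ k, (∑ i, boolSign true * (f k (p i).2 - f k (p i).1)) / Fintype.card ι := by
    simp [boolSign]
  have hflip : ∫ p : ι → 𝒵 × 𝒵, ⨆ k, (∑ i, (f k (p i).2 - f k (p i).1)) / Fintype.card ι
        ∂Measure.pi (fun _ => μ.prod μ)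
      = ∫ p : ι → 𝒵 × 𝒵, ⨆ k, (∑ i, boolSign (ε i) * (f k (p i).2 - f k (p i).1))
        / Fintype.card ι ∂Measure.pi (fun _ => μ.prod μ) := by
    have h1 : AEStronglyMeasurable (fun p : ι → 𝒵 × 𝒵 =>
        ⨆ k, (∑ i, (f k (p i).2 - f k (p i).1)) / Fintype.card ι)
        (Measure.map (fun (p : ι → 𝒵 × 𝒵) i => if ε i then p i else (p i).swap)
          (Measure.pi fun _ => μ.prod μ)) := by
      rw [hG1]
      exact (Measurable.iSup (hmG fun _ => true)).aestronglyMeasurable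
    conv_lhs => rw [← hsw.map_eq]
    rw [integral_map hsw.measurable.aemeasurable h1]
    congr 1
    ext p
    congr 1
    ext k
    congr 1
    refine Finset.sum_congr rfl fun i _ => ?_
    rcases h : ε i <;> simp [boolSign, h]
  have hint_fst : ∫ z, signedSup f (fun i => !ε i) z ∂Measure.pi (fun _ : ι => μ)
      = ∫ p : ι → 𝒵 × 𝒵, signedSup f (fun i => !ε i) (fun i => (p i).1)
        ∂Measure.pi (fun _ => μ.prod μ) := by
    rw [← hfst.map_eq]
    exact integral_map hfst.measurable.aemeasurable (by rw [hfst.map_eq]; exact (hA _).1)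
  have hint_snd : ∫ z, signedSup f ε z ∂Measure.pi (fun _ : ι => μ)
      = ∫ p : ι → 𝒵 × 𝒵, signedSup f ε (fun i => (p i).2)
        ∂Measure.pi (fun _ => μ.prod μ) := by
    rw [← hsnd.map_eq]
    exact integral_map hsnd.measurable.aemeasurable (by rw [hsnd.map_eq]; exact (hA _).1)
  rw [hflip, hint_fst, hint_snd]
  have hi1 := hsnd.integrable_comp_of_integrable (hA ε)
  have hi2 := hfst.integrable_comp_of_integrable (hA fun i => !ε i)
  simp only [Function.comp_def] at hi1 hi2
  rw [← integral_add hi1 hi2]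
  refine integral_mono (integrable_ciSup (hmG ε) (hbG ε)) (hi1.add hi2) fun p => ?_
  refine ciSup_le fun k => ?_
  have hbdd : ∀ (ε : ι → Bool) (z : ι → 𝒵), BddAbove (Set.range fun k =>
      (∑ i, boolSign (ε i) * f k (z i)) / Fintype.card ι) := fun ε z =>
    ⟨c, by rintro _ ⟨k, rfl⟩; exact (abs_le.1 (hbA ε k z)).2⟩
  calc _ = (∑ i, boolSign (ε i) * f k (p i).2) / Fintype.card ι
        + (∑ i, boolSign (!ε i) * f k (p i).1) / Fintype.card ι := by
        rw [← add_div, ← Finset.sum_add_distrib]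
        congr 1
        refine Finset.sum_congr rfl fun i _ => ?_
        rw [boolSign_not]; ring
    _ ≤ _ := add_le_add (le_ciSup (hbdd ε fun i => (p i).2) k)
        (le_ciSup (hbdd (fun i => !ε i) fun i => (p i).1) k)

/-- The mean of `f k` is the expectation of its empirical mean over an independent ghost sample, which
is drawn out of the supremum; averaging the bound of `integral_ghost_sup_le` over all signs gives
twice the Rademacher complexity. -/
theorem integral_sup_mean_sub_le [DecidableEq ι] (hf : ∀ k, Measurable (f k)) (hc : ∀ k z, |f k z| ≤ c)
    (hb : ∀ z : ι → 𝒵, (∑ ε : ι → Bool, signedSup f ε z) / 2 ^ Fintype.card ι ≤ b) :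
    ∫ z, ⨆ k, ((∫ y, f k y ∂μ) - (∑ i, f k (z i)) / Fintype.card ι) ∂Measure.pi (fun _ : ι => μ)
      ≤ 2 * b := by
  set ν : Measure (ι → 𝒵) := Measure.pi fun _ : ι => μ with hν
  have hN : (0 : ℝ) < Fintype.card ι := by exact_mod_cast Fintype.card_pos
  have hmf : ∀ k (i : ι), Measurable fun z : ι → 𝒵 => f k (z i) := fun k i =>
    (hf k).comp (measurable_pi_apply i)
  have hmR : ∀ k, Measurable fun z : ι → 𝒵 => (∑ i, f k (z i)) / Fintype.card ι := fun k =>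
    (Finset.measurable_fun_sum _ fun i _ => hmf k i).div_const _
  have hbR : ∀ k (z : ι → 𝒵), |(∑ i, f k (z i)) / Fintype.card ι| ≤ c := fun k z =>
    abs_sum_div_card_le fun i => hc k _
  have hrc : ∀ k, |∫ y, f k y ∂μ| ≤ c := fun k => by
    have := norm_integral_le_of_norm_le_const (μ := μ) (C := c) (f := f k)
      (Filter.Eventually.of_forall fun z => hc k z)
    simpa using this
  have hmean : ∀ k, ∫ z, (∑ i, f k (z i)) / Fintype.card ι ∂ν = ∫ y, f k y ∂μ := by
    intro k
    have hi : ∀ i : ι, ∫ z, f k (z i) ∂ν = ∫ y, f k y ∂μ := fun i =>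
      integral_comp_eval (μ := fun _ : ι => μ) (hf k).aestronglyMeasurable
    rw [integral_div, integral_finsetSum]
    · simp only [hi, Finset.sum_const, Finset.card_univ, nsmul_eq_mul]
      field_simp
    · exact fun i _ => Integrable.of_bound (hmf k i).aestronglyMeasurable c
        (Filter.Eventually.of_forall fun z => hc k _)
  have hmD : ∀ k, Measurable fun q : (ι → 𝒵) × (ι → 𝒵) =>
      (∑ i, (f k (q.2 i) - f k (q.1 i))) / Fintype.card ι := fun k =>
    (Finset.measurable_fun_sum _ fun i _ => ((hmf k i).comp measurable_snd).sub
      ((hmf k i).comp measurable_fst)).div_const _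
  have hbD : ∀ k (q : (ι → 𝒵) × (ι → 𝒵)),
      |(∑ i, (f k (q.2 i) - f k (q.1 i))) / Fintype.card ι| ≤ c + c := fun k q =>
    abs_sum_div_card_le fun i => (abs_sub _ _).trans (add_le_add (hc k _) (hc k _))
  have hD : Integrable (fun q : (ι → 𝒵) × (ι → 𝒵) =>
      ⨆ k, (∑ i, (f k (q.2 i) - f k (q.1 i))) / Fintype.card ι) (ν.prod ν) :=
    integrable_ciSup hmD hbD
  have hghost : ∀ z : ι → 𝒵, ⨆ k, ((∫ y, f k y ∂μ) - (∑ i, f k (z i)) / Fintype.card ι)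
      ≤ ∫ z', ⨆ k, (∑ i, (f k (z' i) - f k (z i))) / Fintype.card ι ∂ν := by
    intro z
    refine ciSup_le fun k => ?_
    have hint : Integrable (fun z' : ι → 𝒵 => (∑ i, f k (z' i)) / Fintype.card ι) ν :=
      Integrable.of_bound (hmR k).aestronglyMeasurable c
        (Filter.Eventually.of_forall fun z => hbR k _)
    calc (∫ y, f k y ∂μ) - (∑ i, f k (z i)) / Fintype.card ι
        = ∫ z', ((∑ i, f k (z' i)) / Fintype.card ι - (∑ i, f k (z i)) / Fintype.card ι) ∂ν := by
          rw [integral_sub hint (integrable_const _), hmean, integral_const]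
          simp
      _ ≤ _ := by
          refine integral_mono (hint.sub (integrable_const _))
            (integrable_ciSup (fun k => (hmD k).comp measurable_prodMk_left)
              fun k z' => hbD k (z, z')) fun z' => ?_
          simp only
          rw [← sub_div, ← Finset.sum_sub_distrib]
          exact le_ciSup (f := fun k => (∑ i, (f k (z' i) - f k (z i))) / (Fintype.card ι : ℝ))
            ⟨c + c, by rintro _ ⟨k, rfl⟩; exact (abs_le.1 (hbD k (z, z'))).2⟩ k
  have hpair : ∫ z, ⨆ k, ((∫ y, f k y ∂μ) - (∑ i, f k (z i)) / Fintype.card ι) ∂ν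
      ≤ ∫ p : ι → 𝒵 × 𝒵, ⨆ k, (∑ i, (f k (p i).2 - f k (p i).1)) / Fintype.card ι
        ∂Measure.pi (fun _ => μ.prod μ) := by
    have hmp := measurePreserving_arrowProdEquivProdArrow 𝒵 𝒵 ι (fun _ => μ) (fun _ => μ)
    calc _ ≤ ∫ z, ∫ z', ⨆ k, (∑ i, (f k (z' i) - f k (z i))) / Fintype.card ι ∂ν ∂ν := by
          refine integral_mono (integrable_ciSup (c := c + c)
            (fun k => measurable_const.sub (hmR k)) fun k z => ?_) hD.integral_prod_left hghost
          exact (abs_sub _ _).trans (add_le_add (hrc k) (hbR k z))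
      _ = ∫ q, ⨆ k, (∑ i, (f k (q.2 i) - f k (q.1 i))) / Fintype.card ι ∂(ν.prod ν) :=
          (integral_prod _ hD).symm
      _ = _ := by
          rw [hν, ← hmp.map_eq, integral_map_equiv]
          rfl
  have hsigns : (2 : ℝ) ^ Fintype.card ι
      * ∫ z, ⨆ k, ((∫ y, f k y ∂μ) - (∑ i, f k (z i)) / Fintype.card ι) ∂ν
      ≤ ∑ ε : ι → Bool, (∫ z, signedSup f ε z ∂ν + ∫ z, signedSup f (fun i => !ε i) z ∂ν) := by
    calc _ = ∑ _ε : ι → Bool,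
          ∫ z, ⨆ k, ((∫ y, f k y ∂μ) - (∑ i, f k (z i)) / Fintype.card ι) ∂ν := by
          simp
      _ ≤ _ := Finset.sum_le_sum fun ε _ => hpair.trans (integral_ghost_sup_le hf hc ε)
  have hnot : ∑ ε : ι → Bool, ∫ z, signedSup f (fun i => !ε i) z ∂ν
      = ∑ ε : ι → Bool, ∫ z, signedSup f ε z ∂ν :=
    Equiv.sum_comp (Equiv.piCongrRight fun _ : ι => Equiv.boolNot)
      fun ε => ∫ z, signedSup f ε z ∂ν
  have hA : ∀ ε : ι → Bool, Integrable (signedSup f ε) ν := fun ε =>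
    integrable_ciSup (c := c) (fun k => (Finset.measurable_fun_sum _ fun i _ =>
      (hmf k i).const_mul _).div_const _) fun k z =>
      abs_sum_div_card_le fun i => by rw [abs_mul, abs_boolSign, one_mul]; exact hc k _
  have htotal : ∑ ε : ι → Bool, ∫ z, signedSup f ε z ∂ν ≤ 2 ^ Fintype.card ι * b := by
    rw [← integral_finsetSum _ fun ε _ => hA ε]
    calc _ ≤ ∫ _, (2 : ℝ) ^ Fintype.card ι * b ∂ν :=
          integral_mono (integrable_finsetSum _ fun ε _ => hA ε) (integrable_const _)
            fun z => (div_le_iff₀' (by positivity)).1 (hb z)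
      _ = _ := by simp
  rw [Finset.sum_add_distrib, hnot] at hsigns
  have hpos : (0 : ℝ) < 2 ^ Fintype.card ι := by positivity
  refine le_of_mul_le_mul_left (hsigns.trans ?_) hpos
  linarith

end Symmetrisation

/-! ### The test error bound for an arbitrary step size -/

theorem exists_denseSeq_closedBall (d : ℕ) {ρ : ℝ} (hρ : 0 ≤ ρ) :
    ∃ x : ℕ → EuclideanSpace ℝ (Fin d), (∀ k, ‖x k‖ ≤ ρ) ∧
      ∀ u : EuclideanSpace ℝ (Fin d) → ℝ, Continuous u → ∀ c, (∀ k, u (x k) ≤ c) →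
        ∀ y, ‖y‖ ≤ ρ → u y ≤ c := by
  have : Nonempty (Metric.closedBall (0 : EuclideanSpace ℝ (Fin d)) ρ) := ⟨⟨0, by simpa⟩⟩
  set e := TopologicalSpace.denseSeq (Metric.closedBall (0 : EuclideanSpace ℝ (Fin d)) ρ) with he
  refine ⟨fun k => e k, fun k => mem_closedBall_zero_iff.1 (e k).2, fun u hu c hc y hy => ?_⟩
  have hclosed : IsClosed {q : Metric.closedBall (0 : EuclideanSpace ℝ (Fin d)) ρ | u q ≤ c} :=
    isClosed_le (hu.comp continuous_subtype_val) continuous_const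
  have hdense := TopologicalSpace.denseRange_denseSeq
    (Metric.closedBall (0 : EuclideanSpace ℝ (Fin d)) ρ)
  exact hdense.induction_on (p := fun q => u q ≤ c) ⟨y, by simpa using hy⟩ hclosed hc

namespace DistributedProblem

variable {n m : ℕ} {L B C D G : ℝ} (S : DistributedProblem.{u, v} n m L B C D G)

/-- The global empirical risk of the data `z`. -/
noncomputable def empiricalRisk (z : Fin n × Fin m → S.𝒵) (x : EuclideanSpace ℝ (Fin S.d)) : ℝ :=
  (∑ v, ∑ i, S.loss x (z (v, i))) / ((n : ℝ) * m)

/-- All the data points. -/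
def data (ω : S.Ω) : Fin n × Fin m → S.𝒵 := fun p => S.Z p.1 p.2 ω

/-- All the draws of data points. -/
def draws (ω : S.Ω) : ℕ × Fin n → Fin m := fun q => S.K q.1 q.2 ω

/-- The vector fields of the algorithm with data `z` and draws `k`. -/
def field (z : Fin n × Fin m → S.𝒵) (k : ℕ × Fin n → Fin m) :
    ℕ → Fin n → EuclideanSpace ℝ (Fin S.d) → EuclideanSpace ℝ (Fin S.d) :=
  sampledField (fun w i x => S.subgrad x (z (w, i))) fun s w => k (s, w)

/-- The ergodic average as a function of the data and of the draws. -/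
noncomputable def averageOf (η : ℝ) (t : ℕ) (v : Fin n) (z : Fin n × Fin m → S.𝒵)
    (k : ℕ × Fin n → Fin m) : EuclideanSpace ℝ (Fin S.d) :=
  (t : ℝ)⁻¹ • ∑ s ∈ Finset.range t, gossipDescent S.P η (S.field z k) s v

theorem iterate_eq (η : ℝ) (ω : S.Ω) (s : ℕ) :
    S.iterate η ω s = gossipDescent S.P η (S.field (S.data ω) (S.draws ω)) s := by
  induction s with
  | zero => rfl
  | succ s ih =>
    ext1 v
    rw [iterate, gossipDescent, ih]
    rfl

theorem average_eq (η : ℝ) (t : ℕ) (v : Fin n) (ω : S.Ω) :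
    S.average η t v ω = S.averageOf η t v (S.data ω) (S.draws ω) := by
  simp only [average, averageOf, iterate_eq]

theorem sample_size_pos (S : DistributedProblem.{u, v} n m L B C D G) (v : Fin n) : 0 < m := by
  obtain ⟨ω⟩ := nonempty_of_isProbabilityMeasure S.Pr
  exact (S.K 0 v ω).pos

theorem measurable_data : Measurable S.data :=
  measurable_pi_lambda _ fun p => S.Z_measurable p.1 p.2

theorem measurable_draws : Measurable S.draws :=
  measurable_pi_lambda _ fun q => S.K_measurable q.1 q.2

theorem map_data : S.Pr.map S.data = Measure.pi fun _ => S.μ := by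
  have h := (iIndepFun_iff_map_fun_eq_pi_map
    fun p : Fin n × Fin m => (S.Z_measurable p.1 p.2).aemeasurable).1 S.Z_indep
  simp only [S.Z_law] at h
  exact h

theorem map_data_draws : S.Pr.map (fun ω => (S.data ω, S.draws ω))
    = (Measure.pi fun _ => S.μ).prod (S.Pr.map S.draws) := by
  rw [← S.map_data]
  exact (indepFun_iff_map_prod_eq_prod_map_map S.measurable_data.aemeasurable
    S.measurable_draws.aemeasurable).1 S.Z_K_indep

theorem continuous_loss (hL : 0 ≤ L) (z : S.𝒵) : Continuous fun x => S.loss x z :=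
  (LipschitzWith.of_dist_le_mul (K := L.toNNReal) fun x y => by
    rw [Real.dist_eq, dist_eq_norm, Real.coe_toNNReal _ hL]
    exact S.loss_lipschitz z x y).continuous

theorem abs_loss_le (hL : 0 ≤ L) {x : EuclideanSpace ℝ (Fin S.d)} {ρ : ℝ} (hx : ‖x‖ ≤ ρ)
    (z : S.𝒵) : |S.loss x z| ≤ |B| + |C| + L * ρ := by
  have h1 := S.le_loss x z
  have h2 := S.loss_zero_le z
  have h3 := (abs_le.1 (S.loss_lipschitz z x 0)).2
  rw [sub_zero] at h3
  have h4 := mul_le_mul_of_nonneg_left hx hL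
  have h5 : 0 ≤ L * ‖x‖ := by positivity
  have := le_abs_self B
  have := neg_abs_le C
  have := abs_nonneg B
  have := abs_nonneg C
  exact abs_le.2 ⟨by linarith, by linarith⟩

theorem integrable_loss (hL : 0 ≤ L) (x : EuclideanSpace ℝ (Fin S.d)) :
    Integrable (S.loss x) S.μ :=
  Integrable.of_bound (S.loss_measurable x).aestronglyMeasurable _
    (Filter.Eventually.of_forall fun z => S.abs_loss_le hL le_rfl z)

theorem continuous_risk (hL : 0 ≤ L) : Continuous S.risk := by
  refine (LipschitzWith.of_dist_le_mul (K := L.toNNReal) fun x y => ?_).continuous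
  rw [Real.dist_eq, dist_eq_norm, Real.coe_toNNReal _ hL, risk, risk,
    ← integral_sub (S.integrable_loss hL x) (S.integrable_loss hL y)]
  have h := norm_integral_le_of_norm_le_const (μ := S.μ) (C := L * ‖x - y‖)
    (f := fun z => S.loss x z - S.loss y z)
    (Filter.Eventually.of_forall fun z => S.loss_lipschitz z x y)
  simpa using h

theorem continuous_empiricalRisk (hL : 0 ≤ L) (z : Fin n × Fin m → S.𝒵) :
    Continuous (S.empiricalRisk z) :=
  (continuous_finsetSum _ fun _ _ => continuous_finsetSum _ fun _ _ =>
    S.continuous_loss hL _).div_const _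

theorem abs_empiricalRisk_le (hL : 0 ≤ L) (hn : 0 < n) (hm : 0 < m)
    {x : EuclideanSpace ℝ (Fin S.d)} {ρ : ℝ} (hx : ‖x‖ ≤ ρ) (z : Fin n × Fin m → S.𝒵) :
    |S.empiricalRisk z x| ≤ |B| + |C| + L * ρ := by
  have : Nonempty (Fin n × Fin m) := ⟨(⟨0, hn⟩, ⟨0, hm⟩)⟩
  have h := abs_sum_div_card_le (a := fun p : Fin n × Fin m => S.loss x (z p))
    fun p => S.abs_loss_le hL hx (z p)
  rw [Fintype.sum_prod_type] at h
  simpa [empiricalRisk] using h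

theorem abs_risk_le (hL : 0 ≤ L) {x : EuclideanSpace ℝ (Fin S.d)} {ρ : ℝ} (hx : ‖x‖ ≤ ρ) :
    |S.risk x| ≤ |B| + |C| + L * ρ := by
  have h := norm_integral_le_of_norm_le_const (μ := S.μ) (f := S.loss x)
    (Filter.Eventually.of_forall fun z => S.abs_loss_le hL hx z)
  simpa [risk] using h

theorem measurable_empiricalRisk_comp (hL : 0 ≤ L) {β : Type*} [MeasurableSpace β]
    {z : β → Fin n × Fin m → S.𝒵} {x : β → EuclideanSpace ℝ (Fin S.d)} (hz : Measurable z)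
    (hx : Measurable x) : Measurable fun b => S.empiricalRisk (z b) (x b) := by
  have h : Measurable (Function.uncurry S.loss) :=
    measurable_uncurry_of_continuous_of_measurable (fun z => S.continuous_loss hL z)
      S.loss_measurable
  refine (Finset.measurable_fun_sum _ fun v _ => Finset.measurable_fun_sum _ fun i _ =>
    ?_).div_const _
  exact h.comp (hx.prodMk ((measurable_pi_apply (v, i)).comp hz))

theorem measurable_averageOf_comp (η : ℝ) (t : ℕ) (v : Fin n) {β : Type*} [MeasurableSpace β]
    {z : β → Fin n × Fin m → S.𝒵} {k : β → ℕ × Fin n → Fin m} (hz : Measurable z)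
    (hk : Measurable k) : Measurable fun b => S.averageOf η t v (z b) (k b) := by
  have hzk : ∀ s w, Measurable fun b => z b (w, k b (s, w)) := fun s w =>
    (measurable_from_prod_countable_left (f := fun q : (Fin n × Fin m → S.𝒵) × Fin m =>
      q.1 (w, q.2)) fun i => measurable_pi_apply (w, i)).comp
      (hz.prodMk ((measurable_pi_apply (s, w)).comp hk))
  refine (Finset.measurable_fun_sum _ fun s _ => ?_).fun_const_smul _
  exact measurable_gossipDescent (φ := fun s w b x => S.subgrad x (z b (w, k b (s, w))))
    (fun s w => S.subgrad_measurable.comp (measurable_snd.prodMk ((hzk s w).comp measurable_fst)))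
    s v

theorem measurable_average (η : ℝ) (t : ℕ) (v : Fin n) : Measurable (S.average η t v) := by
  simpa only [← average_eq] using
    S.measurable_averageOf_comp η t v S.measurable_data S.measurable_draws

theorem norm_subgrad_le (hL : 0 ≤ L) (x : EuclideanSpace ℝ (Fin S.d)) (z : S.𝒵) :
    ‖S.subgrad x z‖ ≤ L :=
  norm_subgradient_le hL (S.loss_lipschitz z) (S.subgrad_spec z x)

theorem norm_averageOf_le (hL : 0 ≤ L) (hCB : C ≤ B) {η : ℝ} (hη : 0 ≤ η) {t : ℕ} (ht : 1 ≤ t)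
    (v : Fin n) (z : Fin n × Fin m → S.𝒵) (k : ℕ × Fin n → Fin m) :
    ‖S.averageOf η t v z k‖ ≤ √(((t : ℝ) - 1) * (η ^ 2 * L ^ 2 + 2 * η * (B - C))) := by
  refine norm_average_le ht fun s hs => ?_
  refine (norm_gossipDescent_le (L := L) (b := B - C) S.doubly_stochastic hη
    (fun s w x => S.norm_subgrad_le hL _ _) (fun s w x => ?_) s v).trans ?_
  · have h1 := S.subgrad_spec (z (w, k (s, w))) x 0
    have h2 := S.loss_zero_le (z (w, k (s, w)))
    have h3 := S.le_loss x (z (w, k (s, w)))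
    rw [zero_sub, inner_neg_right] at h1
    change -(B - C) ≤ inner ℝ (S.subgrad x (z (w, k (s, w)))) x
    linarith
  · have h1 : (s : ℝ) ≤ t - 1 := by
      have : s + 1 ≤ t := Finset.mem_range.1 hs
      have : (s : ℝ) + 1 ≤ t := by exact_mod_cast this
      linarith
    have h2 : 0 ≤ η ^ 2 * L ^ 2 + 2 * η * (B - C) := by
      have : 0 ≤ B - C := by linarith
      positivity
    gcongr

/-- The generalisation error of any model that stays in a ball is at most twice the Rademacher
complexity of the ball; the supremum is taken over a dense sequence, to keep it measurable. -/
theorem integral_risk_sub_empiricalRisk_le (hL : 0 ≤ L) (hD : 0 ≤ D) (hn : 0 < n) (hm : 0 < m)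
    {ρ : ℝ} (hρ : 0 ≤ ρ) {X : S.Ω → EuclideanSpace ℝ (Fin S.d)} (hX : Measurable X)
    (hXρ : ∀ ω, ‖X ω‖ ≤ ρ) :
    ∫ ω, S.risk (X ω) - S.empiricalRisk (S.data ω) (X ω) ∂S.Pr
      ≤ 2 * (D * ρ / √((n : ℝ) * m)) := by
  obtain ⟨x, hxρ, hx⟩ := exists_denseSeq_closedBall S.d hρ
  have hne : Nonempty (Fin n × Fin m) := ⟨(⟨0, hn⟩, ⟨0, hm⟩)⟩
  set c := |B| + |C| + L * ρ with hc
  have hcard : (Fintype.card (Fin n × Fin m) : ℝ) = n * m := by simp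
  have hemp : ∀ z k, (∑ p, S.loss (x k) (z p)) / (Fintype.card (Fin n × Fin m) : ℝ)
      = S.empiricalRisk z (x k) := by
    intro z k
    rw [hcard, Fintype.sum_prod_type]
    rfl
  have hm1 : ∀ k, Measurable fun z => S.risk (x k) - S.empiricalRisk z (x k) := fun k =>
    measurable_const.sub (S.measurable_empiricalRisk_comp hL measurable_id measurable_const)
  have hb1 : ∀ k z, |S.risk (x k) - S.empiricalRisk z (x k)| ≤ c + c := fun k z =>
    (abs_sub _ _).trans (add_le_add (S.abs_risk_le hL (hxρ k))
      (S.abs_empiricalRisk_le hL hn hm (hxρ k) z))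
  have hsym := integral_sup_mean_sub_le (ι := Fin n × Fin m) (μ := S.μ)
    (f := fun k => S.loss (x k)) (c := c) (b := D * ρ / √((n : ℝ) * m))
    (fun k => S.loss_measurable (x k)) (fun k z => S.abs_loss_le hL (hxρ k) z) (fun z => by
      have hbdd : Bornology.IsBounded (Set.range x) :=
        (Metric.isBounded_closedBall (x := (0 : EuclideanSpace ℝ (Fin S.d))) (r := ρ)).subset (by
          rintro _ ⟨k, rfl⟩
          simpa using hxρ k)
      have h1 := S.rademacher_le z (Set.range x) hbdd
      have h2 : sSup ((fun x => ‖x‖) '' Set.range x) ≤ ρ := by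
        refine csSup_le ((Set.range_nonempty x).image _) ?_
        rintro _ ⟨_, ⟨k, rfl⟩, rfl⟩
        exact hxρ k
      have h3 : (∑ ε : Fin n × Fin m → Bool, signedSup (fun k => S.loss (x k)) ε z)
          / 2 ^ Fintype.card (Fin n × Fin m) = rademacherComplexity S.loss (Set.range x) z := by
        unfold rademacherComplexity signedSup boolSign
        simp only [← Set.range_comp]
        rfl
      rw [h3]
      refine h1.trans ?_
      gcongr)
  have hrisk : ∀ k, ∫ y, S.loss (x k) y ∂S.μ = S.risk (x k) := fun _ => rfl
  simp only [hemp, hrisk] at hsym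
  have hint2 : Integrable (fun z => ⨆ k, (S.risk (x k) - S.empiricalRisk z (x k)))
      (Measure.pi fun _ => S.μ) := integrable_ciSup hm1 hb1
  rw [← S.map_data] at hint2 hsym
  rw [integral_map S.measurable_data.aemeasurable hint2.1] at hsym
  refine le_trans (integral_mono ?_ (hint2.comp_measurable S.measurable_data) fun ω => ?_) hsym
  · refine Integrable.of_bound (C := c + c) ((S.continuous_risk hL).measurable.comp hX |>.sub
      (S.measurable_empiricalRisk_comp hL S.measurable_data hX)).aestronglyMeasurable
      (Filter.Eventually.of_forall fun ω => ?_)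
    exact (abs_sub _ _).trans (add_le_add (S.abs_risk_le hL (hXρ ω))
      (S.abs_empiricalRisk_le hL hn hm (hXρ ω) _))
  · exact hx (fun y => S.risk y - S.empiricalRisk (S.data ω) y)
      ((S.continuous_risk hL).sub (S.continuous_empiricalRisk hL _)) _
      (fun k => le_ciSup (f := fun k => S.risk (x k) - S.empiricalRisk (S.data ω) (x k))
        ⟨c + c, by rintro _ ⟨k, rfl⟩; exact (abs_le.1 (hb1 k _)).2⟩ k) _ (hXρ ω)

/-- For almost all data, the ball of radius `G` contains models that are at least as good on the
data as the minimiser of the test risk, up to an arbitrarily small error. -/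
theorem ae_exists_empiricalRisk_lt (hL : 0 ≤ L) (hG : 0 ≤ G) :
    ∀ᵐ z ∂Measure.pi fun _ : Fin n × Fin m => S.μ, ∀ j : ℕ, ∃ y, ‖y‖ ≤ G ∧
      S.empiricalRisk z y < S.empiricalRisk z S.xStar + 1 / ((j : ℝ) + 1) := by
  obtain ⟨y, hyG, hy⟩ := exists_denseSeq_closedBall S.d hG
  have hmeas : ∀ x, Measurable fun z => S.empiricalRisk z x := fun x =>
    S.measurable_empiricalRisk_comp hL measurable_id measurable_const
  suffices h : ∀ᵐ z ∂Measure.pi fun _ : Fin n × Fin m => S.μ, ∀ j : ℕ, ∃ i,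
      S.empiricalRisk z (y i) < S.empiricalRisk z S.xStar + 1 / ((j : ℝ) + 1) by
    filter_upwards [h] with z hz j
    obtain ⟨i, hi⟩ := hz j
    exact ⟨y i, hyG i, hi⟩
  rw [← S.map_data, ae_map_iff S.measurable_data.aemeasurable]
  · filter_upwards [S.XStar_spec, S.XStar_norm_le] with ω h1 h2 j
    by_contra hcon
    push Not at hcon
    have h3 := hy (fun x => -S.empiricalRisk (S.data ω) x) (S.continuous_empiricalRisk hL _).neg
      (-(S.empiricalRisk (S.data ω) S.xStar + 1 / ((j : ℝ) + 1))) (fun i => neg_le_neg (hcon i))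
      (S.XStar ω) h2
    have h4 : S.empiricalRisk (S.data ω) (S.XStar ω) ≤ S.empiricalRisk (S.data ω) S.xStar :=
      h1 (Set.mem_univ _)
    have h5 : (0 : ℝ) < 1 / ((j : ℝ) + 1) := by positivity
    linarith
  · simp only [Set.ofPred_forall, Set.ofPred_exists]
    exact MeasurableSet.iInter fun j => MeasurableSet.iUnion fun i =>
      measurableSet_lt (hmeas _) ((hmeas _).add_const _)

/-- The optimisation error of the ergodic average is compared with the minimiser of the test risk,
whose empirical risk has mean `S.risk S.xStar`. -/
theorem integral_empiricalRisk_average_le (hL : 0 ≤ L) (hCB : C ≤ B) (hG : 0 ≤ G) {η : ℝ}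
    (hη : 0 < η) {t : ℕ} (ht : 1 ≤ t) (v : Fin n) (hm : 0 < m) :
    ∫ ω, S.empiricalRisk (S.data ω) (S.average η t v ω) ∂S.Pr
      ≤ S.risk S.xStar + (G ^ 2 / (2 * η * t)
        + 10 * (η * L ^ 2 * (1 + Real.log n) / (1 - S.σ₂))) := by
  have hn := v.pos
  set ν : Measure (Fin n × Fin m → S.𝒵) := Measure.pi fun _ => S.μ with hν
  set E₀ : ℝ := G ^ 2 / (2 * η * t) + 10 * (η * L ^ 2 * (1 + Real.log n) / (1 - S.σ₂)) with hE₀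
  have : IsProbabilityMeasure (S.Pr.map S.draws) :=
    Measure.isProbabilityMeasure_map S.measurable_draws.aemeasurable
  have hmeas : Measurable fun p : (Fin n × Fin m → S.𝒵) × (ℕ × Fin n → Fin m) =>
      S.empiricalRisk p.1 (S.averageOf η t v p.1 p.2) :=
    S.measurable_empiricalRisk_comp hL measurable_fst
      (S.measurable_averageOf_comp η t v measurable_fst measurable_snd)
  have hint : Integrable (fun p : (Fin n × Fin m → S.𝒵) × (ℕ × Fin n → Fin m) =>
      S.empiricalRisk p.1 (S.averageOf η t v p.1 p.2)) (ν.prod (S.Pr.map S.draws)) :=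
    Integrable.of_bound hmeas.aestronglyMeasurable _ (Filter.Eventually.of_forall fun p =>
      S.abs_empiricalRisk_le hL hn hm (S.norm_averageOf_le hL hCB hη.le ht v p.1 p.2) p.1)
  have hxs_int : ∀ (p : Fin n × Fin m), Integrable (fun z : Fin n × Fin m → S.𝒵 =>
      S.loss S.xStar (z p)) ν := fun p =>
    Integrable.of_bound ((S.loss_measurable _).comp (measurable_pi_apply p)).aestronglyMeasurable _
      (Filter.Eventually.of_forall fun z => S.abs_loss_le hL le_rfl _)
  have hxs_int' : Integrable (fun z => S.empiricalRisk z S.xStar) ν :=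
    (integrable_finsetSum _ fun v _ => integrable_finsetSum _ fun i _ => hxs_int (v, i)).div_const _
  have hxs : ∫ z, S.empiricalRisk z S.xStar ∂ν = S.risk S.xStar := by
    have h1 : ∀ p : Fin n × Fin m, ∫ z, S.loss S.xStar (z p) ∂ν = S.risk S.xStar := fun p =>
      integral_comp_eval (μ := fun _ : Fin n × Fin m => S.μ)
        (S.loss_measurable _).aestronglyMeasurable
    simp only [empiricalRisk]
    rw [integral_div, integral_finsetSum _ fun v _ => integrable_finsetSum _ fun i _ =>
      hxs_int (v, i)]
    have h2 : ∀ v : Fin n, ∫ z, ∑ i : Fin m, S.loss S.xStar (z (v, i)) ∂ν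
        = m * S.risk S.xStar := by
      intro v
      rw [integral_finsetSum _ fun i _ => hxs_int (v, i)]
      simp [h1]
    have hn0 : (n : ℝ) ≠ 0 := by positivity
    have hm0 : (m : ℝ) ≠ 0 := by positivity
    simp only [h2, Finset.sum_const, Finset.card_univ, Fintype.card_fin, nsmul_eq_mul]
    field_simp
  have hcond : ∀ᵐ z ∂ν, ∫ k, S.empiricalRisk z (S.averageOf η t v z k) ∂S.Pr.map S.draws
      ≤ S.empiricalRisk z S.xStar + E₀ := by
    filter_upwards [S.ae_exists_empiricalRisk_lt hL hG] with z hz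
    have hzm : Measurable fun k => S.empiricalRisk z (S.averageOf η t v z k) :=
      S.measurable_empiricalRisk_comp hL measurable_const
        (S.measurable_averageOf_comp η t v measurable_const measurable_id)
    rw [integral_map S.measurable_draws.aemeasurable hzm.aestronglyMeasurable]
    refine le_of_forall_pos_le_add fun ε hε => ?_
    obtain ⟨j, hj⟩ := exists_nat_one_div_lt hε
    obtain ⟨y, hyG, hyr⟩ := hz j
    have h1 := integral_gossipDescent_average_sub_le (μ := S.Pr) (L := L) (η := η)
      (h := fun w i x => S.loss x (z (w, i))) (g := fun w i x => S.subgrad x (z (w, i)))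
      (K := S.K) hm S.doubly_stochastic S.normal S.spectral_gap hη
      (fun w i => S.loss_convex _) (fun w i => S.loss_lipschitz _)
      (fun w i => S.subgrad_measurable.comp measurable_prodMk_right)
      (fun w i x => S.norm_subgrad_le hL _ _) (fun w i => S.subgrad_spec _)
      S.K_measurable S.K_indep S.K_uniform ht v y
    have ht0 : (0 : ℝ) < t := by exact_mod_cast ht
    have h2 : ‖y‖ ^ 2 / (2 * η * t) ≤ G ^ 2 / (2 * η * t) := by gcongr
    have h3 : ∫ ω, S.empiricalRisk z (S.averageOf η t v z (S.draws ω)) ∂S.Pr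
        ≤ S.empiricalRisk z y + (‖y‖ ^ 2 / (2 * η * t)
          + 10 * (η * L ^ 2 * (1 + Real.log n) / (1 - S.σ₂))) := h1
    linarith
  calc _ = ∫ p, S.empiricalRisk p.1 (S.averageOf η t v p.1 p.2)
        ∂S.Pr.map (fun ω => (S.data ω, S.draws ω)) := by
        rw [integral_map (S.measurable_data.prodMk S.measurable_draws).aemeasurable
          hmeas.aestronglyMeasurable]
        simp only [average_eq]
    _ = ∫ z, ∫ k, S.empiricalRisk z (S.averageOf η t v z k) ∂S.Pr.map S.draws ∂ν := by
        rw [S.map_data_draws, integral_prod _ hint]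
    _ ≤ ∫ z, (S.empiricalRisk z S.xStar + E₀) ∂ν :=
        integral_mono_ae hint.integral_prod_left
          (hxs_int'.add (integrable_const _)) hcond
    _ = _ := by
        rw [integral_add hxs_int' (integrable_const _), hxs]
        simp

/-- The generalisation error and the optimisation error add up, since the empirical risk of the
minimiser of the test risk has the right mean. -/
theorem testError_le (hL : 0 ≤ L) (hCB : C ≤ B) (hD : 0 ≤ D) (hG : 0 ≤ G) {η : ℝ}
    (hη : 0 < η) {t : ℕ} (ht : 1 ≤ t) (v : Fin n) :
    S.testError η t v
      ≤ 2 * D * √(((t : ℝ) - 1) * (η ^ 2 * L ^ 2 + 2 * η * (B - C)) / ((n : ℝ) * m))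
        + (G ^ 2 / (2 * η * t) + 10 * (η * L ^ 2 * (1 + Real.log n) / (1 - S.σ₂))) := by
  have hn := v.pos
  have hm : 0 < m := S.sample_size_pos v
  set ρ := √(((t : ℝ) - 1) * (η ^ 2 * L ^ 2 + 2 * η * (B - C))) with hρ
  have hρ0 : 0 ≤ ((t : ℝ) - 1) * (η ^ 2 * L ^ 2 + 2 * η * (B - C)) := by
    have h1 : 0 ≤ B - C := by linarith
    have h2 : (1 : ℝ) ≤ t := by exact_mod_cast ht
    have h3 : 0 ≤ (t : ℝ) - 1 := by linarith
    positivity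
  have hXm := S.measurable_average η t v
  have hXρ : ∀ ω, ‖S.average η t v ω‖ ≤ ρ := fun ω => by
    rw [average_eq]
    exact S.norm_averageOf_le hL hCB hη.le ht v _ _
  have h1 := S.integral_risk_sub_empiricalRisk_le hL hD hn hm (Real.sqrt_nonneg _) hXm hXρ
  have h2 := S.integral_empiricalRisk_average_le hL hCB hG hη ht v hm
  rw [integral_sub] at h1
  · rw [Real.sqrt_div hρ0]
    have h3 : 2 * (D * ρ / √((n : ℝ) * m)) = 2 * D * (ρ / √((n : ℝ) * m)) := by ring
    rw [h3] at h1
    unfold testError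
    linarith
  · exact Integrable.of_bound ((S.continuous_risk hL).measurable.comp hXm).aestronglyMeasurable _
      (Filter.Eventually.of_forall fun ω => S.abs_risk_le hL (hXρ ω))
  · exact Integrable.of_bound (S.measurable_empiricalRisk_comp hL
      S.measurable_data hXm).aestronglyMeasurable _
      (Filter.Eventually.of_forall fun ω => S.abs_empiricalRisk_le hL hn hm (hXρ ω) _)

/-- At time `1` the model is still at the origin, whatever the step size. -/
theorem testError_one_le (hL : 0 ≤ L) (η : ℝ) (v : Fin n) : S.testError η 1 v ≤ B - C := by
  have h0 : ∀ ω, S.average η 1 v ω = 0 := fun ω => by simp [average, iterate]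
  have h1 : S.risk 0 ≤ B := by
    calc _ ≤ ∫ _, B ∂S.μ :=
          integral_mono (S.integrable_loss hL 0) (integrable_const _) S.loss_zero_le
      _ = B := by simp
  have h2 : C ≤ S.risk S.xStar := by
    calc C = ∫ _, C ∂S.μ := by simp
      _ ≤ _ := integral_mono (integrable_const _) (S.integrable_loss hL _) (S.le_loss _)
  simp only [testError, h0, integral_const, probReal_univ, one_smul]
  linarith

end DistributedProblem

/-! ### Balancing the two terms of the rates -/

theorem cbrt_pow_three {N : ℝ} (hN : 0 < N) : (N ^ ((1 : ℝ) / 3)) ^ 3 = N := by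
  rw [← Real.rpow_natCast, ← Real.rpow_mul hN.le]; norm_num

theorem cbrt_sq {N : ℝ} (hN : 0 < N) : (N ^ ((1 : ℝ) / 3)) ^ 2 = N ^ ((2 : ℝ) / 3) := by
  rw [← Real.rpow_natCast, ← Real.rpow_mul hN.le]; norm_num

theorem inv_le_inv_add_sqrt {p y : ℝ} (hp : 0 < p) (hy : 0 < y) :
    1 / p ≤ 1 / y + √(y / p ^ 3) := by
  rcases le_total y p with h | h
  · have h1 : 1 / p ≤ 1 / y := one_div_le_one_div_of_le hy h
    have := Real.sqrt_nonneg (y / p ^ 3)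
    linarith
  · have h1 : 1 / p ≤ √(y / p ^ 3) := by
      refine Real.le_sqrt_of_sq_le ?_
      rw [le_div_iff₀ (by positivity)]
      have : (1 / p) ^ 2 * p ^ 3 = p := by field_simp
      linarith
    have : 0 < 1 / y := by positivity
    linarith

theorem sq_le_of_one_div_le {p y κ : ℝ} (hp : 0 < p) (hy : 0 < y) (h : 1 / y ≤ κ * (1 / p)) :
    p ^ 2 ≤ κ ^ 2 * y ^ 2 := by
  have h1 : p ≤ κ * y := by
    have := mul_le_mul_of_nonneg_right h (mul_pos hp hy).le
    have e1 : 1 / y * (p * y) = p := by field_simp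
    have e2 : κ * (1 / p) * (p * y) = κ * y := by field_simp
    linarith
  calc p ^ 2 ≤ (κ * y) ^ 2 := pow_le_pow_left₀ hp.le h1 2
    _ = _ := by ring

theorem sq_le_of_sqrt_le {p y κ : ℝ} (hp : 0 < p) (hy : 0 < y)
    (h : √(y / p ^ 3) ≤ κ * (1 / p)) : y ^ 2 ≤ κ ^ 4 * p ^ 2 := by
  have h1 := pow_le_pow_left₀ (Real.sqrt_nonneg _) h 2
  rw [Real.sq_sqrt (by positivity), div_le_iff₀ (by positivity)] at h1
  have h2 : (κ * (1 / p)) ^ 2 * p ^ 3 = κ ^ 2 * p := by field_simp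
  rw [h2] at h1
  calc y ^ 2 ≤ (κ ^ 2 * p) ^ 2 := pow_le_pow_left₀ hy.le h1 2
    _ = _ := by ring

theorem one_div_le_of_sq_le {p y A : ℝ} (hp : 0 < p) (hy : 0 < y) (hA : 0 ≤ A)
    (h : p ^ 2 ≤ A * y ^ 2) : 1 / y ≤ (1 + A) * (1 / p) := by
  have h1 : p ≤ (1 + A) * y := by
    refine abs_le_of_sq_le_sq' ?_ (by positivity) |>.2
    have : A * y ^ 2 ≤ (1 + A) ^ 2 * y ^ 2 := by gcongr; nlinarith
    nlinarith
  rw [mul_one_div, div_le_div_iff₀ hy hp]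
  linarith

theorem sqrt_le_of_sq_le {p y A : ℝ} (hp : 0 < p) (hA : 0 ≤ A)
    (h : y ^ 2 ≤ A * p ^ 2) : √(y / p ^ 3) ≤ (1 + A) * (1 / p) := by
  have h1 : y ≤ (1 + A) ^ 2 * p := by
    refine abs_le_of_sq_le_sq' ?_ (by positivity) |>.2
    have h2 : A ≤ ((1 + A) ^ 2) ^ 2 := by
      have : 1 + A ≤ (1 + A) ^ 2 := by nlinarith
      nlinarith
    have : A * p ^ 2 ≤ ((1 + A) ^ 2) ^ 2 * p ^ 2 := by gcongr
    nlinarith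
  refine Real.sqrt_le_iff.2 ⟨by positivity, ?_⟩
  rw [div_le_iff₀ (by positivity)]
  have : ((1 + A) * (1 / p)) ^ 2 * p ^ 3 = (1 + A) ^ 2 * p := by field_simp
  linarith

section Rates

variable {n m t : ℕ} {σ : ℝ}

/-- The rate of `etaStar` has the form `1 / u + √(u / p ^ 3)` for `u = (1 - σ) * √t` and
`p ^ 3 = n * m * (1 - σ)`. -/
theorem rateStar_eq (hn : 1 ≤ n) (hm : 1 ≤ m) (hσ : σ < 1) :
    rateStar n m t σ = 1 / ((1 - σ) * √t)
      + √(((1 - σ) * √t) / (((n : ℝ) * m * (1 - σ)) ^ ((1 : ℝ) / 3)) ^ 3) := by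
  have hd : 0 < 1 - σ := by linarith
  have hN : (0 : ℝ) < (n : ℝ) * m := by positivity
  rw [cbrt_pow_three (by positivity), rateStar]
  congr 2
  field_simp

theorem stopStar_eq (hn : 1 ≤ n) (hm : 1 ≤ m) (hσ : σ < 1) :
    stopStar n m σ * (1 - σ) ^ 2 = (((n : ℝ) * m * (1 - σ)) ^ ((1 : ℝ) / 3)) ^ 2 := by
  have hd : 0 < 1 - σ := by linarith
  have hN : (0 : ℝ) < (n : ℝ) * m := by positivity
  rw [cbrt_sq (by positivity), Real.mul_rpow hN.le hd.le, stopStar, div_mul_eq_mul_div,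
    div_eq_iff (by positivity), mul_assoc, ← Real.rpow_add hd, ← Real.rpow_natCast]
  norm_num

theorem rateOpt_eq (hn : 1 ≤ n) (hm : 1 ≤ m) :
    rateOpt n m t σ = 1 / √(t * (1 - σ))
      + √(√(t * (1 - σ)) / (((n : ℝ) * m) ^ ((1 : ℝ) / 3)) ^ 3) := by
  rw [cbrt_pow_three (by positivity), rateOpt]

theorem stopGraph_eq (hn : 1 ≤ n) (hm : 1 ≤ m) (hσ : σ < 1) :
    stopGraph n m σ * (1 - σ) = (((n : ℝ) * m) ^ ((1 : ℝ) / 3)) ^ 2 := by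
  have hd : 1 - σ ≠ 0 := by linarith
  rw [cbrt_sq (by positivity), stopGraph, div_mul_cancel₀ _ hd]

theorem one_le_logFactor (hn : 1 ≤ n) (hm : 1 ≤ m) (ht : 1 ≤ t) : 1 ≤ logFactor n m t := by
  have : (1 : ℝ) ≤ (n : ℝ) * m * t := by exact_mod_cast Nat.mul_pos (Nat.mul_pos hn hm) ht
  have := Real.log_nonneg this
  unfold logFactor; linarith

theorem one_add_log_le_logFactor (hn : 1 ≤ n) (hm : 1 ≤ m) (ht : 1 ≤ t) :
    1 + Real.log n ≤ logFactor n m t := by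
  have h0 : (0 : ℝ) < n := by positivity
  have h1 : (n : ℝ) ≤ (n : ℝ) * m * t := by
    exact_mod_cast (Nat.le_mul_of_pos_right n hm).trans (Nat.le_mul_of_pos_right _ ht)
  have := Real.log_le_log h0 h1
  unfold logFactor; linarith

theorem log_mul_sqrt_le_logFactor (hn : 1 ≤ n) (hm : 1 ≤ m) (ht : 1 ≤ t) :
    Real.log (t * √n) ≤ logFactor n m t := by
  have hn' : (1 : ℝ) ≤ n := by exact_mod_cast hn
  have h1 : (t : ℝ) * √n ≤ (n : ℝ) * m * t := by
    have h2 : √(n : ℝ) ≤ n := Real.sqrt_le_iff.2 ⟨by linarith, by nlinarith⟩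
    have h3 : (1 : ℝ) ≤ m := by exact_mod_cast hm
    calc (t : ℝ) * √n ≤ t * n := by gcongr
      _ ≤ t * n * m := le_mul_of_one_le_right (by positivity) h3
      _ = _ := by ring
  have h0 : 0 < (t : ℝ) * √n := by positivity
  have := Real.log_le_log h0 h1
  unfold logFactor; linarith

theorem third_le_log_mul_sqrt (ht : 1 ≤ t) (htn : 2 ≤ t * n) :
    1 / 3 ≤ Real.log (t * √n) := by
  have ht' : (1 : ℝ) ≤ t := by exact_mod_cast ht
  have h1 : √2 ≤ (t : ℝ) * √n := by
    refine Real.sqrt_le_iff.2 ⟨by positivity, ?_⟩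
    rw [mul_pow, Real.sq_sqrt (by positivity)]
    have h2 : (2 : ℝ) ≤ t * n := by exact_mod_cast htn
    nlinarith
  have h2 := Real.log_le_log (by positivity) h1
  rw [Real.log_sqrt (by norm_num)] at h2
  have := Real.log_two_gt_d9
  linarith

theorem rates_lower_bound (hn : 1 ≤ n) (hm : 1 ≤ m) (ht : 1 ≤ t) (hσ : σ < 1) :
    1 / ((n : ℝ) * m * (1 - σ)) ^ ((1 : ℝ) / 3) ≤ rateStar n m t σ ∧
    1 / ((n : ℝ) * m) ^ ((1 : ℝ) / 3) ≤ rateOpt n m t σ ∧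
    1 / ((n : ℝ) * m) ^ ((1 : ℝ) / 3) ≤ rateTest n m t σ := by
  have hd : 0 < 1 - σ := by linarith
  refine ⟨?_, ?_, ?_⟩
  · rw [rateStar_eq hn hm hσ]
    exact inv_le_inv_add_sqrt (by positivity) (by positivity)
  · rw [rateOpt_eq hn hm]
    exact inv_le_inv_add_sqrt (by positivity) (by positivity)
  · exact le_add_of_nonneg_left (by positivity)

theorem stop_of_rate_le (hn : 1 ≤ n) (hm : 1 ≤ m) (ht : 1 ≤ t) (hσ : σ < 1) (κ : ℝ) :
    (rateStar n m t σ ≤ κ * (1 / ((n : ℝ) * m * (1 - σ)) ^ ((1 : ℝ) / 3)) →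
      stopStar n m σ ≤ κ ^ 2 * t ∧ t ≤ κ ^ 4 * stopStar n m σ) ∧
    (rateOpt n m t σ ≤ κ * (1 / ((n : ℝ) * m) ^ ((1 : ℝ) / 3)) →
      stopGraph n m σ ≤ κ ^ 2 * t ∧ t ≤ κ ^ 4 * stopGraph n m σ) ∧
    (rateTest n m t σ ≤ κ * (1 / ((n : ℝ) * m) ^ ((1 : ℝ) / 3)) →
      stopGraph n m σ ≤ κ ^ 2 * t) := by
  have hd : 0 < 1 - σ := by linarith
  have ht0 : (0 : ℝ) < t := by positivity
  have hu : 0 < √(t * (1 - σ)) := by positivity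
  have hu2 : √(t * (1 - σ)) ^ 2 = t * (1 - σ) := Real.sq_sqrt (by positivity)
  have hw : 0 < (1 - σ) * √t := by positivity
  have hw2 : ((1 - σ) * √t) ^ 2 = t * (1 - σ) ^ 2 := by
    rw [mul_pow, Real.sq_sqrt ht0.le]; ring
  refine ⟨fun h => ?_, fun h => ?_, fun h => ?_⟩
  · rw [rateStar_eq hn hm hσ] at h
    have hp : 0 < ((n : ℝ) * m * (1 - σ)) ^ ((1 : ℝ) / 3) := by positivity
    have h1 := sq_le_of_one_div_le hp hw
      ((le_add_of_nonneg_right (Real.sqrt_nonneg _)).trans h)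
    have h2 := sq_le_of_sqrt_le hp hw ((le_add_of_nonneg_left (by positivity)).trans h)
    rw [← stopStar_eq hn hm hσ, hw2, ← mul_assoc] at h1 h2
    exact ⟨le_of_mul_le_mul_right h1 (by positivity), le_of_mul_le_mul_right h2 (by positivity)⟩
  · rw [rateOpt_eq hn hm] at h
    have hp : 0 < ((n : ℝ) * m) ^ ((1 : ℝ) / 3) := by positivity
    have h1 := sq_le_of_one_div_le hp hu
      ((le_add_of_nonneg_right (Real.sqrt_nonneg _)).trans h)
    have h2 := sq_le_of_sqrt_le hp hu ((le_add_of_nonneg_left (by positivity)).trans h)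
    rw [← stopGraph_eq hn hm hσ, hu2, ← mul_assoc] at h1 h2
    exact ⟨le_of_mul_le_mul_right h1 hd, le_of_mul_le_mul_right h2 hd⟩
  · have hp : 0 < ((n : ℝ) * m) ^ ((1 : ℝ) / 3) := by positivity
    have h1 := sq_le_of_one_div_le hp hu
      ((le_add_of_nonneg_right (by positivity)).trans h)
    rw [← stopGraph_eq hn hm hσ, hu2, ← mul_assoc] at h1
    exact le_of_mul_le_mul_right h1 hd

theorem rateStar_le_of_agree (hn : 1 ≤ n) (hm : 1 ≤ m) (ht : 1 ≤ t) (hσ : σ < 1) {A : ℝ}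
    (hA : 0 ≤ A) (h1 : t ≤ A * stopStar n m σ) (h2 : stopStar n m σ ≤ A * t) :
    rateStar n m t σ ≤ 2 * (1 + A) * (1 / ((n : ℝ) * m * (1 - σ)) ^ ((1 : ℝ) / 3)) := by
  have hd : 0 < 1 - σ := by linarith
  have ht0 : (0 : ℝ) < t := by positivity
  have hw : 0 < (1 - σ) * √t := by positivity
  have hw2 : ((1 - σ) * √t) ^ 2 = t * (1 - σ) ^ 2 := by
    rw [mul_pow, Real.sq_sqrt ht0.le]; ring
  have hp : 0 < ((n : ℝ) * m * (1 - σ)) ^ ((1 : ℝ) / 3) := by positivity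
  rw [rateStar_eq hn hm hσ]
  have e1 := one_div_le_of_sq_le hp hw hA (by
    rw [← stopStar_eq hn hm hσ, hw2, ← mul_assoc]; gcongr)
  have e2 := sqrt_le_of_sq_le (y := (1 - σ) * √t) hp hA (by
    rw [← stopStar_eq hn hm hσ, hw2, ← mul_assoc]; gcongr)
  linarith

theorem one_div_sqrt_le_of_stopGraph_le (hn : 1 ≤ n) (hm : 1 ≤ m) (ht : 1 ≤ t) (hσ : σ < 1) {A : ℝ}
    (hA : 0 ≤ A) (h2 : stopGraph n m σ ≤ A * t) :
    1 / √(t * (1 - σ)) ≤ (1 + A) * (1 / ((n : ℝ) * m) ^ ((1 : ℝ) / 3)) := by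
  have hd : 0 < 1 - σ := by linarith
  refine one_div_le_of_sq_le (by positivity) (by positivity) hA ?_
  rw [← stopGraph_eq hn hm hσ, Real.sq_sqrt (by positivity), ← mul_assoc]
  gcongr

theorem rateOpt_le_of_agree (hn : 1 ≤ n) (hm : 1 ≤ m) (ht : 1 ≤ t) (hσ : σ < 1) {A : ℝ}
    (hA : 0 ≤ A) (h1 : t ≤ A * stopGraph n m σ) (h2 : stopGraph n m σ ≤ A * t) :
    rateOpt n m t σ ≤ 2 * (1 + A) * (1 / ((n : ℝ) * m) ^ ((1 : ℝ) / 3)) := by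
  have hd : 0 < 1 - σ := by linarith
  rw [rateOpt_eq hn hm]
  have e1 := one_div_sqrt_le_of_stopGraph_le hn hm ht hσ hA h2
  have e2 := sqrt_le_of_sq_le (p := ((n : ℝ) * m) ^ ((1 : ℝ) / 3)) (y := √(t * (1 - σ)))
    (by positivity) hA (by
      rw [← stopGraph_eq hn hm hσ, Real.sq_sqrt (by positivity), ← mul_assoc]; gcongr)
  linarith

theorem rateTest_le_of_stop_le (hn : 1 ≤ n) (hm : 1 ≤ m) (ht : 1 ≤ t) (hσ : σ < 1) {A : ℝ}
    (hA : 0 ≤ A) (h2 : stopGraph n m σ ≤ A * t) :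
    rateTest n m t σ ≤ 2 * (1 + A) * (1 / ((n : ℝ) * m) ^ ((1 : ℝ) / 3)) := by
  have e1 := one_div_sqrt_le_of_stopGraph_le hn hm ht hσ hA h2
  have e2 : 0 ≤ A * (1 / ((n : ℝ) * m) ^ ((1 : ℝ) / 3)) := by positivity
  have e3 : 0 ≤ 1 / ((n : ℝ) * m) ^ ((1 : ℝ) / 3) := by positivity
  unfold rateTest
  linarith

end Rates

/-! ### The step sizes -/

section StepSizes

theorem sqrt_add_le_add_sqrt {x y : ℝ} (hx : 0 ≤ x) (hy : 0 ≤ y) : √(x + y) ≤ √x + √y := by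
  refine Real.sqrt_le_iff.2 ⟨by positivity, ?_⟩
  have h1 := Real.sq_sqrt hx
  have h2 := Real.sq_sqrt hy
  have h3 : 0 ≤ √x * √y := by positivity
  nlinarith

/-- The quantity under the root in `etaTest`. -/
noncomputable def testScale (n m t : ℕ) (σ : ℝ) : ℝ :=
  19 / 2 * (Real.log (t * √n) / (1 - σ)) + t / ((n : ℝ) * m) ^ ((2 : ℝ) / 3)

variable {L B C D G : ℝ} {n m t : ℕ} {σ : ℝ}

theorem etaStar_eq : etaStar L G t = G / L * (√t / √19 / t) := by
  rw [etaStar, Real.sqrt_mul (by norm_num), div_right_comm, Real.sqrt_div_self']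
  field_simp

theorem etaOpt_eq (ht : 1 ≤ t) (hσ : σ < 1) :
    etaOpt L G n t σ = G / L * (√(t * (1 - σ)) / √(19 * Real.log (t * √n)) / t) := by
  have hd : 0 < 1 - σ := by linarith
  have ht0 : (0 : ℝ) < t := by positivity
  have h19 : (0 : ℝ) ≤ 19 := by norm_num
  rw [etaOpt, Real.sqrt_mul h19, Real.sqrt_mul h19, Real.sqrt_mul ht0.le,
    Real.sqrt_div hd.le, div_right_comm, mul_div_right_comm, Real.sqrt_div_self']
  field_simp

theorem etaTest_eq : etaTest L G n m t σ = G / L * (√t / √(testScale n m t σ) / t) := by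
  rw [div_right_comm, Real.sqrt_div_self', etaTest, testScale]
  field_simp

theorem div_le_testScale (hn : 1 ≤ n) (hm : 1 ≤ m) (ht : 1 ≤ t) (hσ : σ < 1) :
    t / (((n : ℝ) * m) ^ ((1 : ℝ) / 3)) ^ 2 ≤ testScale n m t σ := by
  have hd : 0 < 1 - σ := by linarith
  have hlog : 0 ≤ Real.log (t * √n) := by
    refine Real.log_nonneg ?_
    have h1 : (1 : ℝ) ≤ t := by exact_mod_cast ht
    have h2 : 1 ≤ √(n : ℝ) := Real.one_le_sqrt.2 (by exact_mod_cast hn)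
    nlinarith
  rw [cbrt_sq (by positivity), testScale]
  exact le_add_of_nonneg_left (by positivity)

theorem testScale_pos (hn : 1 ≤ n) (hm : 1 ≤ m) (ht : 1 ≤ t) (hσ : σ < 1) :
    0 < testScale n m t σ :=
  lt_of_lt_of_le (by positivity) (div_le_testScale hn hm ht hσ)

theorem three_div_le_testScale (ht : 1 ≤ t) (htn : 2 ≤ t * n) (hσ : σ < 1) :
    3 / (1 - σ) ≤ testScale n m t σ := by
  have hd : 0 < 1 - σ := by linarith
  have hlog := third_le_log_mul_sqrt ht htn
  have h1 : 3 / (1 - σ) ≤ 19 / 2 * (Real.log (t * √n) / (1 - σ)) := by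
    rw [← mul_div_assoc]
    gcongr
    linarith
  rw [testScale]
  exact h1.trans (le_add_of_nonneg_right (by positivity))

theorem sqrt_testScale_div_le (hn : 1 ≤ n) (hm : 1 ≤ m) (ht : 1 ≤ t) (hσ : σ < 1) :
    √(testScale n m t σ) / √t ≤ 4 * (√(Real.log (t * √n)) / √(t * (1 - σ)))
      + 1 / ((n : ℝ) * m) ^ ((1 : ℝ) / 3) := by
  have hd : 0 < 1 - σ := by linarith
  have ht0 : (0 : ℝ) < t := by positivity
  have hp : 0 < ((n : ℝ) * m) ^ ((1 : ℝ) / 3) := by positivity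
  have hlog : 0 ≤ Real.log (t * √n) := by
    refine Real.log_nonneg ?_
    have h1 : (1 : ℝ) ≤ t := by exact_mod_cast ht
    have h2 : 1 ≤ √(n : ℝ) := Real.one_le_sqrt.2 (by exact_mod_cast hn)
    nlinarith
  rw [← Real.sqrt_div' _ ht0.le, ← Real.sqrt_div hlog]
  have h4 : (4 : ℝ) = √(4 ^ 2) := by rw [Real.sqrt_sq (by norm_num)]
  rw [h4, ← Real.sqrt_mul (by norm_num), ← Real.sqrt_sq (one_div_pos.2 hp).le]
  refine le_trans (Real.sqrt_le_sqrt ?_) ((sqrt_add_le_add_sqrt (by positivity) (by positivity)))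
  rw [testScale, ← cbrt_sq (by positivity), add_div]
  have e1 : (t : ℝ) / (((n : ℝ) * m) ^ ((1 : ℝ) / 3)) ^ 2 / t
      = (1 / ((n : ℝ) * m) ^ ((1 : ℝ) / 3)) ^ 2 := by field_simp
  have e2 : 19 / 2 * (Real.log (t * √n) / (1 - σ)) / t
      = 19 / 2 * (Real.log (t * √n) / (t * (1 - σ))) := by field_simp
  rw [e1, e2]
  gcongr
  norm_num

/-- The generalisation term for the step size `G / L * (y / t)`. The condition `y ≤ √t` keeps the
contribution of the size of the subgradients bounded. -/
theorem sqrt_generalisation_le (hL : 0 < L) (hCB : C ≤ B) (hG : 0 < G) (hn : 1 ≤ n) (hm : 1 ≤ m)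
    (ht : 1 ≤ t) {y w : ℝ} (hy : 0 ≤ y) (hyt : y ≤ √t) (hyw : y ≤ w) :
    √(((t : ℝ) - 1) * ((G / L * (y / t)) ^ 2 * L ^ 2 + 2 * (G / L * (y / t)) * (B - C))
      / ((n : ℝ) * m)) ≤ √(G ^ 2 + 2 * G * (B - C) / L) * √((1 + w) / ((n : ℝ) * m)) := by
  have ht0 : (0 : ℝ) < t := by positivity
  have hBC : 0 ≤ B - C := by linarith
  have hN : (0 : ℝ) < (n : ℝ) * m := by positivity
  have hassoc : (G ^ 2 + 2 * G * (B - C) / L) * ((1 + w) / ((n : ℝ) * m))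
      = (G ^ 2 + 2 * G * (B - C) / L) * (1 + w) / ((n : ℝ) * m) := by ring
  rw [← Real.sqrt_mul (by positivity), hassoc]
  refine Real.sqrt_le_sqrt ?_
  gcongr ?_ / _
  have hy2 : y ^ 2 ≤ t := by
    have := pow_le_pow_left₀ hy hyt 2
    rwa [Real.sq_sqrt ht0.le] at this
  have hw : 0 ≤ w := hy.trans hyw
  calc _ ≤ (t : ℝ) * ((G / L * (y / t)) ^ 2 * L ^ 2 + 2 * (G / L * (y / t)) * (B - C)) := by
        gcongr; linarith
    _ = G ^ 2 * (y ^ 2 / t) + 2 * G * (B - C) / L * y := by field_simp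
    _ ≤ G ^ 2 * 1 + 2 * G * (B - C) / L * w := by
        gcongr
        exact (div_le_one ht0).2 hy2
    _ ≤ _ := by
        have : 0 ≤ G ^ 2 * w := by positivity
        have : 0 ≤ 2 * G * (B - C) / L := by positivity
        linarith

theorem sqrt_one_add_cbrt_div_le (hn : 1 ≤ n) (hm : 1 ≤ m) :
    √((1 + ((n : ℝ) * m) ^ ((1 : ℝ) / 3)) / ((n : ℝ) * m))
      ≤ 2 * (1 / ((n : ℝ) * m) ^ ((1 : ℝ) / 3)) := by
  have hN : (0 : ℝ) < (n : ℝ) * m := by positivity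
  set p := ((n : ℝ) * m) ^ ((1 : ℝ) / 3) with hp
  have hp1 : 1 ≤ p := by
    refine Real.one_le_rpow ?_ (by norm_num)
    exact_mod_cast Nat.mul_pos hn hm
  have hp3 : p ^ 3 = n * m := cbrt_pow_three hN
  refine Real.sqrt_le_iff.2 ⟨by positivity, ?_⟩
  rw [← hp3, div_le_iff₀ (by positivity)]
  have : (2 * (1 / p)) ^ 2 * p ^ 3 = 4 * p := by field_simp; norm_num
  linarith

theorem le_sqrt_of_le_sqrt_mul (hσ0 : 0 ≤ σ) {y : ℝ} (h : y ≤ √(t * (1 - σ))) : y ≤ √t :=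
  h.trans (Real.sqrt_le_sqrt (mul_le_of_le_one_right (by positivity) (by linarith)))

/-- The variable `y` with `etaOpt = G / L * (y / t)` is at most `√(t * (1 - σ))`. -/
theorem yOpt_le (ht : 1 ≤ t) (htn : 2 ≤ t * n) :
    √(t * (1 - σ)) / √(19 * Real.log (t * √n)) ≤ √(t * (1 - σ)) := by
  have hlog := third_le_log_mul_sqrt ht htn
  exact div_le_self (Real.sqrt_nonneg _) (Real.one_le_sqrt.2 (by linarith))

/-- The variable `y` with `etaTest = G / L * (y / t)` is at most `√(t * (1 - σ))`. -/
theorem yTest_le_sqrt (ht : 1 ≤ t) (htn : 2 ≤ t * n) (hσ : σ < 1) :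
    √t / √(testScale n m t σ) ≤ √(t * (1 - σ)) := by
  have hd : 0 < 1 - σ := by linarith
  have h := three_div_le_testScale (m := m) ht htn hσ
  have hA : 0 < testScale n m t σ := lt_of_lt_of_le (by positivity) h
  rw [← Real.sqrt_div (by positivity)]
  refine Real.sqrt_le_sqrt ?_
  rw [div_le_iff₀ hA, mul_assoc]
  refine le_mul_of_one_le_right (by positivity) ?_
  rw [div_le_iff₀ hd] at h
  linarith

theorem yTest_le_cbrt (hn : 1 ≤ n) (hm : 1 ≤ m) (ht : 1 ≤ t) (hσ : σ < 1) :
    √t / √(testScale n m t σ) ≤ ((n : ℝ) * m) ^ ((1 : ℝ) / 3) := by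
  have h := div_le_testScale hn hm ht hσ
  have hA := testScale_pos hn hm ht hσ
  rw [← Real.sqrt_div (by positivity)]
  refine Real.sqrt_le_iff.2 ⟨by positivity, ?_⟩
  rw [div_le_iff₀ (by positivity)] at h ⊢
  linarith

/-! ### The step sizes up to constants and logarithms, and what they minimise -/

theorem agreeUpTo_etaStar (hL : 0 < L) (hG : 0 < G) (Λ : ℝ) {K : ℝ}
    (hK1 : G / L ≤ K) (hK2 : 5 * (L / G) ≤ K) : AgreeUpTo K 0 Λ (etaStar L G t) (1 / √t) := by
  have h19 : 1 ≤ √(19 : ℝ) := Real.one_le_sqrt.2 (by norm_num)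
  have h19' : √(19 : ℝ) ≤ 5 := Real.sqrt_le_iff.2 ⟨by norm_num, by norm_num⟩
  have h0 : (0 : ℝ) < √19 := by linarith
  have hK : 0 ≤ K := le_trans (by positivity) hK1
  have heta : etaStar L G t = G / L / √19 * (1 / √t) := by
    rw [etaStar, Real.sqrt_mul (by norm_num)]; field_simp
  rw [AgreeUpTo, pow_zero, mul_one, heta]
  constructor
  · gcongr
    exact (div_le_self (by positivity) h19).trans hK1
  · rw [← mul_assoc]
    refine le_mul_of_one_le_left (by positivity) ?_
    calc (1 : ℝ) = 5 * (L / G) * (G / L / 5) := by field_simp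
      _ ≤ K * (G / L / √19) := by gcongr

theorem agreeUpTo_etaOpt (hL : 0 < L) (hG : 0 < G) (hn : 1 ≤ n) (hm : 1 ≤ m) (ht : 1 ≤ t)
    (htn : 2 ≤ t * n) (hσ : σ < 1) {K : ℝ}
    (hK1 : G / L ≤ K) (hK2 : 5 * (L / G) ≤ K) :
    AgreeUpTo K 1 (logFactor n m t) (etaOpt L G n t σ) √((1 - σ) / t) := by
  have hd : 0 < 1 - σ := by linarith
  have ht0 : (0 : ℝ) < t := by positivity
  have hΛ := one_le_logFactor hn hm ht
  have hlog := third_le_log_mul_sqrt ht htn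
  have hlogΛ := log_mul_sqrt_le_logFactor hn hm ht
  set ℓ := Real.log (t * √n) with hℓ
  set Λ := logFactor n m t with hΛd
  have hK : 0 < K := lt_of_lt_of_le (by positivity) hK1
  have h1 : 1 ≤ √(19 * ℓ) := Real.one_le_sqrt.2 (by linarith)
  have h2 : √(19 * ℓ) ≤ 5 * Λ := Real.sqrt_le_iff.2 ⟨by positivity, by nlinarith⟩
  have h0 : 0 < √(19 * ℓ) := by linarith
  have heta : etaOpt L G n t σ = G / L / √(19 * ℓ) * √((1 - σ) / t) := by
    have h19 : (0 : ℝ) ≤ 19 := by norm_num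
    rw [etaOpt, ← hℓ, Real.sqrt_mul h19, Real.sqrt_mul h19, Real.sqrt_div hd.le,
      Real.sqrt_div hd.le]
    field_simp
  rw [AgreeUpTo, pow_one, heta]
  constructor
  · gcongr
    exact ((div_le_self (by positivity) h1).trans hK1).trans (le_mul_of_one_le_right hK.le hΛ)
  · rw [← mul_assoc]
    refine le_mul_of_one_le_left (by positivity) ?_
    calc (1 : ℝ) = 5 * (L / G) * Λ * (G / L / (5 * Λ)) := by field_simp
      _ ≤ K * Λ * (G / L / √(19 * ℓ)) := by gcongr

theorem agreeUpTo_etaTest (hL : 0 < L) (hG : 0 < G) (hn : 1 ≤ n) (hm : 1 ≤ m) (ht : 1 ≤ t)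
    (htn : 2 ≤ t * n) (hσ : σ < 1) {K : ℝ}
    (hK1 : 2 * (G / L) ≤ K) (hK2 : 5 * (L / G) ≤ K) :
    AgreeUpTo K 1 (logFactor n m t) (etaTest L G n m t σ)
      (1 / √t * (1 / √(9 / (1 - σ) + t / ((n : ℝ) * m) ^ ((2 : ℝ) / 3)))) := by
  have hd : 0 < 1 - σ := by linarith
  have ht0 : (0 : ℝ) < t := by positivity
  have hΛ := one_le_logFactor hn hm ht
  have hlog := third_le_log_mul_sqrt ht htn
  have hlogΛ := log_mul_sqrt_le_logFactor hn hm ht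
  have hA := testScale_pos hn hm ht hσ
  set A' := 9 / (1 - σ) + t / ((n : ℝ) * m) ^ ((2 : ℝ) / 3) with hA'd
  have hτ : 0 ≤ t / ((n : ℝ) * m) ^ ((2 : ℝ) / 3) := by positivity
  have hA' : 0 < A' := by positivity
  have hAA' : A' ≤ 2 ^ 2 * testScale n m t σ := by
    have : 9 / (1 - σ) ≤ 4 * (19 / 2 * (Real.log (t * √n) / (1 - σ))) := by
      rw [← mul_div_assoc, ← mul_div_assoc]
      gcongr
      linarith
    rw [testScale]
    linarith
  have hA'A : testScale n m t σ ≤ (2 * logFactor n m t) ^ 2 * A' := by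
    have h1 : 19 / 2 * (Real.log (t * √n) / (1 - σ)) ≤ (2 * logFactor n m t) ^ 2 * (9 / (1 - σ)) := by
      rw [← mul_div_assoc, ← mul_div_assoc]
      refine div_le_div_of_nonneg_right ?_ hd.le
      nlinarith
    have h2 : t / ((n : ℝ) * m) ^ ((2 : ℝ) / 3)
        ≤ (2 * logFactor n m t) ^ 2 * (t / ((n : ℝ) * m) ^ ((2 : ℝ) / 3)) :=
      le_mul_of_one_le_left hτ (by nlinarith)
    rw [testScale, hA'd, mul_add]
    linarith
  have hr1 : √A' ≤ 2 * √(testScale n m t σ) := by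
    have := Real.sqrt_le_sqrt hAA'
    rwa [Real.sqrt_mul (by norm_num), Real.sqrt_sq (by norm_num)] at this
  have hr2 : √(testScale n m t σ) ≤ 2 * logFactor n m t * √A' := by
    have := Real.sqrt_le_sqrt hA'A
    rwa [Real.sqrt_mul (by positivity), Real.sqrt_sq (by positivity)] at this
  have heta : etaTest L G n m t σ = G / L * (1 / √t * (1 / √(testScale n m t σ))) := by
    rw [etaTest, testScale]; field_simp
  set Λ := logFactor n m t with hΛd
  have hK : 0 < K := lt_of_lt_of_le (by positivity) hK1
  have hsA : 0 < √(testScale n m t σ) := Real.sqrt_pos.2 hA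
  have hsA' : 0 < √A' := Real.sqrt_pos.2 hA'
  rw [AgreeUpTo, pow_one, heta]
  constructor
  · calc G / L * (1 / √t * (1 / √(testScale n m t σ)))
        ≤ G / L * (1 / √t * (2 * (1 / √A'))) := by
          gcongr
          rw [mul_one_div, div_le_div_iff₀ hsA hsA']
          linarith
      _ = 2 * (G / L) * (1 / √t * (1 / √A')) := by ring
      _ ≤ K * Λ * (1 / √t * (1 / √A')) := by
          refine mul_le_mul_of_nonneg_right ?_ (by positivity)
          exact hK1.trans (le_mul_of_one_le_right hK.le hΛ)
  · calc 1 / √t * (1 / √A') ≤ 1 / √t * (2 * Λ * (1 / √(testScale n m t σ))) := by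
          gcongr
          rw [mul_one_div, div_le_div_iff₀ hsA' hsA]
          linarith
      _ = 2 * (L / G) * Λ * (G / L * (1 / √t * (1 / √(testScale n m t σ)))) := by field_simp
      _ ≤ _ := by
          gcongr
          have : 0 < L / G := by positivity
          linarith

theorem optBound_etaOpt_le (hL : 0 < L) (hG : 0 < G) (ht : 1 ≤ t) (htn : 2 ≤ t * n) (hσ : σ < 1)
    {η : ℝ} (hη : 0 < η) : optBound L G n t σ (etaOpt L G n t σ) ≤ optBound L G n t σ η := by
  have hd : 0 < 1 - σ := by linarith
  have ht0 : (0 : ℝ) < t := by positivity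
  have hlog := third_le_log_mul_sqrt ht htn
  set ℓ := Real.log (t * √n) with hℓ
  have hℓ0 : 0 < ℓ := by linarith
  set e := etaOpt L G n t σ with he
  have he0 : 0 < e := by rw [he, etaOpt]; positivity
  -- the two terms of the bound agree at the optimal step size
  have hbal : G ^ 2 / (2 * t) = 19 / 2 * (L ^ 2 * ℓ / (1 - σ)) * e ^ 2 := by
    rw [he, etaOpt, ← hℓ, mul_pow, div_pow, mul_pow, Real.sq_sqrt (by positivity),
      Real.sq_sqrt (by positivity)]
    field_simp
  have hform : ∀ x : ℝ, 0 < x → optBound L G n t σ x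
      = 19 / 2 * (L ^ 2 * ℓ / (1 - σ)) * (x + e ^ 2 / x) := by
    intro x hx
    have h1 : optBound L G n t σ x
        = 19 / 2 * (L ^ 2 * ℓ / (1 - σ)) * x + G ^ 2 / (2 * t) / x := by
      rw [optBound, ← hℓ]; field_simp
    rw [h1, hbal]
    field_simp
  rw [hform e he0, hform η hη]
  refine mul_le_mul_of_nonneg_left ?_ (by positivity)
  have h1 : e + e ^ 2 / e = 2 * e := by field_simp; ring
  rw [h1, ← sub_nonneg]
  have h2 : η + e ^ 2 / η - 2 * e = (η - e) ^ 2 / η := by field_simp; ring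
  rw [h2]
  positivity

/-- A multiple of `(n * m) ^ (-1 / 3)` by this constant is a lower bound of `testBound`. -/
noncomputable def testBoundConst (L B C D G : ℝ) : ℝ :=
  min (2 * D * √(G / L * (B - C))) (G * L / 2)

theorem le_testBound (hL : 0 < L) (hG : 0 < G) (hD : 0 ≤ D) (hCB : C ≤ B) (hn : 1 ≤ n) (hm : 1 ≤ m)
    (ht : 2 ≤ t) (hσ : σ < 1) {η : ℝ} (hη : 0 < η) :
    1 / 2 * (testBoundConst L B C D G * (1 / ((n : ℝ) * m) ^ ((1 : ℝ) / 3))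
      + 2 * (G * L) * (√(Real.log (t * √n)) / √(t * (1 - σ)))) ≤ testBound L B C D G n m t σ η := by
  have hd : 0 < 1 - σ := by linarith
  have ht1 : 1 ≤ t := by omega
  have htn : 2 ≤ t * n := ht.trans (Nat.le_mul_of_pos_right t hn)
  have ht0 : (0 : ℝ) < t := by positivity
  have hBC : 0 ≤ B - C := by linarith
  have hlog := third_le_log_mul_sqrt ht1 htn
  set ℓ := Real.log (t * √n) with hℓ
  have hℓ0 : 0 < ℓ := by linarith
  set p := ((n : ℝ) * m) ^ ((1 : ℝ) / 3) with hpd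
  have hp : 0 < p := by positivity
  have hp3 : p ^ 3 = n * m := cbrt_pow_three (by positivity)
  set c := testBoundConst L B C D G with hc
  have hc0 : 0 ≤ c := le_min (by positivity) (by positivity)
  have hfirst : c * (1 / p) ≤ testBound L B C D G n m t σ η := by
    set y := η * t * L / G with hy
    have hy0 : 0 < y := by positivity
    have h1 : c * √(y / p ^ 3) ≤ 2 * D * √(((t : ℝ) - 1) * (η ^ 2 * L ^ 2 + 2 * η * (B - C))
        / ((n : ℝ) * m)) := by
      calc _ ≤ 2 * D * √(G / L * (B - C)) * √(y / p ^ 3) := by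
            gcongr; exact min_le_left _ _
        _ = 2 * D * √(G / L * (B - C) * (y / p ^ 3)) := by
            rw [Real.sqrt_mul (show 0 ≤ G / L * (B - C) by positivity)]; ring
        _ ≤ _ := by
            gcongr
            rw [hp3, ← mul_div_assoc]
            gcongr ?_ / _
            have e1 : G / L * (B - C) * y = t * (η * (B - C)) := by rw [hy]; field_simp
            have e2 : (t : ℝ) ≤ 2 * ((t : ℝ) - 1) := by
              have : (2 : ℝ) ≤ t := by exact_mod_cast ht
              linarith
            have e3 : 0 ≤ (t : ℝ) - 1 := by linarith
            rw [e1]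
            calc (t : ℝ) * (η * (B - C)) ≤ 2 * ((t : ℝ) - 1) * (η * (B - C)) := by gcongr
              _ ≤ _ := by
                have : 0 ≤ ((t : ℝ) - 1) * (η ^ 2 * L ^ 2) := by positivity
                linarith
    have h2 : c * (1 / y) ≤ optBound L G n t σ η := by
      calc _ ≤ G * L / 2 * (1 / y) := by gcongr; exact min_le_right _ _
        _ = G ^ 2 / (2 * η * t) := by rw [hy]; field_simp
        _ ≤ _ := by rw [optBound]; exact le_add_of_nonneg_left (by positivity)
    have h3 := mul_le_mul_of_nonneg_left (inv_le_inv_add_sqrt hp hy0) hc0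
    rw [testBound]
    linarith
  have hsecond : 2 * (G * L) * (√ℓ / √(t * (1 - σ))) ≤ testBound L B C D G n m t σ η := by
    have h1 := optBound_etaOpt_le hL hG ht1 htn hσ hη
    have h2 : 2 * (G * L) * (√ℓ / √(t * (1 - σ))) ≤ optBound L G n t σ (etaOpt L G n t σ) := by
      have h19 : 4 ≤ √(19 : ℝ) := Real.le_sqrt_of_sq_le (by norm_num)
      have h3 : G ^ 2 / (2 * etaOpt L G n t σ * t)
          = √19 / 2 * (G * L) * (√ℓ / √(t * (1 - σ))) := by
        rw [etaOpt_eq ht1 hσ, ← hℓ, Real.sqrt_mul (show (0 : ℝ) ≤ 19 by norm_num)]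
        field_simp
      calc _ ≤ √19 / 2 * (G * L) * (√ℓ / √(t * (1 - σ))) := by gcongr; linarith
        _ = G ^ 2 / (2 * etaOpt L G n t σ * t) := h3.symm
        _ ≤ _ := by
          rw [optBound]
          refine le_add_of_nonneg_left ?_
          have : 0 ≤ etaOpt L G n t σ := by rw [etaOpt]; positivity
          positivity
    have h4 : 0 ≤ 2 * D * √(((t : ℝ) - 1) * (η ^ 2 * L ^ 2 + 2 * η * (B - C))
        / ((n : ℝ) * m)) := by positivity
    rw [testBound]
    linarith
  linarith

theorem testBound_etaTest_le (hL : 0 < L) (hG : 0 < G) (hD : 0 ≤ D) (hCB : C ≤ B) (hn : 1 ≤ n)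
    (hm : 1 ≤ m) (ht : 1 ≤ t) (htn : 2 ≤ t * n) (hσ0 : 0 ≤ σ) (hσ : σ < 1) :
    testBound L B C D G n m t σ (etaTest L G n m t σ)
      ≤ (4 * D * √(G ^ 2 + 2 * G * (B - C) / L) + 2 * (G * L)) * (1 / ((n : ℝ) * m) ^ ((1 : ℝ) / 3))
        + 6 * (G * L) * (√(Real.log (t * √n)) / √(t * (1 - σ))) := by
  have hd : 0 < 1 - σ := by linarith
  have ht0 : (0 : ℝ) < t := by positivity
  have hA := testScale_pos hn hm ht hσ
  have hsA : 0 < √(testScale n m t σ) := Real.sqrt_pos.2 hA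
  have hst : 0 < √(t : ℝ) := by positivity
  have hst2 : √(t : ℝ) ^ 2 = t := Real.sq_sqrt ht0.le
  have hsA2 : √(testScale n m t σ) ^ 2 = testScale n m t σ := Real.sq_sqrt hA.le
  set y := √t / √(testScale n m t σ) with hy
  have hy0 : 0 < y := by positivity
  have hgen := sqrt_generalisation_le (L := L) (G := G) hL hCB hG hn hm ht hy0.le
    (le_sqrt_of_le_sqrt_mul hσ0 (yTest_le_sqrt (m := m) ht htn hσ)) (yTest_le_cbrt hn hm ht hσ)
  have hone := sqrt_one_add_cbrt_div_le hn hm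
  have hscale := sqrt_testScale_div_le hn hm ht hσ
  have hopt : optBound L G n t σ (etaTest L G n m t σ)
      ≤ 3 / 2 * (G * L) * (√(testScale n m t σ) / √t) := by
    have h1 : 19 / 2 * (etaTest L G n m t σ * L ^ 2 * Real.log (t * √n) / (1 - σ))
        ≤ G * L * (√(testScale n m t σ) / √t) := by
      have h2 : 19 / 2 * (Real.log (t * √n) / (1 - σ)) ≤ testScale n m t σ := by
        rw [testScale]; exact le_add_of_nonneg_right (by positivity)
      rw [etaTest_eq, ← hy]
      calc _ = G * L * (y / t) * (19 / 2 * (Real.log (t * √n) / (1 - σ))) := by field_simp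
        _ ≤ G * L * (y / t) * testScale n m t σ := by gcongr
        _ = _ := by
          rw [hy]
          nth_rw 2 [← hsA2]
          nth_rw 2 [← hst2]
          field_simp
    have h3 : G ^ 2 / (2 * etaTest L G n m t σ * t)
        = 1 / 2 * (G * L) * (√(testScale n m t σ) / √t) := by
      rw [etaTest_eq]
      field_simp
    rw [optBound, h3]
    linarith
  have hM : 0 ≤ 2 * D * √(G ^ 2 + 2 * G * (B - C) / L) := by positivity
  have h5 := mul_le_mul_of_nonneg_left hone hM
  have h6 := mul_le_mul_of_nonneg_left hgen (by positivity : 0 ≤ 2 * D)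
  have h7 := mul_le_mul_of_nonneg_left hscale (by positivity : 0 ≤ 3 / 2 * (G * L))
  have h8 : 0 ≤ G * L * (1 / ((n : ℝ) * m) ^ ((1 : ℝ) / 3)) := by positivity
  rw [← etaTest_eq] at h6
  rw [testBound]
  linarith

theorem testBound_etaTest_le_mul (hL : 0 < L) (hG : 0 < G) (hD : 0 < D) (hCB : C < B) (hn : 1 ≤ n)
    (hm : 1 ≤ m) (ht : 2 ≤ t) (hσ0 : 0 ≤ σ) (hσ : σ < 1) {K : ℝ}
    (hK : 6 + 2 * (4 * D * √(G ^ 2 + 2 * G * (B - C) / L) + 2 * (G * L))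
      / testBoundConst L B C D G ≤ K) {η : ℝ} (hη : 0 < η) :
    testBound L B C D G n m t σ (etaTest L G n m t σ) ≤ K * testBound L B C D G n m t σ η := by
  have hd : 0 < 1 - σ := by linarith
  have hBC : 0 < B - C := by linarith
  have htn : 2 ≤ t * n := ht.trans (Nat.le_mul_of_pos_right t hn)
  have h1 := testBound_etaTest_le hL hG hD.le hCB.le hn hm (by omega) htn hσ0 hσ
  have h2 := le_testBound hL hG hD.le hCB.le hn hm ht hσ hη
  have hc : 0 < testBoundConst L B C D G := lt_min (by positivity) (by positivity)
  set M := 4 * D * √(G ^ 2 + 2 * G * (B - C) / L) + 2 * (G * L) with hM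
  have hM0 : 0 < M := by positivity
  set c := testBoundConst L B C D G with hcd
  have hK0 : 0 ≤ K := le_trans (by positivity) hK
  set a := 1 / ((n : ℝ) * m) ^ ((1 : ℝ) / 3) with ha
  set b := √(Real.log (t * √n)) / √(t * (1 - σ)) with hb
  have ha0 : 0 ≤ a := by positivity
  have hb0 : 0 ≤ b := by positivity
  have h3 : M ≤ K * (c / 2) := by
    calc M = 2 * M / c * (c / 2) := by field_simp
      _ ≤ K * (c / 2) := by gcongr; linarith
  have h4 : 6 ≤ K := le_trans (le_add_of_nonneg_right (by positivity)) hK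
  have h5 := mul_le_mul_of_nonneg_right h3 ha0
  have h6 : 6 * (G * L * b) ≤ K * (G * L * b) := by gcongr
  have h7 := mul_le_mul_of_nonneg_left h2 hK0
  linarith

end StepSizes

/-! ### The test error for the three step sizes -/

namespace DistributedProblem

variable {n m t : ℕ} {L B C D G : ℝ} (S : DistributedProblem.{u, v} n m L B C D G)

theorem σ₂_nonneg : 0 ≤ S.σ₂ := secondEigenvalue_nonneg S.P

theorem σ₂_lt_one : S.σ₂ < 1 := S.spectral_gap

/-- The test error in terms of the variable `y` of the step size; `w` is the bound of `y` that enters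
the radius of the ball of the models. -/
theorem testError_le_of_eq (hL : 0 < L) (hCB : C ≤ B) (hD : 0 ≤ D) (hG : 0 < G) (ht : 1 ≤ t)
    (v : Fin n) {η y w : ℝ} (hη : η = G / L * (y / t)) (hy : 0 < y) (hyt : y ≤ √t) (hyw : y ≤ w) :
    S.testError η t v ≤ 2 * D * √(G ^ 2 + 2 * G * (B - C) / L) * √((1 + w) / ((n : ℝ) * m))
      + G * L * (1 / (2 * y) + 10 * logFactor n m t * y / (t * (1 - S.σ₂))) := by
  have ht0 : (0 : ℝ) < t := by positivity
  have hη0 : 0 < η := by rw [hη]; positivity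
  have hm := S.sample_size_pos v
  have hd : 0 < 1 - S.σ₂ := sub_pos.2 S.σ₂_lt_one
  have h1 := S.testError_le hL.le hCB hD hG.le hη0 ht v
  have h2 := sqrt_generalisation_le hL hCB hG v.pos hm ht hy.le hyt hyw
  have h3 := mul_le_mul_of_nonneg_left h2 (by positivity : 0 ≤ 2 * D)
  rw [← hη] at h3
  have h4 : G ^ 2 / (2 * η * t) = G * L * (1 / (2 * y)) := by rw [hη]; field_simp
  have h5 : 10 * (η * L ^ 2 * (1 + Real.log n) / (1 - S.σ₂))
      ≤ G * L * (10 * logFactor n m t * y / (t * (1 - S.σ₂))) := by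
    calc _ = G * L * (10 * (1 + Real.log n) * y / (t * (1 - S.σ₂))) := by rw [hη]; field_simp
      _ ≤ _ := by
        gcongr
        exact one_add_log_le_logFactor v.pos hm ht
  linarith

theorem testError_etaStar_le (hL : 0 < L) (hCB : C ≤ B) (hD : 0 ≤ D) (hG : 0 < G) (ht : 1 ≤ t)
    (v : Fin n) {K : ℝ} (hK : 4 * D * √(G ^ 2 + 2 * G * (B - C) / L) + 13 * (G * L) ≤ K) :
    S.testError (etaStar L G t) t v ≤ K * logFactor n m t * rateStar n m t S.σ₂ := by
  have ht0 : (0 : ℝ) < t := by positivity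
  have hm := S.sample_size_pos v
  have hn := v.pos
  have hd : 0 < 1 - S.σ₂ := sub_pos.2 S.σ₂_lt_one
  have hd1 : 1 - S.σ₂ ≤ 1 := sub_le_self _ S.σ₂_nonneg
  have hΛ := one_le_logFactor (t := t) hn hm ht
  set Λ := logFactor n m t
  have hst : 1 ≤ √(t : ℝ) := Real.one_le_sqrt.2 (by exact_mod_cast ht)
  have hst2 : √(t : ℝ) ^ 2 = t := Real.sq_sqrt ht0.le
  have h19 : 1 ≤ √(19 : ℝ) := Real.one_le_sqrt.2 (by norm_num)
  have h19' : √(19 : ℝ) ≤ 6 := Real.sqrt_le_iff.2 ⟨by norm_num, by norm_num⟩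
  have hyt : √(t : ℝ) / √19 ≤ √t := div_le_self (by positivity) h19
  refine (S.testError_le_of_eq hL hCB hD hG ht v etaStar_eq (by positivity) hyt hyt).trans ?_
  set M := √(G ^ 2 + 2 * G * (B - C) / L)
  set δ := 1 - S.σ₂
  have h1 : √((1 + √t) / ((n : ℝ) * m)) ≤ 2 * √(√t / ((n : ℝ) * m)) := by
    have h4 : (2 : ℝ) = √(2 ^ 2) := by rw [Real.sqrt_sq (by norm_num)]
    rw [h4, ← Real.sqrt_mul (by norm_num), ← mul_div_assoc]
    gcongr
    linarith
  have h2 : 1 / (2 * (√(t : ℝ) / √19)) ≤ 3 * (Λ * (1 / (δ * √t))) := by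
    calc 1 / (2 * (√(t : ℝ) / √19)) = √19 / 2 * (1 * (1 / (1 * √t))) := by field_simp
      _ ≤ 3 * (Λ * (1 / (δ * √t))) := by gcongr; linarith
  have h3 : 10 * Λ * (√(t : ℝ) / √19) / (t * δ) ≤ 10 * (Λ * (1 / (δ * √t))) := by
    calc _ ≤ 10 * Λ * √(t : ℝ) / (t * δ) := by gcongr
      _ = _ := by
        nth_rw 2 [← hst2]
        field_simp
  have h5 : √(√t / ((n : ℝ) * m)) ≤ Λ * √(√t / ((n : ℝ) * m)) :=
    le_mul_of_one_le_left (by positivity) hΛ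
  have hX : 0 ≤ Λ * (1 / (δ * √t)) := by positivity
  have hY : 0 ≤ Λ * √(√t / ((n : ℝ) * m)) := by positivity
  have hGL : 0 < G * L := by positivity
  have hDM : 0 ≤ D * M := by positivity
  calc _ ≤ 2 * D * M * (2 * (Λ * √(√t / ((n : ℝ) * m))))
        + G * L * (3 * (Λ * (1 / (δ * √t))) + 10 * (Λ * (1 / (δ * √t)))) := by
        gcongr
        exact h1.trans (by gcongr)
    _ = 4 * D * M * (Λ * √(√t / ((n : ℝ) * m))) + 13 * (G * L) * (Λ * (1 / (δ * √t))) := by ring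
    _ ≤ K * (Λ * √(√t / ((n : ℝ) * m))) + K * (Λ * (1 / (δ * √t))) := by
        gcongr <;> linarith
    _ = _ := by rw [rateStar]; ring

theorem testError_etaOpt_le (hL : 0 < L) (hCB : C ≤ B) (hD : 0 ≤ D) (hG : 0 < G) (ht : 1 ≤ t)
    (htn : 2 ≤ t * n) (v : Fin n) {K : ℝ}
    (hK : 4 * D * √(G ^ 2 + 2 * G * (B - C) / L) + 13 * (G * L) ≤ K) :
    S.testError (etaOpt L G n t S.σ₂) t v ≤ K * logFactor n m t * rateOpt n m t S.σ₂ := by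
  have ht0 : (0 : ℝ) < t := by positivity
  have hm := S.sample_size_pos v
  have hn := v.pos
  have hd : 0 < 1 - S.σ₂ := sub_pos.2 S.σ₂_lt_one
  have hΛ := one_le_logFactor (t := t) hn hm ht
  have hlog := third_le_log_mul_sqrt ht htn
  have hlogΛ := log_mul_sqrt_le_logFactor hn hm ht
  have hu := yOpt_le (σ := S.σ₂) ht htn
  have hu0 : 0 < √(t * (1 - S.σ₂)) := by positivity
  have hu2 : √(t * (1 - S.σ₂)) ^ 2 = t * (1 - S.σ₂) := Real.sq_sqrt (by positivity)
  have hlow := (rates_lower_bound (t := t) hn hm ht S.σ₂_lt_one).2.1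
  have hℓ0 : 0 < Real.log (t * √n) := by linarith
  refine (S.testError_le_of_eq hL hCB hD hG ht v (etaOpt_eq ht S.σ₂_lt_one) (by positivity)
    (le_sqrt_of_le_sqrt_mul S.σ₂_nonneg hu) hu).trans ?_
  set Λ := logFactor n m t
  set ℓ := Real.log (t * √n)
  set M := √(G ^ 2 + 2 * G * (B - C) / L)
  set δ := 1 - S.σ₂
  set w := √(t * δ)
  have h19 : √(19 * ℓ) ≤ 6 * Λ := Real.sqrt_le_iff.2 ⟨by positivity, by nlinarith⟩
  have hs0 : 0 < √(19 * ℓ) := by positivity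
  have h1 : √((1 + w) / ((n : ℝ) * m)) ≤ 2 * rateOpt n m t S.σ₂ := by
    have hN1 : (1 : ℝ) ≤ (n : ℝ) * m := by exact_mod_cast Nat.mul_pos hn hm
    have e1 : √(1 / ((n : ℝ) * m)) ≤ 1 / ((n : ℝ) * m) ^ ((1 : ℝ) / 3) := by
      rw [Real.sqrt_div zero_le_one, Real.sqrt_one, Real.sqrt_eq_rpow]
      exact one_div_le_one_div_of_le (by positivity)
        (Real.rpow_le_rpow_of_exponent_le hN1 (by norm_num))
    have e2 : √(w / ((n : ℝ) * m)) ≤ rateOpt n m t S.σ₂ := by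
      rw [rateOpt]; exact le_add_of_nonneg_left (by positivity)
    have e3 := sqrt_add_le_add_sqrt (x := 1 / ((n : ℝ) * m)) (y := w / ((n : ℝ) * m))
      (by positivity) (by positivity)
    rw [← add_div] at e3
    linarith
  have h2 : 1 / (2 * (w / √(19 * ℓ))) ≤ 3 * (Λ * (1 / w)) := by
    calc 1 / (2 * (w / √(19 * ℓ))) = √(19 * ℓ) / 2 * (1 / w) := by field_simp
      _ ≤ 6 * Λ / 2 * (1 / w) := by gcongr
      _ = _ := by ring
  have h3 : 10 * Λ * (w / √(19 * ℓ)) / (t * δ) ≤ 10 * (Λ * (1 / w)) := by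
    calc _ ≤ 10 * Λ * w / (t * δ) := by gcongr
      _ = _ := by rw [← hu2]; field_simp
  have h4 : 1 / w ≤ rateOpt n m t S.σ₂ := by
    rw [rateOpt]; exact le_add_of_nonneg_right (by positivity)
  have hR : 0 ≤ rateOpt n m t S.σ₂ := le_trans (by positivity) h4
  calc _ ≤ 2 * D * M * (2 * (Λ * rateOpt n m t S.σ₂))
        + G * L * (3 * (Λ * rateOpt n m t S.σ₂) + 10 * (Λ * rateOpt n m t S.σ₂)) := by
        gcongr
        · exact h1.trans (by gcongr; exact le_mul_of_one_le_left hR hΛ)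
        · exact h2.trans (by gcongr)
        · exact h3.trans (by gcongr)
    _ = (4 * D * M + 13 * (G * L)) * (Λ * rateOpt n m t S.σ₂) := by ring
    _ ≤ K * (Λ * rateOpt n m t S.σ₂) := by gcongr
    _ = _ := by ring

theorem testError_etaTest_le (hL : 0 < L) (hCB : C ≤ B) (hD : 0 ≤ D) (hG : 0 < G) (ht : 1 ≤ t)
    (v : Fin n) {K : ℝ}
    (hK : 4 * D * √(G ^ 2 + 2 * G * (B - C) / L) + 13 * (G * L) + (B - C) ≤ K) :
    S.testError (etaTest L G n m t S.σ₂) t v ≤ K * logFactor n m t * rateTest n m t S.σ₂ := by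
  have ht0 : (0 : ℝ) < t := by positivity
  have hm := S.sample_size_pos v
  have hn := v.pos
  have hBC : 0 ≤ B - C := by linarith
  have hd : 0 < 1 - S.σ₂ := sub_pos.2 S.σ₂_lt_one
  have hd1 : 1 - S.σ₂ ≤ 1 := sub_le_self _ S.σ₂_nonneg
  have hΛ := one_le_logFactor (t := t) hn hm ht
  have hDM : 0 ≤ 4 * D * √(G ^ 2 + 2 * G * (B - C) / L) := by positivity
  have hGL : 0 < G * L := by positivity
  rcases Nat.lt_or_ge (t * n) 2 with htn | htn
  -- for `t * n = 1` the step size is large, but no update has taken place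
  · obtain rfl : t = 1 := by nlinarith
    have h1 : 1 ≤ rateTest n m 1 S.σ₂ := by
      have h2 : 1 ≤ 1 / √(((1 : ℕ) : ℝ) * (1 - S.σ₂)) := by
        rw [one_le_div (by positivity), Nat.cast_one, one_mul]
        exact Real.sqrt_le_one.2 hd1
      rw [rateTest]
      exact h2.trans (le_add_of_nonneg_right (by positivity))
    have h3 : 1 ≤ logFactor n m 1 * rateTest n m 1 S.σ₂ := one_le_mul_of_one_le_of_one_le hΛ h1
    have h4 : B - C ≤ K := by linarith
    calc _ ≤ B - C := S.testError_one_le hL.le _ v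
      _ ≤ K * 1 := by linarith
      _ ≤ K * (logFactor n m 1 * rateTest n m 1 S.σ₂) :=
          mul_le_mul_of_nonneg_left h3 (hBC.trans h4)
      _ = _ := by ring
  have hlog := third_le_log_mul_sqrt ht htn
  have hlogΛ := log_mul_sqrt_le_logFactor hn hm ht
  have hA := testScale_pos (t := t) hn hm ht S.σ₂_lt_one
  have hu := yTest_le_sqrt (m := m) ht htn S.σ₂_lt_one
  have hscale := sqrt_testScale_div_le (t := t) hn hm ht S.σ₂_lt_one
  have hu0 : 0 < √(t * (1 - S.σ₂)) := by positivity
  have hu2 : √(t * (1 - S.σ₂)) ^ 2 = t * (1 - S.σ₂) := Real.sq_sqrt (by positivity)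
  have hsA : 0 < √(testScale n m t S.σ₂) := Real.sqrt_pos.2 hA
  refine (S.testError_le_of_eq hL hCB hD hG ht v etaTest_eq (by positivity)
    (le_sqrt_of_le_sqrt_mul S.σ₂_nonneg hu)
    (yTest_le_cbrt hn hm ht S.σ₂_lt_one)).trans ?_
  set Λ := logFactor n m t
  set ℓ := Real.log (t * √n)
  set M := √(G ^ 2 + 2 * G * (B - C) / L)
  set δ := 1 - S.σ₂
  set w := √(t * δ)
  set a := 1 / ((n : ℝ) * m) ^ ((1 : ℝ) / 3) with ha
  have ha0 : 0 ≤ a := by positivity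
  have h1 := sqrt_one_add_cbrt_div_le hn hm
  rw [← ha] at h1
  have haΛ : a ≤ Λ * a := le_mul_of_one_le_left ha0 hΛ
  have h2 : 1 / (2 * (√(t : ℝ) / √(testScale n m t S.σ₂))) ≤ 2 * (Λ * (1 / w)) + Λ * a := by
    have hsℓ : √ℓ ≤ Λ := Real.sqrt_le_iff.2 ⟨by positivity, by nlinarith⟩
    have e1 : √ℓ / w ≤ Λ * (1 / w) := by rw [mul_one_div]; gcongr
    calc 1 / (2 * (√(t : ℝ) / √(testScale n m t S.σ₂)))
        = 1 / 2 * (√(testScale n m t S.σ₂) / √t) := by field_simp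
      _ ≤ _ := by linarith
  have h3 : 10 * Λ * (√(t : ℝ) / √(testScale n m t S.σ₂)) / (t * δ) ≤ 10 * (Λ * (1 / w)) := by
    calc _ ≤ 10 * Λ * w / (t * δ) := by gcongr
      _ = _ := by rw [← hu2]; field_simp
  have hw : 0 ≤ Λ * (1 / w) := by positivity
  calc _ ≤ 2 * D * M * (2 * (Λ * a))
        + G * L * (2 * (Λ * (1 / w)) + Λ * a + 10 * (Λ * (1 / w))) := by
        gcongr
        exact h1.trans (by gcongr)
    _ = (4 * D * M + G * L) * (Λ * a) + 12 * (G * L) * (Λ * (1 / w)) := by ring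
    _ ≤ K * (Λ * a) + K * (Λ * (1 / w)) := by
        gcongr <;> linarith
    _ = _ := by rw [rateTest]; ring

end DistributedProblem

/-! ### Constants and stopping times -/

theorem one_add_mul_logFactor_pow_le {a Λ : ℝ} (hΛ : 1 ≤ Λ) (q : ℕ) :
    1 + a * Λ ^ q ≤ (1 + a) * Λ ^ q := by
  have := one_le_pow₀ hΛ (n := q)
  linarith

/-- At a time that agrees with the stopping time up to `a * Λ ^ q`, a rate is at most
`2 * (1 + a * Λ ^ q)` times its minimum `x`. -/
theorem bound_at_stopping_time {K Λ a rate x err : ℝ} {q : ℕ} (hK : 0 ≤ K) (hΛ : 1 ≤ Λ)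
    (hx : 0 ≤ x) (herr : err ≤ K * Λ * rate) (hrate : rate ≤ 2 * (1 + a * Λ ^ q) * x) :
    err ≤ K * (2 * (1 + a)) * Λ ^ (q + 1) * x := by
  calc err ≤ K * Λ * rate := herr
    _ ≤ K * Λ * (2 * ((1 + a) * Λ ^ q) * x) := by
        gcongr
        exact hrate.trans (by
          gcongr
          exact one_add_mul_logFactor_pow_le hΛ q)
    _ = _ := by ring

theorem mainTheorem4 (L B C D G : ℝ) (hL : 0 < L) (hCB : C ≤ B) (hD : 0 ≤ D) (hG : 0 < G) :
    ∃ K : ℝ, 0 < K ∧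
      -- the step sizes: their order of magnitude, and what they minimise
      (∀ (n m t : ℕ) (σ : ℝ), 1 ≤ n → 1 ≤ m → 1 ≤ t → 2 ≤ t * n → 0 ≤ σ → σ < 1 →
        AgreeUpTo K 0 (logFactor n m t) (etaStar L G t) (1 / √t) ∧
        AgreeUpTo K 1 (logFactor n m t) (etaOpt L G n t σ) √((1 - σ) / t) ∧
        AgreeUpTo K 1 (logFactor n m t) (etaTest L G n m t σ)
          (1 / √t * (1 / √(9 / (1 - σ) + t / ((n : ℝ) * m) ^ ((2 : ℝ) / 3)))) ∧
        (∀ η : ℝ, 0 < η → optBound L G n t σ (etaOpt L G n t σ) ≤ optBound L G n t σ η) ∧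
        (0 < D → C < B → 2 ≤ t → ∀ η : ℝ, 0 < η →
          testBound L B C D G n m t σ (etaTest L G n m t σ)
            ≤ K * testBound L B C D G n m t σ η)) ∧
      -- the test error at any time
      (∀ (n m t : ℕ) (S : DistributedProblem.{u, v} n m L B C D G) (v : Fin n), 1 ≤ t →
        S.testError (etaStar L G t) t v ≤ K * logFactor n m t * rateStar n m t S.σ₂ ∧
        (2 ≤ t * n →
          S.testError (etaOpt L G n t S.σ₂) t v ≤ K * logFactor n m t * rateOpt n m t S.σ₂) ∧
        S.testError (etaTest L G n m t S.σ₂) t v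
          ≤ K * logFactor n m t * rateTest n m t S.σ₂) ∧
      -- the test error at the early stopping time
      (∀ (a : ℝ) (q : ℕ), 0 < a → ∃ K' : ℝ, 0 < K' ∧
        ∀ (n m t : ℕ) (S : DistributedProblem.{u, v} n m L B C D G) (v : Fin n), 1 ≤ t →
          (AgreeUpTo a q (logFactor n m t) t (stopStar n m S.σ₂) →
            S.testError (etaStar L G t) t v
              ≤ K' * logFactor n m t ^ (q + 1)
                * (1 / ((n : ℝ) * m * (1 - S.σ₂)) ^ ((1 : ℝ) / 3))) ∧
          (2 ≤ t * n → AgreeUpTo a q (logFactor n m t) t (stopGraph n m S.σ₂) →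
            S.testError (etaOpt L G n t S.σ₂) t v
              ≤ K' * logFactor n m t ^ (q + 1) * (1 / ((n : ℝ) * m) ^ ((1 : ℝ) / 3))) ∧
          (stopGraph n m S.σ₂ ≤ a * logFactor n m t ^ q * t →
            S.testError (etaTest L G n m t S.σ₂) t v
              ≤ K' * logFactor n m t ^ (q + 1) * (1 / ((n : ℝ) * m) ^ ((1 : ℝ) / 3)))) ∧
      -- the early stopping times are the ones that minimise the orders of the bounds
      (∀ (n m t : ℕ) (σ : ℝ), 1 ≤ n → 1 ≤ m → 1 ≤ t → 0 ≤ σ → σ < 1 →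
        1 / ((n : ℝ) * m * (1 - σ)) ^ ((1 : ℝ) / 3) ≤ rateStar n m t σ ∧
        1 / ((n : ℝ) * m) ^ ((1 : ℝ) / 3) ≤ rateOpt n m t σ ∧
        1 / ((n : ℝ) * m) ^ ((1 : ℝ) / 3) ≤ rateTest n m t σ ∧
        ∀ κ : ℝ,
          (rateStar n m t σ ≤ κ * (1 / ((n : ℝ) * m * (1 - σ)) ^ ((1 : ℝ) / 3)) →
            stopStar n m σ ≤ κ ^ 2 * t ∧ t ≤ κ ^ 4 * stopStar n m σ) ∧
          (rateOpt n m t σ ≤ κ * (1 / ((n : ℝ) * m) ^ ((1 : ℝ) / 3)) →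
            stopGraph n m σ ≤ κ ^ 2 * t ∧ t ≤ κ ^ 4 * stopGraph n m σ) ∧
          (rateTest n m t σ ≤ κ * (1 / ((n : ℝ) * m) ^ ((1 : ℝ) / 3)) →
            stopGraph n m σ ≤ κ ^ 2 * t)) := by
  have hBC : 0 ≤ B - C := by linarith
  have hGL : 0 < G * L := by positivity
  have hgl : 0 < G / L := by positivity
  have hlg : 0 < L / G := by positivity
  have hM : 0 ≤ 4 * D * √(G ^ 2 + 2 * G * (B - C) / L) := by positivity
  have hc : 0 ≤ testBoundConst L B C D G := le_min (by positivity) (by positivity)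
  have hE : 0 ≤ 2 * (4 * D * √(G ^ 2 + 2 * G * (B - C) / L) + 2 * (G * L))
      / testBoundConst L B C D G := by positivity
  -- the first two terms serve the orders of the step sizes, the third one the minimality of
  -- `etaTest`, and the last one the test error
  obtain ⟨K, hK⟩ : ∃ K, K = 2 * (G / L) + 5 * (L / G)
      + (6 + 2 * (4 * D * √(G ^ 2 + 2 * G * (B - C) / L) + 2 * (G * L))
        / testBoundConst L B C D G)
      + (4 * D * √(G ^ 2 + 2 * G * (B - C) / L) + 13 * (G * L) + (B - C)) := ⟨_, rfl⟩
  have hK0 : 0 < K := by linarith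
  have herr : ∀ (n m t : ℕ) (S : DistributedProblem.{u, v} n m L B C D G) (v : Fin n), 1 ≤ t →
      S.testError (etaStar L G t) t v ≤ K * logFactor n m t * rateStar n m t S.σ₂ ∧
      (2 ≤ t * n →
        S.testError (etaOpt L G n t S.σ₂) t v ≤ K * logFactor n m t * rateOpt n m t S.σ₂) ∧
      S.testError (etaTest L G n m t S.σ₂) t v ≤ K * logFactor n m t * rateTest n m t S.σ₂ :=
    fun n m t S v ht => ⟨S.testError_etaStar_le hL hCB hD hG ht v (by linarith),
      fun htn => S.testError_etaOpt_le hL hCB hD hG ht htn v (by linarith),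
      S.testError_etaTest_le hL hCB hD hG ht v (by linarith)⟩
  refine ⟨K, hK0, ?_, herr, ?_, ?_⟩
  · intro n m t σ hn hm ht htn hσ0 hσ
    exact ⟨agreeUpTo_etaStar hL hG _ (by linarith) (by linarith),
      agreeUpTo_etaOpt hL hG hn hm ht htn hσ (by linarith) (by linarith),
      agreeUpTo_etaTest hL hG hn hm ht htn hσ (by linarith) (by linarith),
      fun η hη => optBound_etaOpt_le hL hG ht htn hσ hη,
      fun hD' hCB' ht2 η hη =>
        testBound_etaTest_le_mul hL hG hD' hCB' hn hm ht2 hσ0 hσ (by linarith) hη⟩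
  · intro a q ha
    refine ⟨K * (2 * (1 + a)), by positivity, fun n m t S v ht => ?_⟩
    have hn : 1 ≤ n := v.pos
    have hm : 1 ≤ m := S.sample_size_pos v
    have hΛ := one_le_logFactor hn hm ht
    have hA : 0 ≤ a * logFactor n m t ^ q := by positivity
    have hd : 0 < 1 - S.σ₂ := sub_pos.2 S.σ₂_lt_one
    obtain ⟨h1, h2, h3⟩ := herr n m t S v ht
    refine ⟨fun h => ?_, fun htn h => ?_, fun h => ?_⟩
    · exact bound_at_stopping_time hK0.le hΛ (by positivity) h1
        (rateStar_le_of_agree hn hm ht S.σ₂_lt_one hA h.1 h.2)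
    · exact bound_at_stopping_time hK0.le hΛ (by positivity) (h2 htn)
        (rateOpt_le_of_agree hn hm ht S.σ₂_lt_one hA h.1 h.2)
    · exact bound_at_stopping_time hK0.le hΛ (by positivity) h3
        (rateTest_le_of_stop_le hn hm ht S.σ₂_lt_one hA h)
  · intro n m t σ hn hm ht hσ0 hσ
    obtain ⟨h1, h2, h3⟩ := rates_lower_bound hn hm ht hσ
    exact ⟨h1, h2, h3, stop_of_rate_le hn hm ht hσ⟩
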